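/- Let $T>0$, let $\Omega\subset\mathbb R^3$ be a bounded open set (for instance a bounded domain), put $Q_T=(0,T)\times\Omega$, and let $N\in\mathbb N$. Let $R\in\big(L^2(0,T;L^2(\Omega))\big)^N$ and let $u\in L^2(0,T;H^1_0(\Omega))$ be a vector field with values in $\mathbb R^3$, where $H^1_0(\Omega)$ is the closure of $C_c^\infty(\Omega)$ in $H^1(\Omega)$. Suppose that $$\partial_t R+\mathrm{div}(u\otimes R)=0\quad\text{in }\mathcal D'(Q_T),$$ that is, $\partial_tR_i+\mathrm{div}(R_i u)=0$ in $\mathcal D'(Q_T)$ for $i=1,\dots,N$. Then: (1) For every $C^1$ function $\beta:\mathbb R^N\to\mathbb R$ with bounded gradient, $$\partial_t\beta(R)+\mathrm{div}(\beta(R)u)+[\nabla\beta(R)\cdot R-\beta(R)]\,\mathrm{div}\,u=0\quad\text{in }\mathcal D'(Q_T).$$ (2) If moreover $R\in L^\infty(0,T;L^\gamma(\Omega))$ for some real $\gamma>1$, then (after modification on a null set of times) $R\in C([0,T];L^1(\Omega))$. If in addition $R|_{t=0}=R_0$ in the sense of distributions for some $R_0\in L^1_{\mathrm{loc}}(\Omega)^N$,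 i.e. $$\int_0^T\!\!\int_\Omega R_i\,(\partial_t\varphi+u\cdot\nabla\varphi)\,dx\,dt+\int_\Omega R_{0,i}\,\varphi(0,\cdot)\,dx=0\qquad\text{for all }\varphi\in C_c^\infty([0,T)\times\Omega),\ i=1,\dots,N,$$ then this continuous representative satisfies $R(0)=R_0$ a.e. in $\Omega$, and for every $C^1$ function $\beta:\mathbb R^N\to\mathbb R$ with bounded gradient and every $t\in[0,T]$, $$\int_\Omega\beta(R(t))\,dx=\int_\Omega\beta(R_0)\,dx-\int_0^t\!\!\int_\Omega[\nabla\beta(R)\cdot R-\beta(R)]\,\mathrm{div}\,u\,dx\,ds,$$ where all three integrals converge absolutely. -/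

import Mathlib

open MeasureTheory Set Filter Topology
open scoped ContDiff

/-- Physical space `ℝ³`. -/
abbrev Space3 : Type := EuclideanSpace ℝ (Fin 3)

/-- `φ` is a test function on the open set `U`, that is `φ ∈ C_c^∞(U)`. -/
def IsTestOn {X F : Type*} [NormedAddCommGroup X] [NormedSpace ℝ X]
    [NormedAddCommGroup F] [NormedSpace ℝ F] (U : Set X) (φ : X → F) : Prop :=
  ContDiff ℝ ∞ φ ∧ HasCompactSupport φ ∧ tsupport φ ⊆ U

/-- `G` is the weak (distributional) gradient of the vector field `v` on `Ω`. -/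
def HasWeakGradient (Ω : Set Space3) (v : Space3 → Space3)
    (G : Space3 → Space3 →L[ℝ] Space3) : Prop :=
  ∀ φ : Space3 → ℝ, IsTestOn Ω φ → ∀ e : Space3,
    ∫ x in Ω, φ x • G x e = - ∫ x in Ω, (fderiv ℝ φ x e) • v x

/-- `v ∈ H¹(Ω)³` with weak gradient `G`. -/
def MemH1 (Ω : Set Space3) (v : Space3 → Space3)
    (G : Space3 → Space3 →L[ℝ] Space3) : Prop :=
  MemLp v 2 (volume.restrict Ω) ∧ MemLp G 2 (volume.restrict Ω) ∧ HasWeakGradient Ω v G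

/-- `v ∈ H¹₀(Ω)³` with weak gradient `G`: `v` is a limit in the `H¹`-norm of vector fields in
`C_c^∞(Ω)`. -/
def MemH10 (Ω : Set Space3) (v : Space3 → Space3)
    (G : Space3 → Space3 →L[ℝ] Space3) : Prop :=
  MemH1 Ω v G ∧
    ∃ φ : ℕ → Space3 → Space3, (∀ n, IsTestOn Ω (φ n)) ∧
      Tendsto (fun n => eLpNorm (fun x => φ n x - v x) 2 (volume.restrict Ω)) atTop (𝓝 0) ∧
      Tendsto (fun n => eLpNorm (fun x => fderiv ℝ (φ n) x - G x) 2 (volume.restrict Ω))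
        atTop (𝓝 0)

/-- The space-time cylinder `(0,T) × Ω`. -/
def cyl (T : ℝ) (Ω : Set Space3) : Set (ℝ × Space3) := Ioo 0 T ×ˢ Ω

/-- `R ∈ L²(0,T; L²(Ω))`, identified with `L²((0,T) × Ω)`. -/
def MemL2L2 {F : Type*} [NormedAddCommGroup F] (T : ℝ) (Ω : Set Space3)
    (R : ℝ → Space3 → F) : Prop :=
  MemLp (fun z : ℝ × Space3 => R z.1 z.2) 2 (volume.restrict (cyl T Ω))

/-- `R ∈ L^∞(0,T; L^γ(Ω))`. -/
def MemLinftyLp {F : Type*} [NormedAddCommGroup F] (T : ℝ) (Ω : Set Space3) (γ : ℝ)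
    (R : ℝ → Space3 → F) : Prop :=
  AEStronglyMeasurable (fun z : ℝ × Space3 => R z.1 z.2) (volume.restrict (cyl T Ω)) ∧
    ∃ C : NNReal, ∀ᵐ t ∂(volume.restrict (Ioo 0 T)),
      eLpNorm (R t) (ENNReal.ofReal γ) (volume.restrict Ω) ≤ C

/-- `u ∈ L²(0,T; H¹₀(Ω))`, with spatial weak gradient `Du`. -/
def MemL2H10 (T : ℝ) (Ω : Set Space3) (u : ℝ → Space3 → Space3)
    (Du : ℝ → Space3 → Space3 →L[ℝ] Space3) : Prop :=
  MemL2L2 T Ω u ∧ MemL2L2 T Ω Du ∧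
    ∀ᵐ t ∂(volume.restrict (Ioo 0 T)), MemH10 Ω (u t) (Du t)

/-- The trace of a gradient; `divOf (Du t x)` is `div u (t,x)`. -/
noncomputable def divOf (A : Space3 →L[ℝ] Space3) : ℝ :=
  ∑ i : Fin 3, (A (EuclideanSpace.single i 1)) i

/-- `∂ₜ r + div (r u) + f = 0` in the sense of distributions on `(0,T) × Ω`. -/
def SolvesTransport (T : ℝ) (Ω : Set Space3) (u : ℝ → Space3 → Space3)
    (r f : ℝ → Space3 → ℝ) : Prop :=
  LocallyIntegrableOn (fun z : ℝ × Space3 => r z.1 z.2) (cyl T Ω) ∧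
  LocallyIntegrableOn (fun z : ℝ × Space3 => r z.1 z.2 • u z.1 z.2) (cyl T Ω) ∧
  LocallyIntegrableOn (fun z : ℝ × Space3 => f z.1 z.2) (cyl T Ω) ∧
  ∀ φ : ℝ × Space3 → ℝ, IsTestOn (cyl T Ω) φ →
    ∫ z in cyl T Ω, (r z.1 z.2 * fderiv ℝ φ z (1, 0)
      + r z.1 z.2 * fderiv ℝ φ z (0, u z.1 z.2) - f z.1 z.2 * φ z) = 0

/-- `∂ₜ r + div (r u) = 0`, `r|_{t=0} = r₀`, in the sense of distributions: the initial value is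
encoded by test functions in `C_c^∞([0,T) × Ω)`. -/
def SolvesTransportWithInitial (T : ℝ) (Ω : Set Space3) (u : ℝ → Space3 → Space3)
    (r : ℝ → Space3 → ℝ) (r₀ : Space3 → ℝ) : Prop :=
  LocallyIntegrableOn r₀ Ω ∧
  ∀ φ : ℝ × Space3 → ℝ, IsTestOn (Iio T ×ˢ Ω) φ →
    (∫ z in cyl T Ω, (r z.1 z.2 * fderiv ℝ φ z (1, 0)
      + r z.1 z.2 * fderiv ℝ φ z (0, u z.1 z.2))) + (∫ x in Ω, r₀ x * φ (0, x)) = 0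

/-- `β ∈ C¹(ℝᴺ)` with bounded gradient. -/
def IsC1BoundedGradient {N : ℕ} (β : EuclideanSpace ℝ (Fin N) → ℝ) : Prop :=
  ContDiff ℝ 1 β ∧ ∃ C : ℝ, ∀ X, ‖fderiv ℝ β X‖ ≤ C

/-- The function `(∇β(R)·R - β(R)) div u` of `(t,x)`. -/
noncomputable def renormSource {N : ℕ} (β : EuclideanSpace ℝ (Fin N) → ℝ)
    (R : ℝ → Space3 → EuclideanSpace ℝ (Fin N))
    (Du : ℝ → Space3 → Space3 →L[ℝ] Space3) (t : ℝ) (x : Space3) : ℝ :=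
  (fderiv ℝ β (R t x) (R t x) - β (R t x)) * divOf (Du t x)

/-! The proof follows DiPerna and Lions. All functions are extended by zero outside the cylinder and
R is mollified in space only, Rₙ = κₙ ∗ R. At points whose distance to the complement of Ω exceeds
the mollification radius, ∂ₜRₙ + u·∇Rₙ + Rₙ div u = rₙ, where rₙ is the commutator of convection and
mollification. Rₙ is C¹ in x and, at each such x, agrees a.e. with a primitive in time, so the chain
rule gives the equation of β(Rₙ) with the extra source ∇β(Rₙ)·rₙ (`integral_renormalized_moll`). The
central fact is rₙ → 0 in L¹. Subtracting a divergence integral that vanishes expresses rₙ through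
increments of R and the first-order Taylor remainder of u; the latter is o(|y|) in L², while
|y||∇κₙ(y)| has bounded integral, and products of L² functions are in L¹ (`ae_commutator_eq`,
`lintegral_enorm_transportCommutator_le`). The limit n → ∞ is `renormalized`.

Time continuity: Rₙ − Rₘ is the mollification with kernel κₙ − κₘ, so the same identity holds for
it. With β close to the norm, for which ∇β(X)·X − β(X) is negligible, the variation in time of ∫
χ|Rₙ − Rₘ| is controlled by Rₙ − Rₘ in L² and rₙ − rₘ in L¹. Hence Rₙ → R in L¹ with weight χ
uniformly in time (`exists_tendsto_ae_lintegral_moll_sub_le`). Each Rₙ is uniformly continuous in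
time, and the L^γ bound makes the mass near the boundary small, whence a modulus of continuity in
L¹(Ω) (`exists_uniform_modulus`).

Integral balance: the test function 1 must be reached by cutoffs χₙ with u·∇χₙ → 0 in L¹. Since Ω is
an arbitrary bounded open set, the distance to the boundary is of no use; the cutoffs are functions
of S = ρ² + ∫ |v|² dt, where v approximates u and ρ is smooth with ρ ≠ 0 exactly on Ω. Where ∇χ ≠ 0,
S is at most m⁻², so u is small there just where ∇χ is large (`exists_cutoff_step`). This handles
bounded β; general β follows by arctan truncation. The initial value is identified by comparing the
two weak formulations on products θ(t)χ(x) with θ(0) = 1. -/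

/-! ### Passing to the limit under the integral -/

/-- Split mₙfₙ = mₙf' + mₙ(fₙ − f'): dominated convergence for the first part, the bound C and L¹
convergence for the second. It serves for products ∇β(Rₙ)·Fₙ, where the first factor is bounded but
converges only pointwise. -/
theorem tendsto_integral_clm_apply {α E F : Type*} [MeasurableSpace α] {μ : Measure α}
    [NormedAddCommGroup E] [NormedSpace ℝ E] [NormedAddCommGroup F] [NormedSpace ℝ F]
    {m : ℕ → α → E →L[ℝ] F} {m' : α → E →L[ℝ] F} {f : ℕ → α → E} {f' : α → E} {C : ℝ}
    (hm : ∀ n, AEStronglyMeasurable (m n) μ) (hC : ∀ n, ∀ᵐ x ∂μ, ‖m n x‖ ≤ C)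
    (hlim : ∀ᵐ x ∂μ, Tendsto (fun n => m n x) atTop (𝓝 (m' x)))
    (hf : ∀ n, Integrable (f n) μ) (hf' : Integrable f' μ)
    (hfl : Tendsto (fun n => ∫⁻ x, ‖f n x - f' x‖ₑ ∂μ) atTop (𝓝 0)) :
    Tendsto (fun n => ∫ x, m n x (f n x) ∂μ) atTop (𝓝 (∫ x, m' x (f' x) ∂μ)) := by
  have hint : ∀ n (g : α → E), Integrable g μ → Integrable (fun x => m n x (g x)) μ := by
    intro n g hg
    refine (hg.norm.const_mul C).mono' ?_ ?_
    · exact (ContinuousLinearMap.apply ℝ F).flip.aestronglyMeasurable_comp₂ (hm n)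
        hg.aestronglyMeasurable
    · filter_upwards [hC n] with x hx
      exact (m n x).le_of_opNorm_le hx _
  have h1 : Tendsto (fun n => ∫ x, m n x (f' x) ∂μ) atTop (𝓝 (∫ x, m' x (f' x) ∂μ)) := by
    refine tendsto_integral_of_dominated_convergence (fun x => C * ‖f' x‖)
      (fun n => (hint n f' hf').aestronglyMeasurable) (hf'.norm.const_mul C) ?_ ?_
    · intro n
      filter_upwards [hC n] with x hx
      exact (m n x).le_of_opNorm_le hx _
    · filter_upwards [hlim] with x hx
      exact ((ContinuousLinearMap.apply ℝ F (f' x)).continuous.tendsto _).comp hx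
  have h2 : Tendsto (fun n => ∫ x, m n x (f n x - f' x) ∂μ) atTop (𝓝 0) := by
    have h3 : Tendsto (fun n => ENNReal.ofReal C * ∫⁻ x, ‖f n x - f' x‖ₑ ∂μ) atTop (𝓝 0) := by
      simpa using ENNReal.Tendsto.const_mul hfl (Or.inr ENNReal.ofReal_ne_top)
    rw [tendsto_zero_iff_enorm_tendsto_zero]
    refine tendsto_of_tendsto_of_tendsto_of_le_of_le tendsto_const_nhds h3 (fun _ => zero_le) ?_
    intro n
    refine (enorm_integral_le_lintegral_enorm _).trans ?_
    beta_reduce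
    rw [← lintegral_const_mul' _ _ ENNReal.ofReal_ne_top]
    refine lintegral_mono_ae ?_
    filter_upwards [hC n] with x hx
    rw [← ofReal_norm, ← ofReal_norm, ← ENNReal.ofReal_mul ((norm_nonneg _).trans hx)]
    exact ENNReal.ofReal_le_ofReal ((m n x).le_of_opNorm_le hx _)
  have h4 := h1.add h2
  rw [add_zero] at h4
  refine h4.congr fun n => ?_
  have h5 := integral_add (hint n _ hf') (hint n _ ((hf n).sub hf'))
  simp only [Pi.sub_apply] at h5
  rw [← h5]
  simp

theorem integrable_bounded_smul {α E : Type*} [MeasurableSpace α] {μ : Measure α}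
    [NormedAddCommGroup E] [NormedSpace ℝ E] {f : α → E} {φ : α → ℝ} {C : ℝ}
    (hf : Integrable f μ) (hφ : AEStronglyMeasurable φ μ) (hC : ∀ x, ‖φ x‖ ≤ C) :
    Integrable (fun x => φ x • f x) μ :=
  hf.bdd_smul C hφ (ae_of_all _ hC)

/-! ### Weak derivatives and the chain rule in one variable -/

section OneDim

variable {E F : Type*} [NormedAddCommGroup E] [NormedSpace ℝ E]
  [NormedAddCommGroup F] [NormedSpace ℝ F]

theorem IsTestOn.eq_zero_of_notMem {X F : Type*} [NormedAddCommGroup X] [NormedSpace ℝ X]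
    [NormedAddCommGroup F] [NormedSpace ℝ F] {U : Set X} {φ : X → F} (h : IsTestOn U φ) {x : X}
    (hx : x ∉ U) : φ x = 0 :=
  image_eq_zero_of_notMem_tsupport fun h' => hx (h.2.2 h')

theorem IsTestOn.fderiv_eq_zero_of_notMem {X F : Type*} [NormedAddCommGroup X] [NormedSpace ℝ X]
    [NormedAddCommGroup F] [NormedSpace ℝ F] {U : Set X} {φ : X → F} (h : IsTestOn U φ) {x : X}
    (hx : x ∉ U) : fderiv ℝ φ x = 0 :=
  fderiv_of_notMem_tsupport (𝕜 := ℝ) fun h' => hx (h.2.2 h')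

theorem norm_image_sub_le_of_fderiv_bound {β : E → F} (hβ : ContDiff ℝ 1 β) {C : ℝ}
    (hC : ∀ X, ‖fderiv ℝ β X‖ ≤ C) (X Y : E) : ‖β X - β Y‖ ≤ C * ‖X - Y‖ :=
  Convex.norm_image_sub_le_of_norm_fderiv_le (fun x _ => hβ.differentiable one_ne_zero x)
    (fun x _ => hC x) convex_univ (mem_univ _) (mem_univ _)

theorem continuous_intervalIntegral_of_integrable {f : ℝ → E} (hf : Integrable f) (a : ℝ) :
    Continuous fun t => ∫ s in a..t, f s :=
  intervalIntegral.continuous_primitive (fun _ _ => hf.intervalIntegrable) a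

/-- The chain rule for `W^{1,1}` functions of one variable, tested against `θ`. -/
theorem integral_deriv_smul_comp_primitive [CompleteSpace E] {f : ℝ → E} (hf : Integrable f) (a : ℝ) (c : E)
    {β : E → F} (hβ : ContDiff ℝ 1 β) {C : ℝ} (hC : ∀ X, ‖fderiv ℝ β X‖ ≤ C)
    {θ : ℝ → ℝ} (hθ : ContDiff ℝ 1 θ) (hθc : HasCompactSupport θ) :
    ∫ t, (deriv θ t • β (c + ∫ s in a..t, f s)
      + θ t • fderiv ℝ β (c + ∫ s in a..t, f s) (f t)) = 0 := by
  have hθd : Continuous (deriv θ) := hθ.continuous_deriv le_rfl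
  have hθdc : HasCompactSupport (deriv θ) := hθc.deriv
  have hβ' : Continuous (fderiv ℝ β) := hβ.continuous_fderiv one_ne_zero
  obtain ⟨M, hM⟩ := hθ.continuous.bounded_above_of_compact_support hθc
  have hM0 : 0 ≤ M := (norm_nonneg _).trans (hM 0)
  have hC0 : 0 ≤ C := (norm_nonneg _).trans (hC 0)
  -- the smooth case
  have smooth : ∀ g : ℝ → E, Continuous g → Integrable g →
      ∫ t, (deriv θ t • β (c + ∫ s in a..t, g s)
        + θ t • fderiv ℝ β (c + ∫ s in a..t, g s) (g t)) = 0 := by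
    intro g hg hgi
    have hG : ∀ t, HasDerivAt (fun t => c + ∫ s in a..t, g s) (g t) t := fun t =>
      (intervalIntegral.integral_hasDerivAt_right hgi.intervalIntegrable
        hg.stronglyMeasurable.stronglyMeasurableAtFilter hg.continuousAt).const_add c
    have hd : ∀ t, HasDerivAt (fun t => θ t • β (c + ∫ s in a..t, g s))
        (θ t • fderiv ℝ β (c + ∫ s in a..t, g s) (g t)
          + deriv θ t • β (c + ∫ s in a..t, g s)) t := fun t =>
      ((hθ.differentiable one_ne_zero t).hasDerivAt).smul
        ((hβ.differentiable one_ne_zero _).hasFDerivAt.comp_hasDerivAt t (hG t))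
    have hGc := (continuous_const (y := c)).add (continuous_intervalIntegral_of_integrable hgi a)
    have hcont : Continuous fun t => θ t • fderiv ℝ β (c + ∫ s in a..t, g s) (g t)
          + deriv θ t • β (c + ∫ s in a..t, g s) := by
      refine (hθ.continuous.smul ?_).add (hθd.smul (hβ.continuous.comp hGc))
      exact (hβ'.comp hGc).clm_apply hg
    have hcs : HasCompactSupport fun t => θ t • β (c + ∫ s in a..t, g s) := hθc.smul_right
    have hcs' : HasCompactSupport fun t => θ t • fderiv ℝ β (c + ∫ s in a..t, g s) (g t)
          + deriv θ t • β (c + ∫ s in a..t, g s) := hθc.smul_right.add hθdc.smul_right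
    have := integral_eq_zero_of_hasDerivAt_of_integrable hd (hcont.integrable_of_hasCompactSupport hcs')
      ((hθ.continuous.smul (hβ.continuous.comp hGc)).integrable_of_hasCompactSupport hcs)
    rw [← this]
    congr 1; ext t; rw [add_comm]
  -- Density of continuous functions in L¹(ℝ): L¹ convergence of g n makes the primitives converge
  -- uniformly.
  choose g hgc hgd hg hgi using fun n : ℕ =>
    hf.exists_hasCompactSupport_integral_sub_le (ε := 1 / (n + 1 : ℝ)) (by positivity)
  have hd0 : Tendsto (fun n => ∫ t, ‖f t - g n t‖) atTop (𝓝 0) :=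
    squeeze_zero (fun n => by positivity) hgd tendsto_one_div_add_atTop_nhds_zero_nat
  have hGd : ∀ n t, ‖(c + ∫ s in a..t, g n s) - (c + ∫ s in a..t, f s)‖ ≤ ∫ t, ‖f t - g n t‖ := by
    intro n t
    rw [add_sub_add_left_eq_sub, ← intervalIntegral.integral_sub (hgi n).intervalIntegrable
      hf.intervalIntegrable]
    refine (intervalIntegral.norm_integral_le_integral_norm_uIoc).trans ?_
    simp_rw [norm_sub_rev (g n _)]
    exact setIntegral_le_integral (hf.sub (hgi n)).norm (ae_of_all _ fun _ => norm_nonneg _)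
  have hGl : ∀ t, Tendsto (fun n => c + ∫ s in a..t, g n s) atTop (𝓝 (c + ∫ s in a..t, f s)) :=
    fun t => tendsto_iff_norm_sub_tendsto_zero.2
      (squeeze_zero (fun _ => norm_nonneg _) (fun n => hGd n t) hd0)
  have hGc : Continuous fun t => c + ∫ s in a..t, f s :=
    continuous_const.add (continuous_intervalIntegral_of_integrable hf a)
  have hGnc : ∀ n, Continuous fun t => c + ∫ s in a..t, g n s := fun n =>
    continuous_const.add (continuous_intervalIntegral_of_integrable (hgi n) a)
  have L1 : Tendsto (fun n => ∫ t, deriv θ t • β (c + ∫ s in a..t, g n s)) atTop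
      (𝓝 (∫ t, deriv θ t • β (c + ∫ s in a..t, f s))) := by
    refine tendsto_integral_of_dominated_convergence
      (fun t => |deriv θ t| * (‖β (c + ∫ s in a..t, f s)‖ + C * 1))
      (fun n => (hθd.smul (hβ.continuous.comp (hGnc n))).aestronglyMeasurable) ?_ ?_ ?_
    · refine Continuous.integrable_of_hasCompactSupport
        (hθd.abs.mul ((hβ.continuous.comp hGc).norm.add continuous_const)) ?_
      exact hθdc.abs.mul_right
    · intro n
      refine ae_of_all _ fun t => ?_
      rw [norm_smul, Real.norm_eq_abs]
      gcongr
      have h1 := norm_image_sub_le_of_fderiv_bound hβ hC (c + ∫ s in a..t, g n s)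
        (c + ∫ s in a..t, f s)
      have h2 : (1 : ℝ) / (n + 1) ≤ 1 := by
        rw [div_le_one (by positivity)]; linarith [n.cast_nonneg (α := ℝ)]
      have h3 := mul_le_mul_of_nonneg_left (((hGd n t).trans (hgd n)).trans h2) hC0
      have h4 := norm_le_norm_add_norm_sub' (β (c + ∫ s in a..t, g n s))
        (β (c + ∫ s in a..t, f s))
      linarith
    · exact ae_of_all _ fun t => ((hβ.continuous.tendsto _).comp (hGl t)).const_smul _
  have L2 : Tendsto (fun n => ∫ t, (θ t • fderiv ℝ β (c + ∫ s in a..t, g n s)) (g n t)) atTop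
      (𝓝 (∫ t, (θ t • fderiv ℝ β (c + ∫ s in a..t, f s)) (f t))) := by
    refine tendsto_integral_clm_apply (C := M * C)
      (fun n => (hθ.continuous.smul (hβ'.comp (hGnc n))).aestronglyMeasurable) ?_ ?_ hgi hf ?_
    · intro n
      refine ae_of_all _ fun t => ?_
      rw [norm_smul]
      exact mul_le_mul (hM t) (hC _) (norm_nonneg _) hM0
    · exact ae_of_all _ fun t => ((hβ'.tendsto _).comp (hGl t)).const_smul _
    · have : ∀ n, ∫⁻ t, ‖g n t - f t‖ₑ = ENNReal.ofReal (∫ t, ‖f t - g n t‖) := by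
        intro n
        have h5 := ofReal_integral_norm_eq_lintegral_enorm (hf.sub (hgi n))
        simp only [Pi.sub_apply] at h5
        rw [h5]
        congr 1; ext t
        rw [← enorm_neg, neg_sub]
      simp_rw [this]
      simpa using ENNReal.tendsto_ofReal hd0
  have hI1 : ∀ (g : ℝ → E), Integrable g →
      Integrable fun t => deriv θ t • β (c + ∫ s in a..t, g s) := fun g hg =>
    (hθd.smul (hβ.continuous.comp (continuous_const.add
      (continuous_intervalIntegral_of_integrable hg a)))).integrable_of_hasCompactSupport
      hθdc.smul_right
  have hI2 : ∀ (g : ℝ → E), Integrable g →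
      Integrable fun t => (θ t • fderiv ℝ β (c + ∫ s in a..t, g s)) (g t) := by
    intro g hg
    refine (hg.norm.const_mul (M * C)).mono' ?_ (ae_of_all _ fun t => ?_)
    · exact (ContinuousLinearMap.apply ℝ F).flip.aestronglyMeasurable_comp₂
        (hθ.continuous.smul (hβ'.comp (continuous_const.add
          (continuous_intervalIntegral_of_integrable hg a)))).aestronglyMeasurable
        hg.aestronglyMeasurable
    · refine ContinuousLinearMap.le_of_opNorm_le _ ?_ _
      rw [norm_smul]
      exact mul_le_mul (hM t) (hC _) (norm_nonneg _) hM0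
  have L3 := L1.add L2
  have L4 : Tendsto (fun _ : ℕ => (0 : F)) atTop (𝓝
      (∫ t, deriv θ t • β (c + ∫ s in a..t, f s)
        + (θ t • fderiv ℝ β (c + ∫ s in a..t, f s)) (f t))) := by
    rw [integral_add (hI1 f hf) (hI2 f hf)]
    refine L3.congr fun n => ?_
    rw [← integral_add (hI1 _ (hgi n)) (hI2 _ (hgi n))]
    exact smooth _ (hg n) (hgi n)
  exact (tendsto_nhds_unique L4 tendsto_const_nhds)

/-- A function of one variable with integrable weak derivative `f` is a primitive of `f`. -/
theorem ae_eq_add_primitive_of_weak_deriv [CompleteSpace E] {g f : ℝ → E} {a b : ℝ} (hab : a < b)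
    (hg : IntegrableOn g (Ioo a b)) (hf : Integrable f)
    (h : ∀ θ : ℝ → ℝ, IsTestOn (Ioo a b) θ →
      ∫ t in Ioo a b, (deriv θ t • g t + θ t • f t) = 0) :
    ∃ c : E, ∀ᵐ t ∂(volume.restrict (Ioo a b)), g t = c + ∫ s in a..t, f s := by
  set G : ℝ → E := fun t => ∫ s in a..t, f s with hGdef
  have hGc : Continuous G := continuous_intervalIntegral_of_integrable hf a
  set k : ℝ → E := fun t => g t - G t with hkdef
  have hGi : IntegrableOn G (Ioo a b) :=
    (hGc.integrableOn_Icc (a := a) (b := b)).mono_set Ioo_subset_Icc_self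
  have hk : IntegrableOn k (Ioo a b) := hg.sub hGi
  -- After subtraction of the primitive G, the difference k has zero weak derivative, and it remains
  -- to show that k is constant.
  have key : ∀ θ : ℝ → ℝ, IsTestOn (Ioo a b) θ → ∫ t in Ioo a b, deriv θ t • k t = 0 := by
    intro θ hθ
    have hd : Continuous (deriv θ) := hθ.1.continuous_deriv (by exact_mod_cast le_top)
    obtain ⟨M, hM⟩ := hd.bounded_above_of_compact_support hθ.2.1.deriv
    obtain ⟨M', hM'⟩ := hθ.1.continuous.bounded_above_of_compact_support hθ.2.1
    have i1 : IntegrableOn (fun t => deriv θ t • g t) (Ioo a b) :=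
      integrable_bounded_smul hg hd.aestronglyMeasurable hM
    have i2 : IntegrableOn (fun t => deriv θ t • G t) (Ioo a b) :=
      integrable_bounded_smul hGi hd.aestronglyMeasurable hM
    have i3 : IntegrableOn (fun t => θ t • f t) (Ioo a b) :=
      integrable_bounded_smul hf.integrableOn hθ.1.continuous.aestronglyMeasurable hM'
    have h1 := h θ hθ
    have h2 := integral_deriv_smul_comp_primitive (β := fun x : E => x) hf a 0 contDiff_id (C := 1)
      (fun X => by
        rw [fderiv_fun_id]; exact ContinuousLinearMap.norm_id_le) (hθ.1.of_le (by exact_mod_cast le_top)) hθ.2.1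
    simp only [zero_add, fderiv_fun_id, ContinuousLinearMap.coe_id', id_eq] at h2
    rw [← setIntegral_eq_integral_of_forall_compl_eq_zero (s := Ioo a b)] at h2
    · rw [integral_add i1 i3] at h1
      rw [integral_add i2 i3] at h2
      simp_rw [hkdef, smul_sub]
      rw [integral_sub i1 i2]
      rw [eq_neg_of_add_eq_zero_left h1, eq_neg_of_add_eq_zero_left h2, sub_self]
    · intro t ht
      have := hθ.fderiv_eq_zero_of_notMem ht
      rw [hθ.eq_zero_of_notMem ht, ← fderiv_apply_one_eq_deriv, this]
      simp
  obtain ⟨θ₀, hθ₀⟩ : ∃ θ₀ : ℝ → ℝ, IsTestOn (Ioo a b) θ₀ ∧ ∫ t, θ₀ t = 1 := by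
    let B : ContDiffBump ((a + b) / 2) := ⟨(b - a) / 8, (b - a) / 4, by linarith, by linarith⟩
    refine ⟨B.normed volume, ⟨B.contDiff_normed, B.hasCompactSupport_normed, ?_⟩,
      B.integral_normed⟩
    rw [B.tsupport_normed_eq, Real.closedBall_eq_Icc]
    intro t ht
    have : B.rOut = (b - a) / 4 := rfl
    rw [this] at ht
    constructor <;> linarith [ht.1, ht.2]
  set c : E := ∫ t in Ioo a b, θ₀ t • k t with hc
  refine ⟨c, ?_⟩
  rw [ae_restrict_iff' measurableSet_Ioo]
  have main := isOpen_Ioo.ae_eq_zero_of_integral_contDiff_smul_eq_zero (U := Ioo a b) (μ := volume)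
    (f := fun t => k t - c)
    ((hk.sub (integrableOn_const (by simp))).locallyIntegrableOn) ?_
  · filter_upwards [main] with t ht hmem
    have := ht hmem
    simp only [hkdef] at this
    rw [← sub_eq_zero, ← this]; abel
  intro ψ hψ hψc hψs
  -- Subtracting I times the unit-mass bump θ₀ makes ψ of mean zero, hence the derivative of a test
  -- function; the constant is therefore the mean of k against θ₀.
  set I : ℝ := ∫ t, ψ t
  set η : ℝ → ℝ := fun t => ψ t - I * θ₀ t with hη
  have hηs : ContDiff ℝ ∞ η := hψ.sub (contDiff_const.mul hθ₀.1.1)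
  have hηz : ∀ t, t ∉ tsupport ψ ∪ tsupport θ₀ → η t = 0 := by
    intro t ht
    rw [mem_union, not_or] at ht
    simp [hη, image_eq_zero_of_notMem_tsupport ht.1, image_eq_zero_of_notMem_tsupport ht.2]
  have hKc : IsCompact (tsupport ψ ∪ tsupport θ₀) := hψc.isCompact.union hθ₀.1.2.1.isCompact
  have hKs : tsupport ψ ∪ tsupport θ₀ ⊆ Ioo a b := union_subset hψs hθ₀.1.2.2
  -- A compact interval carrying both supports; if these were empty, the empty interval from 1 to 0
  -- would do.
  obtain ⟨a', b', hab', hsub⟩ : ∃ a' b', Icc a' b' ⊆ Ioo a b ∧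
      tsupport ψ ∪ tsupport θ₀ ⊆ Icc a' b' := by
    rcases (tsupport ψ ∪ tsupport θ₀).eq_empty_or_nonempty with he | hne
    · exact ⟨1, 0, by simp, by simp [he]⟩
    · exact ⟨sInf _, sSup _, Icc_subset_Ioo (hKs (hKc.sInf_mem hne)).1 (hKs (hKc.sSup_mem hne)).2,
        fun t ht => ⟨csInf_le hKc.bddBelow ht, le_csSup hKc.bddAbove ht⟩⟩
  have hηz' : ∀ t, t ∉ Icc a' b' → η t = 0 := fun t ht => hηz t fun h' => ht (hsub h')
  have hηi : Integrable η := hηs.continuous.integrable_of_hasCompactSupport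
    (HasCompactSupport.intro isCompact_Icc hηz')
  have hψi : Integrable ψ := hψ.continuous.integrable_of_hasCompactSupport hψc
  have hθi : Integrable θ₀ := hθ₀.1.1.continuous.integrable_of_hasCompactSupport hθ₀.1.2.1
  have hηI : ∫ t, η t = 0 := by
    rw [hη, integral_sub hψi (hθi.const_mul _), integral_const_mul, hθ₀.2]; simp [I]
  -- This primitive vanishes to the left of the supports by construction and to the right because η
  -- has mean zero.
  set ζ : ℝ → ℝ := fun t => ∫ s in a..t, η s with hζ
  have hζd : ∀ t, HasDerivAt ζ (η t) t := fun t =>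
    intervalIntegral.integral_hasDerivAt_right hηi.intervalIntegrable
        hηs.continuous.stronglyMeasurable.stronglyMeasurableAtFilter hηs.continuous.continuousAt
  have hζz : ∀ t, t ∉ Icc a' b' → ζ t = 0 := by
    intro t ht
    by_cases hempty : a' ≤ b'
    · have ha' : a < a' := (hab' ⟨le_rfl, hempty⟩).1
      have hb' : b' < b := (hab' ⟨hempty, le_rfl⟩).2
      by_cases h1 : t < a'
      · simp only [hζ]
        refine intervalIntegral.integral_zero_ae (ae_of_all _ fun s hs => hηz' s fun hs' => ?_)
        rcases mem_uIoc.1 hs with h | h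
        · linarith [h.2, hs'.1]
        · linarith [h.2, hs'.1]
      · have h2 : b' < t := by
          by_contra h3; exact ht ⟨not_lt.1 h1, not_lt.1 h3⟩
        rw [← hηI]
        simp only [hζ]
        rw [intervalIntegral.integral_of_le (by linarith)]
        refine setIntegral_eq_integral_of_forall_compl_eq_zero fun s hs => hηz' s fun hs' => hs ?_
        exact ⟨by linarith [hs'.1], by linarith [hs'.2]⟩
    · have : ∀ s, η s = 0 := fun s => hηz' s (by rw [Icc_eq_empty hempty]; simp)
      simp [hζ, this]
  have hζt : IsTestOn (Ioo a b) ζ := by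
    refine ⟨?_, HasCompactSupport.intro isCompact_Icc hζz, ?_⟩
    · have : deriv ζ = η := funext fun t => (hζd t).deriv
      rw [contDiff_infty_iff_deriv]
      exact ⟨fun t => (hζd t).differentiableAt, this ▸ hηs⟩
    · refine (closure_minimal (fun t ht => ?_) isClosed_Icc).trans hab'
      by_contra h'
      exact ht (hζz t h')
  have h3 := key ζ hζt
  simp_rw [fun t => (hζd t).deriv] at h3
  obtain ⟨M, hM⟩ := hψ.continuous.bounded_above_of_compact_support hψc
  obtain ⟨M', hM'⟩ := hθ₀.1.1.continuous.bounded_above_of_compact_support hθ₀.1.2.1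
  have j1 : IntegrableOn (fun t => ψ t • k t) (Ioo a b) :=
      integrable_bounded_smul hk hψ.continuous.aestronglyMeasurable hM
  have j2 : IntegrableOn (fun t => θ₀ t • k t) (Ioo a b) :=
      integrable_bounded_smul hk hθ₀.1.1.continuous.aestronglyMeasurable hM'
  have h4 : ∫ t in Ioo a b, ψ t • k t = I • c := by
    have j3 : IntegrableOn (fun t => I • θ₀ t • k t) (Ioo a b) := j2.smul I
    rw [← sub_eq_zero, ← h3, hc, ← integral_smul, ← integral_sub j1 j3]
    congr 1; ext t
    simp only [hη, sub_smul, mul_smul]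
  rw [← setIntegral_eq_integral_of_forall_compl_eq_zero (s := Ioo a b)
    (fun t ht => by
      rw [image_eq_zero_of_notMem_tsupport (fun h' => ht (hψs h')), zero_smul])]
  simp_rw [smul_sub]
  rw [integral_sub j1 (hψi.integrableOn.smul_const c), h4, integral_smul_const,
    setIntegral_eq_integral_of_forall_compl_eq_zero (fun t ht => by
      rw [image_eq_zero_of_notMem_tsupport (fun h' => ht (hψs h'))]), sub_self]

end OneDim

/-! ### L² norms and approximation by velocity fields simple in time -/

open scoped ENNReal

theorem eLpNorm_two_sq {α E : Type*} [MeasurableSpace α] {μ : Measure α} [NormedAddCommGroup E]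
    (f : α → E) : eLpNorm f 2 μ ^ 2 = ∫⁻ x, ‖f x‖ₑ ^ 2 ∂μ := by
  have := eLpNorm_nnreal_pow_eq_lintegral (f := f) (μ := μ) (p := 2) two_ne_zero
  simpa using this

theorem tendsto_eLpNorm_two_iff {α E ι : Type*} [MeasurableSpace α] {μ : Measure α}
    [NormedAddCommGroup E] {f : ι → α → E} {l : Filter ι} :
    Tendsto (fun n => eLpNorm (f n) 2 μ) l (𝓝 0) ↔
      Tendsto (fun n => ∫⁻ x, ‖f n x‖ₑ ^ 2 ∂μ) l (𝓝 0) := by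
  simp_rw [← eLpNorm_two_sq]
  constructor
  · intro h
    simpa using ENNReal.Tendsto.pow (n := 2) h
  · intro h
    have := h.ennrpow_const (1 / 2)
    rw [ENNReal.zero_rpow_of_pos (by norm_num)] at this
    refine this.congr fun n => ?_
    rw [← ENNReal.rpow_natCast, ← ENNReal.rpow_mul]
    norm_num

theorem lintegral_enorm_mul_enorm_le {α E F : Type*} [MeasurableSpace α] {μ : Measure α}
    [NormedAddCommGroup E] [NormedAddCommGroup F] {f : α → E} {g : α → F}
    (hf : AEStronglyMeasurable f μ) (hg : AEStronglyMeasurable g μ) :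
    ∫⁻ x, ‖f x‖ₑ * ‖g x‖ₑ ∂μ ≤ eLpNorm f 2 μ * eLpNorm g 2 μ := by
  have h := ENNReal.lintegral_mul_le_Lp_mul_Lq μ Real.HolderConjugate.two_two hf.enorm hg.enorm
  rw [eLpNorm_eq_lintegral_rpow_enorm_toReal two_ne_zero ENNReal.ofNat_ne_top,
    eLpNorm_eq_lintegral_rpow_enorm_toReal two_ne_zero ENNReal.ofNat_ne_top]
  simpa using h

/-- `v` with gradient `G` is an `H¹(ℝ³)`-limit of elements of `C_c^∞(Ω)`. -/
def IsH10Limit (Ω : Set Space3) (v : Space3 → Space3) (G : Space3 → Space3 →L[ℝ] Space3) : Prop :=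
  ∃ φ : ℕ → Space3 → Space3, (∀ n, IsTestOn Ω (φ n)) ∧
    Tendsto (fun n => eLpNorm (fun x => φ n x - v x) 2 volume) atTop (𝓝 0) ∧
    Tendsto (fun n => eLpNorm (fun x => fderiv ℝ (φ n) x - G x) 2 volume) atTop (𝓝 0)

theorem IsTestOn.zero {X F : Type*} [NormedAddCommGroup X] [NormedSpace ℝ X]
    [NormedAddCommGroup F] [NormedSpace ℝ F] (U : Set X) : IsTestOn U (0 : X → F) :=
  ⟨contDiff_const, HasCompactSupport.zero, by simp [tsupport]⟩

theorem IsTestOn.continuous_fderiv {X F : Type*} [NormedAddCommGroup X] [NormedSpace ℝ X]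
    [NormedAddCommGroup F] [NormedSpace ℝ F] {U : Set X} {φ : X → F} (h : IsTestOn U φ) :
    Continuous (fderiv ℝ φ) :=
  h.1.continuous_fderiv (by simp)

theorem IsTestOn.differentiable {X F : Type*} [NormedAddCommGroup X] [NormedSpace ℝ X]
    [NormedAddCommGroup F] [NormedSpace ℝ F] {U : Set X} {φ : X → F} (h : IsTestOn U φ) :
    Differentiable ℝ φ :=
  h.1.differentiable (by simp)

theorem IsTestOn.memLp {X F : Type*} [NormedAddCommGroup X] [NormedSpace ℝ X]
    [NormedAddCommGroup F] [NormedSpace ℝ F] [MeasurableSpace X] [BorelSpace X]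
    [SecondCountableTopology X] {μ : Measure X} [IsFiniteMeasureOnCompacts μ] {p : ℝ≥0∞}
    {U : Set X} {φ : X → F} (h : IsTestOn U φ) : MemLp φ p μ :=
  h.1.continuous.memLp_of_hasCompactSupport h.2.1

theorem IsTestOn.memLp_fderiv {X F : Type*} [NormedAddCommGroup X] [NormedSpace ℝ X]
    [NormedAddCommGroup F] [NormedSpace ℝ F] [MeasurableSpace X] [BorelSpace X]
    [SecondCountableTopology X] {μ : Measure X} [IsFiniteMeasureOnCompacts μ] {p : ℝ≥0∞}
    {U : Set X} {φ : X → F} (h : IsTestOn U φ) : MemLp (fderiv ℝ φ) p μ :=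
  h.continuous_fderiv.memLp_of_hasCompactSupport (h.2.1.fderiv (𝕜 := ℝ))

/-- A sequence of test fields which is dense in `C_c^∞(Ω)` for the `H¹`-distance. -/
theorem exists_dense_test_sequence (Ω : Set Space3) :
    ∃ d : ℕ → Space3 → Space3, (∀ n, IsTestOn Ω (d n)) ∧
      ∀ φ : Space3 → Space3, IsTestOn Ω φ → ∀ ε : ℝ≥0∞, 0 < ε → ∃ n,
        eLpNorm (fun x => φ x - d n x) 2 volume < ε ∧
        eLpNorm (fun x => fderiv ℝ φ x - fderiv ℝ (d n) x) 2 volume < ε := by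
  let Y := Lp Space3 2 (volume : Measure Space3) ×
    Lp (Space3 →L[ℝ] Space3) 2 (volume : Measure Space3)
  have : Fact ((2 : ℝ≥0∞) ≠ ⊤) := ⟨ENNReal.ofNat_ne_top⟩
  -- The pairs (φ, ∇φ) form a subset of a separable metric space, so a countable family of test
  -- fields is dense for the H¹ distance.
  let ι : {φ : Space3 → Space3 // IsTestOn Ω φ} → Y := fun φ =>
    (φ.2.memLp.toLp φ.1, φ.2.memLp_fderiv.toLp (fderiv ℝ φ.1))
  have : Nonempty {φ : Space3 → Space3 // IsTestOn Ω φ} := ⟨⟨0, IsTestOn.zero Ω⟩⟩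
  have : Nonempty (range ι) := (range_nonempty ι).to_subtype
  have : ProperSpace (Space3 →L[ℝ] Space3) := FiniteDimensional.proper ℝ _
  have : SecondCountableTopology (Lp Space3 2 (volume : Measure Space3)) :=
    Lp.SecondCountableTopology
  have : SecondCountableTopology (Lp (Space3 →L[ℝ] Space3) 2 (volume : Measure Space3)) :=
    Lp.SecondCountableTopology
  have : SecondCountableTopology Y :=
    inferInstanceAs (SecondCountableTopology (Lp Space3 2 (volume : Measure Space3) ×
      Lp (Space3 →L[ℝ] Space3) 2 (volume : Measure Space3)))
  let s : ℕ → range ι := TopologicalSpace.denseSeq (range ι)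
  have hs : DenseRange s := TopologicalSpace.denseRange_denseSeq _
  choose d hd using fun n => (s n).2
  refine ⟨fun n => (d n).1, fun n => (d n).2, fun φ hφ ε hε => ?_⟩
  obtain ⟨n, hn⟩ := hs.exists_mem_open (Metric.isOpen_eball
    (x := (⟨ι ⟨φ, hφ⟩, mem_range_self _⟩ : range ι)) (ε := ε)) ⟨_, Metric.mem_eball_self hε⟩
  refine ⟨n, ?_⟩
  rw [Metric.mem_eball', Subtype.edist_eq, ← hd n, Prod.edist_eq, max_lt_iff] at hn
  have h1 := (Lp.edist_toLp_toLp _ _ hφ.memLp (d n).2.memLp).symm.trans_lt hn.1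
  have h2 := (Lp.edist_toLp_toLp _ _ hφ.memLp_fderiv (d n).2.memLp_fderiv).symm.trans_lt hn.2
  exact ⟨h1, h2⟩

theorem measurable_comp_index {α : Type*} [MeasurableSpace α] {e : ℕ → α → ℝ≥0∞}
    (he : ∀ n, Measurable (e n)) {k : α → ℕ} (hk : Measurable k) :
    Measurable fun t => e (k t) t :=
  (measurable_from_prod_countable_right (f := fun p : ℕ × α => e p.1 p.2) he).comp
    (hk.prodMk measurable_id)

/-- Measurable selection of an index `≤ N` at which `e · t` is minimal. -/
theorem exists_measurable_argmin {α : Type*} [MeasurableSpace α] {e : ℕ → α → ℝ≥0∞}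
    (he : ∀ n, Measurable (e n)) :
    ∃ k : ℕ → α → ℕ, (∀ N, Measurable (k N)) ∧ (∀ N t, k N t ≤ N) ∧
      (∀ N t n, n ≤ N → e (k N t) t ≤ e n t) ∧ (∀ N t, e 0 t = 0 → k N t = 0) := by
  -- The index changes only on strict improvement, so it never leaves 0 once e 0 vanishes.
  let k : ℕ → α → ℕ := fun N => Nat.rec (motive := fun _ => α → ℕ) (fun _ => 0)
    (fun N kN t => if e (N + 1) t < e (kN t) t then N + 1 else kN t) N
  have hk0 : ∀ t, k 0 t = 0 := fun t => rfl
  have hks : ∀ N t, k (N + 1) t = if e (N + 1) t < e (k N t) t then N + 1 else k N t :=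
    fun N t => rfl
  refine ⟨k, ?_, ?_, ?_, ?_⟩
  · intro N
    induction N with
    | zero => exact measurable_const
    | succ N ih =>
      exact Measurable.ite (measurableSet_lt (he _) (measurable_comp_index he ih))
        measurable_const ih
  · intro N t
    induction N with
    | zero => exact le_rfl
    | succ N ih => rw [hks]; split_ifs <;> omega
  · intro N t
    induction N with
    | zero => intro n hn; rw [Nat.le_zero.1 hn, hk0]
    | succ N ih =>
      intro n hn
      rw [hks]
      split_ifs with hlt
      · rcases Nat.le_succ_iff.1 hn with h' | h'
        · exact hlt.le.trans (ih n h')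
        · rw [h']
      · rcases Nat.le_succ_iff.1 hn with h' | h'
        · exact ih n h'
        · rw [h']; exact not_lt.1 hlt
  · intro N t hz
    induction N with
    | zero => exact hk0 t
    | succ N ih => rw [hks, ih, hz]; simp

/-- Approximation of `u ∈ L²(ℝ; H¹₀(Ω))` by functions which are simple in time with values in
`C_c^∞(Ω)`. -/
theorem exists_simple_approx {Ω : Set Space3} {u : ℝ × Space3 → Space3}
    {A : ℝ × Space3 → Space3 →L[ℝ] Space3} (hu : StronglyMeasurable u) (hA : StronglyMeasurable A)
    (hu2 : MemLp u 2 volume) (hA2 : MemLp A 2 volume)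
    (h : ∀ᵐ t, IsH10Limit Ω (fun x => u (t, x)) (fun x => A (t, x))) :
    ∃ (d : ℕ → Space3 → Space3) (k : ℕ → ℝ → ℕ), (∀ n, IsTestOn Ω (d n)) ∧ d 0 = 0 ∧
      (∀ N, Measurable (k N)) ∧ (∀ N t, k N t ≤ N) ∧
      (∀ N t, (∀ x, u (t, x) = 0) → (∀ x, A (t, x) = 0) → k N t = 0) ∧
      Tendsto (fun N => eLpNorm (fun z : ℝ × Space3 => u z - d (k N z.1) z.2) 2 volume)
        atTop (𝓝 0) ∧
      Tendsto (fun N => eLpNorm (fun z : ℝ × Space3 => A z - fderiv ℝ (d (k N z.1)) z.2) 2 volume)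
        atTop (𝓝 0) := by
  obtain ⟨d', hd', hdense⟩ := exists_dense_test_sequence Ω
  -- The zero field is inserted at index 0: times at which u and its gradient vanish then select it,
  -- and comparison with it bounds every later error.
  obtain ⟨d, hd0, hds⟩ : ∃ d : ℕ → Space3 → Space3, d 0 = 0 ∧ ∀ n, d (n + 1) = d' n :=
    ⟨fun n => Nat.casesOn (motive := fun _ => Space3 → Space3) n 0 d', rfl, fun _ => rfl⟩
  simp_rw [← hds] at hd' hdense
  have hd : ∀ n, IsTestOn Ω (d n) := by
    rintro (_ | n)
    · exact hd0 ▸ IsTestOn.zero Ω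
    · exact hd' n
  -- The squared H¹ distance from u(t) to the n-th test field.
  obtain ⟨e, he⟩ : ∃ e : ℕ → ℝ → ℝ≥0∞, ∀ n t, e n t = ∫⁻ x, (‖u (t, x) - d n x‖ₑ ^ 2
      + ‖A (t, x) - fderiv ℝ (d n) x‖ₑ ^ 2) := ⟨_, fun _ _ => rfl⟩
  have hem' : ∀ n, Measurable fun z : ℝ × Space3 =>
      ‖u z - d n z.2‖ₑ ^ 2 + ‖A z - fderiv ℝ (d n) z.2‖ₑ ^ 2 := by
    intro n
    have h1 : StronglyMeasurable fun z : ℝ × Space3 => d n z.2 :=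
      ((hd n).1.continuous.comp continuous_snd).stronglyMeasurable
    have h2 : StronglyMeasurable fun z : ℝ × Space3 => fderiv ℝ (d n) z.2 :=
      ((hd n).continuous_fderiv.comp continuous_snd).stronglyMeasurable
    exact ((hu.sub h1).enorm.pow_const 2).add ((hA.sub h2).enorm.pow_const 2)
  have hem : ∀ n, Measurable (e n) := fun n => by
    rw [show e n = _ from funext (he n)]
    exact (hem' n).lintegral_prod_right'
  obtain ⟨k, hkm, hkle, hmin, hk0⟩ := exists_measurable_argmin hem
  have he0 : ∀ t, e 0 t = ∫⁻ x, (‖u (t, x)‖ₑ ^ 2 + ‖A (t, x)‖ₑ ^ 2) := by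
    intro t
    rw [he, hd0]
    refine lintegral_congr fun x => ?_
    simp
  have hlim : ∀ᵐ t, Tendsto (fun N => e (k N t) t) atTop (𝓝 0) := by
    filter_upwards [h] with t ⟨φ, hφ, h1, h2⟩
    choose j hj1 hj2 using fun n : ℕ => hdense (φ n) (hφ n) ((n : ℝ≥0∞)⁻¹) (by simp)
    have hinv : Tendsto (fun n : ℕ => ((n : ℝ≥0∞)⁻¹)) atTop (𝓝 0) :=
      ENNReal.tendsto_inv_nat_nhds_zero
    have hut : AEStronglyMeasurable (fun x => u (t, x)) volume :=
      (hu.comp_measurable measurable_prodMk_left).aestronglyMeasurable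
    have hAt : AEStronglyMeasurable (fun x => A (t, x)) volume :=
      (hA.comp_measurable measurable_prodMk_left).aestronglyMeasurable
    have b1 : Tendsto (fun n => eLpNorm (fun x => u (t, x) - d (j n + 1) x) 2 volume) atTop
        (𝓝 0) := by
      have := h1.add hinv
      rw [add_zero] at this
      refine tendsto_of_tendsto_of_tendsto_of_le_of_le tendsto_const_nhds this
        (fun _ => zero_le) fun n => ?_
      have h3 : (fun x => u (t, x) - d (j n + 1) x) =
          (fun x => u (t, x) - φ n x) + fun x => φ n x - d (j n + 1) x := by
        ext x; simp
      rw [h3]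
      refine (eLpNorm_add_le (hut.sub (hφ n).1.continuous.aestronglyMeasurable)
        ((hφ n).1.continuous.sub (hd (j n + 1)).1.continuous).aestronglyMeasurable
        one_le_two).trans (add_le_add ?_ (hj1 n).le)
      exact (eLpNorm_sub_comm _ _ _ _).le
    have b2 : Tendsto (fun n => eLpNorm (fun x => A (t, x) - fderiv ℝ (d (j n + 1)) x) 2 volume)
        atTop (𝓝 0) := by
      have := h2.add hinv
      rw [add_zero] at this
      refine tendsto_of_tendsto_of_tendsto_of_le_of_le tendsto_const_nhds this
        (fun _ => zero_le) fun n => ?_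
      have h3 : (fun x => A (t, x) - fderiv ℝ (d (j n + 1)) x) =
          (fun x => A (t, x) - fderiv ℝ (φ n) x)
            + fun x => fderiv ℝ (φ n) x - fderiv ℝ (d (j n + 1)) x := by
        ext x; simp
      rw [h3]
      refine (eLpNorm_add_le (hAt.sub (hφ n).continuous_fderiv.aestronglyMeasurable)
        ((hφ n).continuous_fderiv.sub (hd (j n + 1)).continuous_fderiv).aestronglyMeasurable
        one_le_two).trans (add_le_add ?_ (hj2 n).le)
      exact (eLpNorm_sub_comm _ _ _ _).le
    have b3 := (tendsto_eLpNorm_two_iff.1 b1).add (tendsto_eLpNorm_two_iff.1 b2)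
    rw [add_zero] at b3
    rw [ENNReal.tendsto_atTop_zero] at b3 ⊢
    intro ε hε
    obtain ⟨n, hn⟩ := b3 ε hε
    refine ⟨j n + 1, fun N hN => (hmin N t _ hN).trans ?_⟩
    refine le_trans (le_of_eq ?_) (hn n le_rfl)
    rw [he]
    exact lintegral_add_left' ((hut.sub (hd _).1.continuous.aestronglyMeasurable).enorm.pow_const 2)
      _
  -- The minimal distance is dominated by e 0, the squared H¹ norm of u(t), which is integrable in
  -- time.
  have hint : Tendsto (fun N => ∫⁻ t, e (k N t) t) atTop (𝓝 0) := by
    have := tendsto_lintegral_of_dominated_convergence (μ := (volume : Measure ℝ))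
      (F := fun N t => e (k N t) t) (f := fun _ => 0) (e 0) (fun N => measurable_comp_index hem (hkm N))
      (fun N => ae_of_all _ fun t => hmin N t 0 (Nat.zero_le _)) ?_ hlim
    · simpa using this
    · have h1 : ∫⁻ t, e 0 t = ∫⁻ z : ℝ × Space3, (‖u z‖ₑ ^ 2 + ‖A z‖ₑ ^ 2) := by
        simp_rw [he0]
        rw [Measure.volume_eq_prod, lintegral_prod]
        exact ((hu.enorm.pow_const 2).add (hA.enorm.pow_const 2)).aemeasurable
      rw [h1, lintegral_add_left (hu.enorm.pow_const 2), ← eLpNorm_two_sq, ← eLpNorm_two_sq]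
      exact ENNReal.add_ne_top.2 ⟨ENNReal.pow_ne_top hu2.2.ne, ENNReal.pow_ne_top hA2.2.ne⟩
  have htot : ∀ N, ∫⁻ t, e (k N t) t = ∫⁻ z : ℝ × Space3,
      (‖u z - d (k N z.1) z.2‖ₑ ^ 2 + ‖A z - fderiv ℝ (d (k N z.1)) z.2‖ₑ ^ 2) := by
    intro N
    simp_rw [he]
    rw [Measure.volume_eq_prod, lintegral_prod]
    exact ((measurable_from_prod_countable_right (f := fun p : ℕ × (ℝ × Space3) =>
      ‖u p.2 - d p.1 p.2.2‖ₑ ^ 2 + ‖A p.2 - fderiv ℝ (d p.1) p.2.2‖ₑ ^ 2) hem').comp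
      (((hkm N).comp measurable_fst).prodMk measurable_id)).aemeasurable
  simp_rw [htot] at hint
  refine ⟨d, k, hd, hd0, hkm, hkle, ?_, ?_, ?_⟩
  · intro N t h1 h2
    have hz : e 0 t = 0 := by
      rw [he0]
      have h3 : ‖(0 : Space3 →L[ℝ] Space3)‖ₑ = 0 := by
        rw [← ofReal_norm, norm_zero, ENNReal.ofReal_zero]
      simp [h1, h2, h3]
    exact hk0 N t hz
  · rw [tendsto_eLpNorm_two_iff]
    exact tendsto_of_tendsto_of_tendsto_of_le_of_le tendsto_const_nhds hint (fun _ => zero_le)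
      fun N => lintegral_mono fun z => le_self_add
  · rw [tendsto_eLpNorm_two_iff]
    exact tendsto_of_tendsto_of_tendsto_of_le_of_le tendsto_const_nhds hint (fun _ => zero_le)
      fun N => lintegral_mono fun z => le_add_self

/-! ### The divergence and integration by parts -/

/-- The trace as a continuous linear functional. -/
noncomputable def divCLM : (Space3 →L[ℝ] Space3) →L[ℝ] ℝ :=
  LinearMap.toContinuousLinearMap
    { toFun := divOf
      map_add' := fun A B => by simp [divOf, Finset.sum_add_distrib]
      map_smul' := fun c A => by simp [divOf, Finset.mul_sum] }

section L2pairing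

variable {α E F : Type*} [MeasurableSpace α] {μ : Measure α}
    [NormedAddCommGroup E] [NormedSpace ℝ E] [NormedAddCommGroup F] [NormedSpace ℝ F]

theorem lintegral_enorm_clm_apply_le {m : α → E →L[ℝ] F} {f : α → E}
    (hm : AEStronglyMeasurable m μ) (hf : AEStronglyMeasurable f μ) :
    ∫⁻ x, ‖m x (f x)‖ₑ ∂μ ≤ eLpNorm m 2 μ * eLpNorm f 2 μ :=
  (lintegral_mono fun x => (m x).le_opENorm (f x)).trans (lintegral_enorm_mul_enorm_le hm hf)

theorem MeasureTheory.AEStronglyMeasurable.clm_apply' {m : α → E →L[ℝ] F} {f : α → E}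
    (hm : AEStronglyMeasurable m μ) (hf : AEStronglyMeasurable f μ) :
    AEStronglyMeasurable (fun x => m x (f x)) μ :=
  (ContinuousLinearMap.apply ℝ F).flip.aestronglyMeasurable_comp₂ hm hf

theorem MeasureTheory.MemLp.integrable_clm_apply {m : α → E →L[ℝ] F} {f : α → E}
    (hm : MemLp m 2 μ) (hf : MemLp f 2 μ) : Integrable (fun x => m x (f x)) μ :=
  ⟨AEStronglyMeasurable.clm_apply' hm.1 hf.1,
    (lintegral_enorm_clm_apply_le hm.1 hf.1).trans_lt (ENNReal.mul_lt_top hm.2 hf.2)⟩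

theorem tendsto_integral_clm_apply_of_L2 {m : α → E →L[ℝ] F} {f : ℕ → α → E} {f' : α → E}
    (hm : MemLp m 2 μ) (hf : ∀ n, MemLp (f n) 2 μ) (hf' : MemLp f' 2 μ)
    (h : Tendsto (fun n => eLpNorm (fun x => f n x - f' x) 2 μ) atTop (𝓝 0)) :
    Tendsto (fun n => ∫ x, m x (f n x) ∂μ) atTop (𝓝 (∫ x, m x (f' x) ∂μ)) := by
  refine tendsto_integral_of_L1 _ (hm.integrable_clm_apply hf').1
    (Eventually.of_forall fun n => hm.integrable_clm_apply (hf n)) ?_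
  have h1 : Tendsto (fun n => eLpNorm m 2 μ * eLpNorm (fun x => f n x - f' x) 2 μ) atTop
      (𝓝 0) := by
    simpa using ENNReal.Tendsto.const_mul h (Or.inr hm.2.ne)
  refine tendsto_of_tendsto_of_tendsto_of_le_of_le tendsto_const_nhds h1 (fun _ => zero_le) ?_
  intro n
  simp only [← map_sub]
  exact lintegral_enorm_clm_apply_le hm.1 ((hf n).1.sub hf'.1)

end L2pairing

theorem memLp_smul_const {X E : Type*} [NormedAddCommGroup X] [MeasurableSpace X] [BorelSpace X]
    [SecondCountableTopology X] {μ : Measure X} [IsFiniteMeasureOnCompacts μ]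
    [NormedAddCommGroup E] [NormedSpace ℝ E] {p : ℝ≥0∞} {ζ : X → ℝ} (hζ : Continuous ζ)
    (hζc : HasCompactSupport ζ) (v : E) : MemLp (fun x => ζ x • v) p μ := by
  have h1 : Continuous fun x => ζ x • v := hζ.smul continuous_const
  exact h1.memLp_of_hasCompactSupport (hζc.smul_right (f' := fun _ => v))

/-- Coordinatewise integration by parts. The compact support of ζ suffices, so φ may be any C¹
field; the commutator identity uses a linear one. -/
theorem integral_mul_divOf_add_eq_zero {ζ : Space3 → ℝ} (hζ : ContDiff ℝ 1 ζ)
    (hζc : HasCompactSupport ζ) {φ : Space3 → Space3} (hφ : ContDiff ℝ 1 φ) :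
    ∫ x, (ζ x * divOf (fderiv ℝ φ x) + fderiv ℝ ζ x (φ x)) = 0 := by
  have hζ' := hζ.continuous_fderiv one_ne_zero
  have hφ' := hφ.continuous_fderiv one_ne_zero
  have hcomp : ∀ i x, fderiv ℝ (fun y => φ y i) x (EuclideanSpace.single i 1)
      = (fderiv ℝ φ x (EuclideanSpace.single i 1)) i := by
    intro i x
    have := ((EuclideanSpace.proj i : Space3 →L[ℝ] ℝ).hasFDerivAt (x := φ x)).comp x
      (hφ.differentiable one_ne_zero x).hasFDerivAt
    have h2 : fderiv ℝ (fun y => φ y i) x = _ := this.fderiv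
    rw [h2]; rfl
  have hsum : ∀ x, ζ x * divOf (fderiv ℝ φ x) + fderiv ℝ ζ x (φ x) =
      ∑ i : Fin 3, (ζ x * fderiv ℝ (fun y => φ y i) x (EuclideanSpace.single i 1)
        + fderiv ℝ ζ x (EuclideanSpace.single i 1) * φ x i) := by
    intro x
    rw [Finset.sum_add_distrib, divOf, Finset.mul_sum]
    congr 1
    · simp_rw [hcomp]
    · have h3 : φ x = ∑ i : Fin 3, φ x i • EuclideanSpace.single i (1 : ℝ) := by
        ext j; fin_cases j <;> simp [Fin.sum_univ_three]
      conv_lhs => rw [h3]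
      simp [mul_comm]
  have hφi : ∀ i : Fin 3, ContDiff ℝ 1 fun y => φ y i := fun i =>
    (EuclideanSpace.proj i : Space3 →L[ℝ] ℝ).contDiff.comp hφ
  have hs : ∀ g : Space3 → ℝ, HasCompactSupport fun x => ζ x * g x := fun g =>
    hζc.mul_right (f' := g)
  have hs' : ∀ (g : Space3 → ℝ) (e : Space3), HasCompactSupport fun x => fderiv ℝ ζ x e * g x :=
    fun g e => (hζc.fderiv_apply (𝕜 := ℝ) e).mul_right (f' := g)
  have i1 : ∀ i : Fin 3, Integrable fun x =>
      ζ x * fderiv ℝ (fun y => φ y i) x (EuclideanSpace.single i 1) := fun i =>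
    (hζ.continuous.mul (((hφi i).continuous_fderiv one_ne_zero).clm_apply
      continuous_const)).integrable_of_hasCompactSupport
      (hs _)
  have i2 : ∀ i : Fin 3, Integrable fun x =>
      fderiv ℝ ζ x (EuclideanSpace.single i 1) * φ x i := fun i =>
    ((hζ'.clm_apply continuous_const).mul (hφi i).continuous).integrable_of_hasCompactSupport
      (hs' _ _)
  simp_rw [hsum]
  have i3 : ∀ i : Fin 3, Integrable fun x =>
      ζ x * fderiv ℝ (fun y => φ y i) x (EuclideanSpace.single i 1)
        + fderiv ℝ ζ x (EuclideanSpace.single i 1) * φ x i := fun i => (i1 i).add (i2 i)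
  rw [integral_finsetSum _ fun i _ => i3 i]
  refine Finset.sum_eq_zero fun i _ => ?_
  rw [integral_add (i1 i) (i2 i), integral_mul_fderiv_eq_neg_fderiv_mul_of_integrable (i2 i) (i1 i)
    ((hζ.continuous.mul (hφi i).continuous).integrable_of_hasCompactSupport (hs _))
    (fun x _ => hζ.differentiable one_ne_zero x) (fun x _ => (hφi i).differentiable one_ne_zero x),
    neg_add_cancel]

/-- Both terms are continuous in the H¹ distance, so the smooth case passes to the limit. No
condition on ζ at the boundary of Ω is needed, since the approximating fields vanish there. -/
theorem IsH10Limit.integral_mul_divOf_add_eq_zero {Ω : Set Space3} {v : Space3 → Space3}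
    {G : Space3 → Space3 →L[ℝ] Space3} (h : IsH10Limit Ω v G) (hv : MemLp v 2 volume)
    (hG : MemLp G 2 volume) {ζ : Space3 → ℝ} (hζ : ContDiff ℝ 1 ζ) (hζc : HasCompactSupport ζ) :
    ∫ x, (ζ x * divOf (G x) + fderiv ℝ ζ x (v x)) = 0 := by
  obtain ⟨φ, hφ, h1, h2⟩ := h
  have m1 : MemLp (fun x => ζ x • divCLM) 2 volume :=
    memLp_smul_const hζ.continuous hζc divCLM
  have m2 : MemLp (fderiv ℝ ζ) 2 volume :=
    (hζ.continuous_fderiv one_ne_zero).memLp_of_hasCompactSupport (hζc.fderiv (𝕜 := ℝ))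
  have l1 := tendsto_integral_clm_apply_of_L2 m1 (fun n => (hφ n).memLp_fderiv) hG h2
  have l2 := tendsto_integral_clm_apply_of_L2 m2 (fun n => (hφ n).memLp) hv h1
  have l3 := l1.add l2
  rw [← integral_add (m1.integrable_clm_apply hG) (m2.integrable_clm_apply hv)] at l3
  refine tendsto_nhds_unique l3 (tendsto_const_nhds.congr fun n => ?_)
  rw [← integral_add (m1.integrable_clm_apply (hφ n).memLp_fderiv)
    (m2.integrable_clm_apply (hφ n).memLp)]
  exact (_root_.integral_mul_divOf_add_eq_zero hζ hζc ((hφ n).1.of_le (by simp))).symm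

/-! ### Translations and difference quotients -/

theorem measurePreserving_space_shift (h : Space3) :
    MeasurePreserving (fun z : ℝ × Space3 => (z.1, z.2 - h)) volume volume := by
  rw [Measure.volume_eq_prod]
  exact (MeasurePreserving.id _).prod (measurePreserving_sub_right volume h)

theorem eLpNorm_space_shift {F : Type*} [NormedAddCommGroup F] {f : ℝ × Space3 → F} {p : ℝ≥0∞}
    (hf : AEStronglyMeasurable f volume) (h : Space3) :
    eLpNorm (fun z : ℝ × Space3 => f (z.1, z.2 - h)) p volume = eLpNorm f p volume :=
  eLpNorm_comp_measurePreserving (g := f) hf (measurePreserving_space_shift h)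

/-- Taylor's formula with integral remainder, ∫₀¹ (Dψ(x − sh) − Dψ(x))h ds, followed by
Cauchy–Schwarz on the unit interval. -/
theorem enorm_sub_shift_sub_fderiv_sq_le {ψ : Space3 → Space3} (hψ : ContDiff ℝ 1 ψ)
    (x h : Space3) :
    ‖ψ x - ψ (x - h) - fderiv ℝ ψ x h‖ₑ ^ 2 ≤
      ‖h‖ₑ ^ 2 * ∫⁻ s in Ioc (0 : ℝ) 1, ‖fderiv ℝ ψ (x - s • h) - fderiv ℝ ψ x‖ₑ ^ 2 := by
  have hψ' := hψ.continuous_fderiv one_ne_zero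
  have hline : Continuous fun s : ℝ => fderiv ℝ ψ (x - s • h) := by fun_prop
  have hd : ∀ s : ℝ, HasDerivAt (fun s : ℝ => -ψ (x - s • h)) (fderiv ℝ ψ (x - s • h) h) s := by
    intro s
    have h1 : HasDerivAt (fun s : ℝ => x - s • h) (-h) s := by
      simpa using ((hasDerivAt_id s).smul_const h).const_sub x
    have h2 := ((hψ.differentiable one_ne_zero (x - s • h)).hasFDerivAt.comp_hasDerivAt s h1).neg
    rw [map_neg, neg_neg] at h2
    exact h2
  have hI : ∫ s in (0 : ℝ)..1, (fderiv ℝ ψ (x - s • h) - fderiv ℝ ψ x) h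
      = ψ x - ψ (x - h) - fderiv ℝ ψ x h := by
    have h3 := intervalIntegral.integral_eq_sub_of_hasDerivAt (a := 0) (b := 1)
      (fun s _ => hd s) ((hline.clm_apply continuous_const).intervalIntegrable _ _)
    simp only [_root_.sub_apply]
    rw [intervalIntegral.integral_sub ((hline.clm_apply continuous_const).intervalIntegrable _ _)
      (continuous_const.intervalIntegrable _ _), h3]
    simp
    abel
  rw [← hI, intervalIntegral.integral_of_le zero_le_one]
  have h4 : ‖∫ s in Ioc (0 : ℝ) 1, (fderiv ℝ ψ (x - s • h) - fderiv ℝ ψ x) h‖ₑ ≤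
      eLpNorm (fun s : ℝ => fderiv ℝ ψ (x - s • h) - fderiv ℝ ψ x) 2
        (volume.restrict (Ioc (0 : ℝ) 1)) * ‖h‖ₑ := by
    refine (enorm_integral_le_lintegral_enorm _).trans ?_
    refine (lintegral_enorm_clm_apply_le (f := fun _ : ℝ => h)
      (hline.sub continuous_const).aestronglyMeasurable aestronglyMeasurable_const).trans ?_
    refine mul_le_mul' le_rfl (le_of_eq ?_)
    rw [eLpNorm_const' _ two_ne_zero ENNReal.ofNat_ne_top]
    simp
  calc _ ≤ (eLpNorm (fun s : ℝ => fderiv ℝ ψ (x - s • h) - fderiv ℝ ψ x) 2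
        (volume.restrict (Ioc (0 : ℝ) 1)) * ‖h‖ₑ) ^ 2 := by gcongr
    _ = _ := by rw [mul_pow, eLpNorm_two_sq, mul_comm]

/-- Difference quotients of `u ∈ L²(ℝ; H¹₀)` converge to the gradient, quantitatively. -/
theorem eLpNorm_sub_shift_sub_le {Ω : Set Space3} {u : ℝ × Space3 → Space3}
    {A : ℝ × Space3 → Space3 →L[ℝ] Space3} (hu : StronglyMeasurable u) (hA : StronglyMeasurable A)
    (hu2 : MemLp u 2 volume) (hA2 : MemLp A 2 volume)
    (hH : ∀ᵐ t, IsH10Limit Ω (fun x => u (t, x)) (fun x => A (t, x))) (h : Space3) {η : ℝ≥0∞}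
    (hη : ∀ s ∈ Ioc (0 : ℝ) 1,
      eLpNorm (fun z : ℝ × Space3 => A (z.1, z.2 - s • h) - A z) 2 volume ≤ η) :
    eLpNorm (fun z : ℝ × Space3 => u z - u (z.1, z.2 - h) - A z h) 2 volume ≤ ‖h‖ₑ * η := by
  obtain ⟨d, k, hd, -, hk, -, -, h1, h2⟩ := exists_simple_approx hu hA hu2 hA2 hH
  have hvm : ∀ N, StronglyMeasurable fun z : ℝ × Space3 => d (k N z.1) z.2 := fun N =>
    ((measurable_from_prod_countable_right (f := fun p : ℕ × Space3 => d p.1 p.2)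
      fun n => (hd n).1.continuous.measurable).comp
      (((hk N).comp measurable_fst).prodMk measurable_snd)).stronglyMeasurable
  have hDm : ∀ N, StronglyMeasurable fun z : ℝ × Space3 => fderiv ℝ (d (k N z.1)) z.2 := fun N =>
    ((measurable_from_prod_countable_right (f := fun p : ℕ × Space3 => fderiv ℝ (d p.1) p.2)
      fun n => (hd n).continuous_fderiv.measurable).comp
      (((hk N).comp measurable_fst).prodMk measurable_snd)).stronglyMeasurable
  have hsm : ∀ s : Space3, Measurable fun z : ℝ × Space3 => (z.1, z.2 - s) := fun s => by fun_prop
  set a : ℕ → ℝ≥0∞ := fun N => eLpNorm (fun z : ℝ × Space3 => u z - d (k N z.1) z.2) 2 volume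
  set b : ℕ → ℝ≥0∞ := fun N =>
    eLpNorm (fun z : ℝ × Space3 => A z - fderiv ℝ (d (k N z.1)) z.2) 2 volume
  -- For an approximant smooth in x, Taylor's formula holds at each time. Its gradient differs from
  -- A by b N, which enters twice: once at the shifted point and once at the original one.
  have hstep : ∀ N, eLpNorm (fun z : ℝ × Space3 => d (k N z.1) z.2 - d (k N z.1) (z.2 - h)
      - fderiv ℝ (d (k N z.1)) z.2 h) 2 volume ≤ ‖h‖ₑ * (b N + η + b N) := by
    intro N
    have hs : ∀ s ∈ Ioc (0 : ℝ) 1, eLpNorm (fun z : ℝ × Space3 =>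
        fderiv ℝ (d (k N z.1)) (z.2 - s • h) - fderiv ℝ (d (k N z.1)) z.2) 2 volume
          ≤ b N + η + b N := by
      intro s hs
      have e1 : (fun z : ℝ × Space3 =>
          fderiv ℝ (d (k N z.1)) (z.2 - s • h) - fderiv ℝ (d (k N z.1)) z.2) =
          ((fun z : ℝ × Space3 => fderiv ℝ (d (k N z.1)) (z.2 - s • h) - A (z.1, z.2 - s • h))
            + fun z => A (z.1, z.2 - s • h) - A z)
            + fun z => A z - fderiv ℝ (d (k N z.1)) z.2 := by
        ext z; simp
      have m1 : StronglyMeasurable fun z : ℝ × Space3 =>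
          fderiv ℝ (d (k N z.1)) (z.2 - s • h) - A (z.1, z.2 - s • h) :=
        ((hDm N).sub hA).comp_measurable (hsm (s • h))
      have m2 : StronglyMeasurable fun z : ℝ × Space3 => A (z.1, z.2 - s • h) - A z :=
        (hA.comp_measurable (hsm (s • h))).sub hA
      rw [e1]
      refine (eLpNorm_add_le (m1.add m2).aestronglyMeasurable
        (hA.sub (hDm N)).aestronglyMeasurable one_le_two).trans (add_le_add ?_ le_rfl)
      refine (eLpNorm_add_le m1.aestronglyMeasurable m2.aestronglyMeasurable one_le_two).trans ?_
      refine add_le_add (le_of_eq ?_) (hη s hs)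
      rw [eLpNorm_space_shift (f := fun z : ℝ × Space3 => fderiv ℝ (d (k N z.1)) z.2 - A z)
        ((hDm N).sub hA).aestronglyMeasurable]
      exact eLpNorm_sub_comm _ _ _ _
    rw [← ENNReal.pow_le_pow_left_iff two_ne_zero, eLpNorm_two_sq]
    calc _ ≤ ∫⁻ z : ℝ × Space3, ‖h‖ₑ ^ 2 * ∫⁻ s in Ioc (0 : ℝ) 1,
          ‖fderiv ℝ (d (k N z.1)) (z.2 - s • h) - fderiv ℝ (d (k N z.1)) z.2‖ₑ ^ 2 :=
          lintegral_mono fun z => enorm_sub_shift_sub_fderiv_sq_le ((hd _).1.of_le (by simp)) _ _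
      _ = ‖h‖ₑ ^ 2 * ∫⁻ s in Ioc (0 : ℝ) 1, ∫⁻ z : ℝ × Space3,
          ‖fderiv ℝ (d (k N z.1)) (z.2 - s • h) - fderiv ℝ (d (k N z.1)) z.2‖ₑ ^ 2 := by
          rw [lintegral_const_mul' _ _ (by simp), lintegral_lintegral_swap]
          refine (Measurable.pow_const (StronglyMeasurable.enorm ?_) 2).aemeasurable
          refine StronglyMeasurable.sub ?_ ((hDm N).comp_measurable measurable_fst)
          exact (hDm N).comp_measurable (g := fun p : (ℝ × Space3) × ℝ =>
            (p.1.1, p.1.2 - p.2 • h)) (by fun_prop)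
      _ ≤ ‖h‖ₑ ^ 2 * ∫⁻ s in Ioc (0 : ℝ) 1, (b N + η + b N) ^ 2 := by
          gcongr ‖h‖ₑ ^ 2 * ?_
          refine setLIntegral_mono' measurableSet_Ioc fun s hs' => ?_
          rw [← eLpNorm_two_sq]
          gcongr
          exact hs s hs'
      _ = _ := by simp [mul_pow]
  have hlim : Tendsto (fun N => a N + ‖h‖ₑ * (b N + η + b N) + a N + b N * ‖h‖ₑ) atTop
      (𝓝 (0 + ‖h‖ₑ * (0 + η + 0) + 0 + 0 * ‖h‖ₑ)) := by
    refine ((h1.add ?_).add h1).add ?_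
    · exact ENNReal.Tendsto.const_mul ((h2.add tendsto_const_nhds).add h2) (Or.inr (by simp))
    · exact ENNReal.Tendsto.mul_const h2 (Or.inr (by simp))
  simp only [zero_add, add_zero, zero_mul] at hlim
  -- The bound holds up to errors vanishing with N, so the approximation can be removed.
  refine ge_of_tendsto' hlim fun N => ?_
  have e2 : (fun z : ℝ × Space3 => u z - u (z.1, z.2 - h) - A z h) =
      (((fun z : ℝ × Space3 => u z - d (k N z.1) z.2)
        + fun z => d (k N z.1) z.2 - d (k N z.1) (z.2 - h) - fderiv ℝ (d (k N z.1)) z.2 h)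
        + fun z => d (k N z.1) (z.2 - h) - u (z.1, z.2 - h))
        + fun z => (fderiv ℝ (d (k N z.1)) z.2 - A z) h := by
    ext1 z; simp only [Pi.add_apply, _root_.sub_apply]; abel
  have m0 : StronglyMeasurable fun z : ℝ × Space3 => u z - d (k N z.1) z.2 := hu.sub (hvm N)
  have m1 : StronglyMeasurable fun z : ℝ × Space3 =>
      d (k N z.1) (z.2 - h) - u (z.1, z.2 - h) :=
    ((hvm N).sub hu).comp_measurable (hsm h)
  have m3 : StronglyMeasurable fun z : ℝ × Space3 => (fderiv ℝ (d (k N z.1)) z.2 - A z) h :=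
    (ContinuousLinearMap.apply ℝ Space3 h).continuous.comp_stronglyMeasurable ((hDm N).sub hA)
  have m2 : StronglyMeasurable fun z : ℝ × Space3 =>
      d (k N z.1) z.2 - d (k N z.1) (z.2 - h) - fderiv ℝ (d (k N z.1)) z.2 h :=
    ((hvm N).sub ((hvm N).comp_measurable (hsm h))).sub
      ((ContinuousLinearMap.apply ℝ Space3 h).continuous.comp_stronglyMeasurable (hDm N))
  rw [e2]
  refine (eLpNorm_add_le ((m0.add m2).add m1).aestronglyMeasurable m3.aestronglyMeasurable
    one_le_two).trans (add_le_add ((eLpNorm_add_le (m0.add m2).aestronglyMeasurable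
      m1.aestronglyMeasurable one_le_two).trans (add_le_add ((eLpNorm_add_le
      m0.aestronglyMeasurable m2.aestronglyMeasurable one_le_two).trans
      (add_le_add le_rfl (hstep N))) ?_)) ?_)
  · rw [eLpNorm_space_shift (f := fun z : ℝ × Space3 => d (k N z.1) z.2 - u z)
      ((hvm N).sub hu).aestronglyMeasurable]
    exact (eLpNorm_sub_comm _ _ _ _).le
  · have h5 : b N = eLpNorm (fun z : ℝ × Space3 => fderiv ℝ (d (k N z.1)) z.2 - A z) 2 volume :=
      eLpNorm_sub_comm _ _ _ _
    rw [h5, mul_comm]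
    have h6 := eLpNorm_le_nnreal_smul_eLpNorm_of_ae_le_mul (μ := volume) (c := ‖h‖₊)
      (f := fun z : ℝ × Space3 => (fderiv ℝ (d (k N z.1)) z.2 - A z) h)
      (g := fun z : ℝ × Space3 => fderiv ℝ (d (k N z.1)) z.2 - A z)
      (ae_of_all _ fun z => by
        rw [mul_comm]; exact (fderiv ℝ (d (k N z.1)) z.2 - A z).le_opNNNorm h) 2
    exact h6

/-- The translations depend continuously on h in the compact-open topology and preserve the measure,
so composition with them is continuous in L². -/
theorem tendsto_eLpNorm_space_shift {F : Type*} [NormedAddCommGroup F] {f : ℝ × Space3 → F}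
    (hf : MemLp f 2 volume) :
    Tendsto (fun h : Space3 => eLpNorm (fun z : ℝ × Space3 => f (z.1, z.2 - h) - f z) 2 volume)
      (𝓝 0) (𝓝 0) := by
  let g : Space3 → C(ℝ × Space3, ℝ × Space3) := fun h => ⟨fun z => (z.1, z.2 - h), by fun_prop⟩
  have hg : Continuous g := by
    refine ContinuousMap.continuous_of_continuous_uncurry _ ?_
    simp only [g, ContinuousMap.coe_mk]
    fun_prop
  have hgm : ∀ h, MeasurePreserving (g h) volume volume := measurePreserving_space_shift
  have key := (continuous_const (y := hf.toLp f)).compMeasurePreservingLp hg hgm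
    ENNReal.ofNat_ne_top
  have h0 := (key.tendsto 0).edist (tendsto_const_nhds (x := hf.toLp f))
  have e : ∀ h, edist (Lp.compMeasurePreserving (g h) (hgm h) (hf.toLp f)) (hf.toLp f) =
      eLpNorm (fun z : ℝ × Space3 => f (z.1, z.2 - h) - f z) 2 volume := by
    intro h
    rw [Lp.toLp_compMeasurePreserving hf (hgm h), Lp.edist_toLp_toLp]
    rfl
  simp_rw [e] at h0
  convert h0 using 2
  simp

/-! ### Time slices and convolution in space -/

theorem ae_of_ae_time {p : ℝ → Prop} (h : ∀ᵐ t, p t) : ∀ᵐ z : ℝ × Space3, p z.1 := by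
  rw [Measure.volume_eq_prod]
  exact Measure.quasiMeasurePreserving_fst.ae h

/-- Cauchy–Schwarz for the measure with density w, after writing w a = w^(1/2) · (w^(1/2) a). -/
theorem sq_lintegral_mul_le {α : Type*} [MeasurableSpace α] {μ : Measure α} {w a : α → ℝ≥0∞}
    (hw : Measurable w) (ha : Measurable a) :
    (∫⁻ x, w x * a x ∂μ) ^ 2 ≤ (∫⁻ x, w x ∂μ) * ∫⁻ x, w x * a x ^ 2 ∂μ := by
  have hs : ∀ x, w x ^ (1 / 2 : ℝ) * w x ^ (1 / 2 : ℝ) = w x := by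
    intro x
    rw [← ENNReal.rpow_add_of_nonneg _ _ (by norm_num) (by norm_num)]
    norm_num
  have h := ENNReal.lintegral_mul_le_Lp_mul_Lq μ Real.HolderConjugate.two_two
    (hw.pow_const (1 / 2 : ℝ)).aemeasurable ((hw.pow_const (1 / 2 : ℝ)).mul ha).aemeasurable
  simp only [Pi.mul_apply, ← mul_assoc, hs] at h
  have e1 : ∀ x, (w x ^ (1 / 2 : ℝ)) ^ (2 : ℝ) = w x := by
    intro x; rw [← ENNReal.rpow_mul]; norm_num
  have e2 : ∀ x, (w x ^ (1 / 2 : ℝ) * a x) ^ (2 : ℝ) = w x * a x ^ 2 := by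
    intro x; rw [ENNReal.mul_rpow_of_nonneg _ _ (by norm_num), e1]; norm_num
  simp_rw [e1, e2] at h
  calc _ ≤ ((∫⁻ x, w x ∂μ) ^ (1 / 2 : ℝ) * (∫⁻ x, w x * a x ^ 2 ∂μ) ^ (1 / 2 : ℝ)) ^ 2 := by gcongr
    _ = _ := by
      rw [mul_pow, ← ENNReal.rpow_natCast, ← ENNReal.rpow_mul, ← ENNReal.rpow_natCast,
        ← ENNReal.rpow_mul]
      norm_num

/-- The weighted Cauchy–Schwarz inequality and Tonelli. It replaces Minkowski's integral inequality,
both for Young's inequality in L² and for the L² error of mollification. -/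
theorem lintegral_sq_lintegral_mul_le {α β : Type*} [MeasurableSpace α] [MeasurableSpace β]
    {μ : Measure α} {ν : Measure β} [SFinite μ] [SFinite ν] {w : β → ℝ≥0∞} {H : α × β → ℝ≥0∞}
    (hw : Measurable w) (hH : Measurable H) :
    ∫⁻ z, (∫⁻ y, w y * H (z, y) ∂ν) ^ 2 ∂μ ≤
      (∫⁻ y, w y ∂ν) * ∫⁻ y, w y * ∫⁻ z, H (z, y) ^ 2 ∂μ ∂ν := by
  calc _ ≤ ∫⁻ z, (∫⁻ y, w y ∂ν) * ∫⁻ y, w y * H (z, y) ^ 2 ∂ν ∂μ :=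
        lintegral_mono fun z => sq_lintegral_mul_le hw (hH.comp measurable_prodMk_left)
    _ = (∫⁻ y, w y ∂ν) * ∫⁻ z, ∫⁻ y, w y * H (z, y) ^ 2 ∂ν ∂μ := by
        rw [lintegral_const_mul]
        exact ((hw.comp measurable_snd).mul (hH.pow_const 2)).lintegral_prod_right'
    _ = _ := by
        rw [lintegral_lintegral_swap
          ((hw.comp measurable_snd).mul (hH.pow_const 2)).aemeasurable]
        congr 1
        refine lintegral_congr fun y => ?_
        rw [lintegral_const_mul]
        exact (hH.comp measurable_prodMk_right).pow_const 2

theorem stronglyMeasurable_shift_pair {E : Type*} [NormedAddCommGroup E]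
    {g : ℝ × Space3 → E} (hg : StronglyMeasurable g) :
    StronglyMeasurable fun p : (ℝ × Space3) × Space3 => g (p.1.1, p.1.2 - p.2) :=
  hg.comp_measurable (g := fun p : (ℝ × Space3) × Space3 => (p.1.1, p.1.2 - p.2)) (by fun_prop)

/-- For almost every time the slice of a space-time `L²` function is in `L²`. -/
theorem ae_memLp_slice {E : Type*} [NormedAddCommGroup E] {g : ℝ × Space3 → E}
    (hg : StronglyMeasurable g) (hg2 : MemLp g 2 volume) :
    ∀ᵐ t, MemLp (fun x => g (t, x)) 2 volume := by
  have h1 : ∫⁻ t, ∫⁻ x, ‖g (t, x)‖ₑ ^ 2 ≠ ⊤ := by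
    rw [← lintegral_prod (f := fun z => ‖g z‖ₑ ^ 2) (hg.enorm.pow_const 2).aemeasurable,
      ← Measure.volume_eq_prod, ← eLpNorm_two_sq]
    exact ENNReal.pow_ne_top hg2.2.ne
  filter_upwards [ae_lt_top (hg.enorm.pow_const 2).lintegral_prod_right' h1] with t ht
  refine ⟨(hg.comp_measurable measurable_prodMk_left).aestronglyMeasurable, ?_⟩
  rw [← eLpNorm_two_sq] at ht
  exact lt_top_iff_ne_top.2 fun h => by simp [h] at ht

section Kernel

variable {E F : Type*} [NormedAddCommGroup E] [NormedSpace ℝ E]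
  [NormedAddCommGroup F] [NormedSpace ℝ F]

/-- Convolution in the space variable with an operator valued kernel. -/
noncomputable def spaceConv (K : Space3 → E →L[ℝ] F) (g : ℝ × Space3 → E) (z : ℝ × Space3) : F :=
  ∫ y, K y (g (z.1, z.2 - y))

variable {K : Space3 → E →L[ℝ] F} {g : ℝ × Space3 → E}

theorem stronglyMeasurable_kernel_apply (hK : Continuous K) (hg : StronglyMeasurable g) :
    StronglyMeasurable fun p : (ℝ × Space3) × Space3 => K p.2 (g (p.1.1, p.1.2 - p.2)) :=
  (ContinuousLinearMap.apply ℝ F).flip.continuous₂.comp_stronglyMeasurable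
    ((hK.stronglyMeasurable.comp_measurable measurable_snd).prodMk
      (stronglyMeasurable_shift_pair hg))

theorem stronglyMeasurable_spaceConv (hK : Continuous K) (hg : StronglyMeasurable g) :
    StronglyMeasurable (spaceConv K g) :=
  (stronglyMeasurable_kernel_apply hK hg).integral_prod_right'

theorem enorm_spaceConv_le (z : ℝ × Space3) :
    ‖spaceConv K g z‖ₑ ≤ ∫⁻ y, ‖K y‖ₑ * ‖g (z.1, z.2 - y)‖ₑ :=
  (enorm_integral_le_lintegral_enorm _).trans (lintegral_mono fun _ => (K _).le_opENorm _)

theorem lintegral_shift {f : ℝ × Space3 → ℝ≥0∞} (hf : Measurable f) (h : Space3) :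
    ∫⁻ z : ℝ × Space3, f (z.1, z.2 - h) = ∫⁻ z, f z :=
  (measurePreserving_space_shift h).lintegral_comp hf

theorem lintegral_enorm_spaceConv_le (hK : Continuous K) (hg : StronglyMeasurable g) :
    ∫⁻ z, ‖spaceConv K g z‖ₑ ≤ (∫⁻ y, ‖K y‖ₑ) * ∫⁻ z, ‖g z‖ₑ := by
  calc _ ≤ ∫⁻ z : ℝ × Space3, ∫⁻ y, ‖K y‖ₑ * ‖g (z.1, z.2 - y)‖ₑ :=
        lintegral_mono fun z => enorm_spaceConv_le z
    _ = ∫⁻ y, ∫⁻ z : ℝ × Space3, ‖K y‖ₑ * ‖g (z.1, z.2 - y)‖ₑ :=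
        lintegral_lintegral_swap ((hK.enorm.measurable.comp measurable_snd).mul
          (stronglyMeasurable_shift_pair hg).enorm).aemeasurable
    _ = ∫⁻ y, ‖K y‖ₑ * ∫⁻ z, ‖g z‖ₑ := by
        refine lintegral_congr fun y => ?_
        have h1 : Measurable fun z : ℝ × Space3 => ‖g (z.1, z.2 - y)‖ₑ :=
          (stronglyMeasurable_shift_pair hg).enorm.comp measurable_prodMk_right
        rw [lintegral_const_mul _ h1, lintegral_shift (f := fun z => ‖g z‖ₑ) hg.enorm]
    _ = _ := lintegral_mul_const _ hK.enorm.measurable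

theorem eLpNorm_spaceConv_le (hK : Continuous K) (hg : StronglyMeasurable g) :
    eLpNorm (spaceConv K g) 2 volume ≤ (∫⁻ y, ‖K y‖ₑ) * eLpNorm g 2 volume := by
  rw [← ENNReal.pow_le_pow_left_iff two_ne_zero, eLpNorm_two_sq, mul_pow, eLpNorm_two_sq]
  calc _ ≤ ∫⁻ z : ℝ × Space3, (∫⁻ y, ‖K y‖ₑ * ‖g (z.1, z.2 - y)‖ₑ) ^ 2 :=
        lintegral_mono fun z => by gcongr; exact enorm_spaceConv_le z
    _ ≤ _ := lintegral_sq_lintegral_mul_le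
        (H := fun p : (ℝ × Space3) × Space3 => ‖g (p.1.1, p.1.2 - p.2)‖ₑ) hK.enorm.measurable
        (stronglyMeasurable_shift_pair hg).enorm
    _ = (∫⁻ y, ‖K y‖ₑ) * ∫⁻ y, ‖K y‖ₑ * ∫⁻ z, ‖g z‖ₑ ^ 2 := by
        congr 1
        refine lintegral_congr fun y => ?_
        rw [lintegral_shift (f := fun z => ‖g z‖ₑ ^ 2) (hg.enorm.pow_const 2)]
    _ = _ := by rw [lintegral_mul_const _ hK.enorm.measurable]; ring

theorem lintegral_enorm_lt_top_of_hasCompactSupport (hK : Continuous K)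
    (hKc : HasCompactSupport K) : ∫⁻ y, ‖K y‖ₑ < ⊤ :=
  (hK.integrable_of_hasCompactSupport hKc).2

theorem memLp_spaceConv (hK : Continuous K) (hKc : HasCompactSupport K)
    (hg : StronglyMeasurable g) (hg2 : MemLp g 2 volume) : MemLp (spaceConv K g) 2 volume :=
  ⟨(stronglyMeasurable_spaceConv hK hg).aestronglyMeasurable,
    (eLpNorm_spaceConv_le hK hg).trans_lt
      (ENNReal.mul_lt_top (lintegral_enorm_lt_top_of_hasCompactSupport hK hKc) hg2.2)⟩

theorem integrable_spaceConv (hK : Continuous K) (hKc : HasCompactSupport K)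
    (hg : StronglyMeasurable g) (hg1 : Integrable g volume) : Integrable (spaceConv K g) volume :=
  ⟨(stronglyMeasurable_spaceConv hK hg).aestronglyMeasurable,
    (lintegral_enorm_spaceConv_le hK hg).trans_lt
      (ENNReal.mul_lt_top (lintegral_enorm_lt_top_of_hasCompactSupport hK hKc) hg1.2)⟩

end Kernel

/-! ### The DiPerna–Lions commutator -/

section Commutator

variable {E F : Type*} [NormedAddCommGroup E] [NormedSpace ℝ E]
  [NormedAddCommGroup F] [NormedSpace ℝ F]

theorem MeasureTheory.MemLp.comp_const_sub {E : Type*} [NormedAddCommGroup E] {f : Space3 → E}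
    {p : ℝ≥0∞} (hf : MemLp f p volume) (x : Space3) : MemLp (fun y => f (x - y)) p volume :=
  hf.comp_measurePreserving (Measure.measurePreserving_sub_left volume x)

/-- Space mollification `κ ∗ R`. -/
noncomputable def moll (κ : Space3 → ℝ) (R : ℝ × Space3 → E) : ℝ × Space3 → E :=
  spaceConv (fun y => κ y • ContinuousLinearMap.id ℝ E) R

/-- The space gradient of `κ ∗ R`. -/
noncomputable def mollGrad (κ : Space3 → ℝ) (R : ℝ × Space3 → E) : ℝ × Space3 → Space3 →L[ℝ] E :=
  spaceConv (fun y => ContinuousLinearMap.smulRightL ℝ Space3 E (fderiv ℝ κ y)) R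

/-- The divergence of the mollified flux `κ ∗ (u ⊗ R)`. -/
noncomputable def mollFlux (κ : Space3 → ℝ) (u : ℝ × Space3 → Space3) (R : ℝ × Space3 → E)
    (z : ℝ × Space3) : E :=
  ∫ y, fderiv ℝ κ y (u (z.1, z.2 - y)) • R (z.1, z.2 - y)

/-- The commutator of convection by `u` and convolution with `κ`. -/
noncomputable def transportCommutator (κ : Space3 → ℝ) (u : ℝ × Space3 → Space3)
    (A : ℝ × Space3 → Space3 →L[ℝ] Space3) (R : ℝ × Space3 → E) (z : ℝ × Space3) : E :=
  mollGrad κ R z (u z) + divOf (A z) • moll κ R z - mollFlux κ u R z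

theorem moll_apply (κ : Space3 → ℝ) (R : ℝ × Space3 → E) (z : ℝ × Space3) :
    moll κ R z = ∫ y, κ y • R (z.1, z.2 - y) := rfl

variable {κ : Space3 → ℝ}

theorem continuous_moll_kernel (hκ : ContDiff ℝ 1 κ) :
    Continuous fun y => κ y • ContinuousLinearMap.id ℝ E :=
  hκ.continuous.smul continuous_const

theorem hasCompactSupport_moll_kernel (hκc : HasCompactSupport κ) :
    HasCompactSupport fun y => κ y • ContinuousLinearMap.id ℝ E :=
  hκc.smul_right (f' := fun _ => ContinuousLinearMap.id ℝ E)

theorem continuous_mollGrad_kernel (hκ : ContDiff ℝ 1 κ) :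
    Continuous fun y => ContinuousLinearMap.smulRightL ℝ Space3 E (fderiv ℝ κ y) :=
  (ContinuousLinearMap.smulRightL ℝ Space3 E).continuous.comp (hκ.continuous_fderiv one_ne_zero)

theorem hasCompactSupport_mollGrad_kernel (hκc : HasCompactSupport κ) :
    HasCompactSupport fun y => ContinuousLinearMap.smulRightL ℝ Space3 E (fderiv ℝ κ y) :=
  (hκc.fderiv (𝕜 := ℝ)).comp_left (g := ContinuousLinearMap.smulRightL ℝ Space3 E) (map_zero _)

/-- The kernel of a convolution is integrable against a slice in `L²`. -/
theorem integrable_kernel_of_memLp_slice {K : Space3 → E →L[ℝ] F} (hK : Continuous K)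
    (hKc : HasCompactSupport K) {f : Space3 → E} (hf : MemLp f 2 volume) (x : Space3) :
    Integrable fun y => K y (f (x - y)) :=
  (hK.memLp_of_hasCompactSupport hKc).integrable_clm_apply (hf.comp_const_sub x)

theorem integrable_mollFlux_slice (hκ : ContDiff ℝ 1 κ) (hκc : HasCompactSupport κ)
    {v : Space3 → Space3} {f : Space3 → E} (hv : MemLp v 2 volume) (hf : MemLp f 2 volume)
    (x : Space3) : Integrable fun y => fderiv ℝ κ y (v (x - y)) • f (x - y) := by
  have hκ' := hκ.continuous_fderiv one_ne_zero
  obtain ⟨C, hC⟩ := hκ'.bounded_above_of_compact_support (hκc.fderiv (𝕜 := ℝ))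
  have hv' := hv.comp_const_sub x
  have hf' := hf.comp_const_sub x
  have h1 : Integrable fun y => ‖v (x - y)‖ * ‖f (x - y)‖ := hv'.norm.integrable_mul hf'.norm
  refine (h1.const_mul C).mono' ((hκ'.aestronglyMeasurable.clm_apply' hv'.1).smul hf'.1)
    (ae_of_all _ fun y => ?_)
  rw [norm_smul, ← mul_assoc]
  gcongr
  exact (fderiv ℝ κ y).le_of_opNorm_le (hC y) _

theorem stronglyMeasurable_mollFlux {u : ℝ × Space3 → Space3} {R : ℝ × Space3 → E}
    (hκ : ContDiff ℝ 1 κ) (hu : StronglyMeasurable u) (hR : StronglyMeasurable R) :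
    StronglyMeasurable (mollFlux κ u R) :=
  ((stronglyMeasurable_kernel_apply (hκ.continuous_fderiv one_ne_zero) hu).smul
    (stronglyMeasurable_shift_pair hR)).integral_prod_right'

/-- The product of u and R is only in L¹, so the flux is dominated by the convolution of |∇κ| with
|u||R|, to which Young's inequality in L¹ applies. Slices in L² justify the pointwise comparison for
almost every time. -/
theorem integrable_mollFlux {u : ℝ × Space3 → Space3} {R : ℝ × Space3 → E}
    (hκ : ContDiff ℝ 1 κ) (hκc : HasCompactSupport κ) (hu : StronglyMeasurable u)
    (hu2 : MemLp u 2 volume) (hR : StronglyMeasurable R) (hR2 : MemLp R 2 volume) :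
    Integrable (mollFlux κ u R) := by
  refine ⟨(stronglyMeasurable_mollFlux hκ hu hR).aestronglyMeasurable, ?_⟩
  have hκ' := hκ.continuous_fderiv one_ne_zero
  have hg : StronglyMeasurable fun z => ‖u z‖ * ‖R z‖ := hu.norm.mul hR.norm
  have hg1 : Integrable fun z => ‖u z‖ * ‖R z‖ := hu2.norm.integrable_mul hR2.norm
  have hK : Continuous fun y => ‖fderiv ℝ κ y‖ • ContinuousLinearMap.id ℝ ℝ :=
    hκ'.norm.smul continuous_const
  have hKc : HasCompactSupport fun y => ‖fderiv ℝ κ y‖ • ContinuousLinearMap.id ℝ ℝ :=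
    (hκc.fderiv (𝕜 := ℝ)).norm.smul_right (f' := fun _ => ContinuousLinearMap.id ℝ ℝ)
  refine lt_of_le_of_lt ?_ (integrable_spaceConv hK hKc hg hg1).2
  have hi : ∀ᵐ z : ℝ × Space3, Integrable fun y =>
      ‖fderiv ℝ κ y‖ * (‖u (z.1, z.2 - y)‖ * ‖R (z.1, z.2 - y)‖) := by
    have h1 : ∀ᵐ t : ℝ, ∀ x, Integrable fun y =>
        ‖fderiv ℝ κ y‖ * (‖u (t, x - y)‖ * ‖R (t, x - y)‖) := by
      filter_upwards [ae_memLp_slice hu hu2, ae_memLp_slice hR hR2] with t hut hRt x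
      obtain ⟨C, hC⟩ := hκ'.bounded_above_of_compact_support (hκc.fderiv (𝕜 := ℝ))
      have h1 : Integrable fun y => ‖u (t, x - y)‖ * ‖R (t, x - y)‖ :=
        (hut.comp_const_sub x).norm.integrable_mul (hRt.comp_const_sub x).norm
      exact integrable_bounded_smul h1 hκ'.norm.aestronglyMeasurable
        (fun y => by rw [norm_norm]; exact hC y)
    filter_upwards [ae_of_ae_time h1] with z hz using hz z.2
  refine lintegral_mono_ae ?_
  filter_upwards [hi] with z hz
  rw [← ofReal_norm, ← ofReal_norm]
  refine ENNReal.ofReal_le_ofReal ((norm_integral_le_of_norm_le hz (ae_of_all _ fun y => ?_)).trans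
    (le_abs_self _))
  rw [norm_smul, ← mul_assoc]
  gcongr
  exact (fderiv ℝ κ y).le_opNorm _

/-- At fixed (t, x) the divergence theorem for the linear field y ↦ A(t, x)y gives ∫ (κ div A +
∇κ·(A y)) dy = 0. Subtracting this multiple of R(t, x) produces differences of R wherever u has been
replaced by its linear part. Each of the three terms then has a small factor. -/
theorem ae_commutator_eq [CompleteSpace E] {u : ℝ × Space3 → Space3}
    {A : ℝ × Space3 → Space3 →L[ℝ] Space3} {R : ℝ × Space3 → E} (hu : StronglyMeasurable u)
    (hu2 : MemLp u 2 volume) (hR : StronglyMeasurable R) (hR2 : MemLp R 2 volume)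
    (hκ : ContDiff ℝ 1 κ) (hκc : HasCompactSupport κ) :
    ∀ᵐ t, ∀ x, transportCommutator κ u A R (t, x) =
      ∫ y, (fderiv ℝ κ y (u (t, x) - u (t, x - y) - A (t, x) y) • R (t, x - y)
        + fderiv ℝ κ y (A (t, x) y) • (R (t, x - y) - R (t, x))
        + (κ y * divOf (A (t, x))) • (R (t, x - y) - R (t, x))) := by
  filter_upwards [ae_memLp_slice hu hu2, ae_memLp_slice hR hR2] with t hut hRt x
  have i1 := integrable_kernel_of_memLp_slice (F := Space3 →L[ℝ] E) (continuous_mollGrad_kernel hκ)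
    (hasCompactSupport_mollGrad_kernel hκc) hRt x
  have i2 := integrable_kernel_of_memLp_slice (F := E) (continuous_moll_kernel hκ)
    (hasCompactSupport_moll_kernel hκc) hRt x
  have i3 := integrable_mollFlux_slice hκ hκc hut hRt x
  have i4 : Integrable fun y => κ y * divOf (A (t, x)) + fderiv ℝ κ y (A (t, x) y) :=
    Continuous.integrable_of_hasCompactSupport
      ((hκ.continuous.mul continuous_const).add
        ((hκ.continuous_fderiv one_ne_zero).clm_apply (A (t, x)).continuous))
      ((hκc.mul_right (f' := fun _ => divOf (A (t, x)))).add
        ((hκc.fderiv (𝕜 := ℝ)).mono fun y hy h0 => hy (by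
          change fderiv ℝ κ y (A (t, x) y) = 0
          rw [h0]; rfl)))
  have h4 : ∫ y, (κ y * divOf (A (t, x)) + fderiv ℝ κ y (A (t, x) y)) = 0 := by
    have := integral_mul_divOf_add_eq_zero hκ hκc (A (t, x)).contDiff
    simpa using this
  have e1 : mollGrad κ R (t, x) (u (t, x)) = ∫ y, fderiv ℝ κ y (u (t, x)) • R (t, x - y) := by
    have := (ContinuousLinearMap.apply ℝ E (u (t, x))).integral_comp_comm i1
    exact this.symm
  rw [transportCommutator, e1, moll_apply, mollFlux, ← integral_smul]
  have i1' : Integrable fun y => fderiv ℝ κ y (u (t, x)) • R (t, x - y) :=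
    (ContinuousLinearMap.apply ℝ E (u (t, x))).integrable_comp i1
  have i2' : Integrable fun y => divOf (A (t, x)) • κ y • R (t, x - y) := i2.smul _
  have i4' := i4.smul_const (R (t, x))
  have h5 : ∫ y, (κ y * divOf (A (t, x)) + fderiv ℝ κ y (A (t, x) y)) • R (t, x) = 0 := by
    rw [integral_smul_const, h4, zero_smul]
  have i5 : Integrable fun y => fderiv ℝ κ y (u (t, x)) • R (t, x - y)
    + divOf (A (t, x)) • κ y • R (t, x - y) := i1'.add i2'
  have i6 : Integrable fun y => fderiv ℝ κ y (u (t, x)) • R (t, x - y)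
    + divOf (A (t, x)) • κ y • R (t, x - y) - fderiv ℝ κ y (u (t, x - y)) • R (t, x - y) :=
    i5.sub i3
  simp only
  rw [← integral_add i1' i2', ← integral_sub i5 i3, ← sub_zero (∫ y, _), ← h5,
    ← integral_sub i6 i4']
  refine integral_congr_ae (ae_of_all _ fun y => ?_)
  simp only [map_sub, sub_smul, add_smul, smul_sub, smul_smul, mul_comm (divOf (A (t, x)))]
  abel

end Commutator

/-! ### Mollifiers -/

/-- A family of mollifiers with uniformly bounded first moment of the gradient. -/
structure IsMollifierSeq (κ : ℕ → Space3 → ℝ) (B : ℝ≥0∞) : Prop where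
  contDiff : ∀ n, ContDiff ℝ ∞ (κ n)
  tsupport_subset : ∀ n, tsupport (κ n) ⊆ Metric.closedBall 0 (1 / ((n : ℝ) + 1))
  lintegral_eq : ∀ n, ∫⁻ y, ‖κ n y‖ₑ = 1
  integral_eq : ∀ n, ∫ y, κ n y = 1
  moment_le : ∀ n, ∫⁻ y, ‖fderiv ℝ (κ n) y‖ₑ * ‖y‖ₑ ≤ B

theorem IsMollifierSeq.hasCompactSupport {κ : ℕ → Space3 → ℝ} {B : ℝ≥0∞}
    (h : IsMollifierSeq κ B) (n : ℕ) : HasCompactSupport (κ n) :=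
  (isCompact_closedBall _ _).of_isClosed_subset (isClosed_tsupport _) (h.tsupport_subset n)

/-- Rescale a unit-mass bump by n + 1. Differentiation costs a factor n + 1, which the weight |y|
returns, so the first moment of the gradient does not depend on n. -/
theorem exists_isMollifierSeq : ∃ κ B, B ≠ ⊤ ∧ IsMollifierSeq κ B := by
  let b : ContDiffBump (0 : Space3) := ⟨1 / 2, 1, by norm_num, by norm_num⟩
  set ρ : Space3 → ℝ := b.normed volume with hρ
  have hρd : ContDiff ℝ ∞ ρ := b.contDiff_normed
  have hρc : HasCompactSupport ρ := b.hasCompactSupport_normed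
  have hρs : tsupport ρ = Metric.closedBall 0 1 := b.tsupport_normed_eq
  have hρ0 : ∀ y, 0 ≤ ρ y := b.nonneg_normed
  have hρ1 : ∫ y, ρ y = 1 := b.integral_normed
  have hρ' : Continuous (fderiv ℝ ρ) := hρd.continuous_fderiv (by simp)
  have hmom : Integrable fun y => ‖fderiv ℝ ρ y‖ * ‖y‖ :=
    (hρ'.norm.mul continuous_norm).integrable_of_hasCompactSupport
      ((hρc.fderiv (𝕜 := ℝ)).norm.mul_right (f' := fun y => ‖y‖))
  let κ : ℕ → Space3 → ℝ := fun n y => ((n : ℝ) + 1) ^ 3 * ρ (((n : ℝ) + 1) • y)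
  have hpos : ∀ n : ℕ, 0 < (n : ℝ) + 1 := fun n => by positivity
  have hκd : ∀ n, ContDiff ℝ ∞ (κ n) := fun n =>
    contDiff_const.mul (hρd.comp (contDiff_const_smul _))
  have hκs : ∀ n, tsupport (κ n) ⊆ Metric.closedBall 0 (1 / ((n : ℝ) + 1)) := by
    intro n
    refine closure_minimal (fun y hy => ?_) Metric.isClosed_closedBall
    have h1 : ρ (((n : ℝ) + 1) • y) ≠ 0 := fun h0 => hy (by simp [κ, h0])
    have h2 : ((n : ℝ) + 1) • y ∈ tsupport ρ := subset_tsupport _ h1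
    rw [hρs, mem_closedBall_zero_iff, norm_smul, Real.norm_of_nonneg (hpos n).le] at h2
    rw [mem_closedBall_zero_iff, le_div_iff₀ (hpos n), mul_comm]
    exact h2
  have hκc : ∀ n, HasCompactSupport (κ n) := fun n =>
    (isCompact_closedBall _ _).of_isClosed_subset (isClosed_tsupport _) (hκs n)
  have hκ1 : ∀ n, ∫ y, κ n y = 1 := by
    intro n
    simp only [κ]
    rw [integral_const_mul, Measure.integral_comp_smul volume ρ, hρ1]
    simp only [finrank_euclideanSpace, Fintype.card_fin, smul_eq_mul, mul_one]
    rw [abs_of_pos (by have := hpos n; positivity)]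
    exact mul_inv_cancel₀ (by have := hpos n; positivity)
  have hκ' : ∀ n y, fderiv ℝ (κ n) y =
      ((n : ℝ) + 1) ^ 3 • ((n : ℝ) + 1) • fderiv ℝ ρ (((n : ℝ) + 1) • y) := by
    intro n y
    have h1 : HasFDerivAt (fun y => ρ (((n : ℝ) + 1) • y))
        ((fderiv ℝ ρ (((n : ℝ) + 1) • y)).comp (((n : ℝ) + 1) • ContinuousLinearMap.id ℝ Space3))
        y :=
      ((hρd.differentiable (by simp) _).hasFDerivAt).comp y
        ((hasFDerivAt_id y).const_smul ((n : ℝ) + 1))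
    rw [(h1.const_mul (((n : ℝ) + 1) ^ 3)).fderiv]
    ext v
    simp
  refine ⟨κ, ENNReal.ofReal (∫ y, ‖fderiv ℝ ρ y‖ * ‖y‖), ENNReal.ofReal_ne_top,
    hκd, hκs, ?_, hκ1, ?_⟩
  · intro n
    have h1 : Integrable (κ n) := (hκd n).continuous.integrable_of_hasCompactSupport (hκc n)
    rw [← ofReal_integral_norm_eq_lintegral_enorm h1, ← ENNReal.ofReal_one, ← hκ1 n]
    congr 1
    refine integral_congr_ae (ae_of_all _ fun y => Real.norm_of_nonneg ?_)
    exact mul_nonneg (by have := hpos n; positivity) (hρ0 _)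
  · intro n
    have e : ∀ y, ‖fderiv ℝ (κ n) y‖ * ‖y‖ = ((n : ℝ) + 1) ^ 3 *
        (‖fderiv ℝ ρ (((n : ℝ) + 1) • y)‖ * ‖((n : ℝ) + 1) • y‖) := by
      intro y
      rw [hκ', norm_smul, norm_smul, norm_smul, norm_pow, Real.norm_of_nonneg (hpos n).le]
      ring
    have h2 : Integrable fun y => ‖fderiv ℝ (κ n) y‖ * ‖y‖ := by
      simp_rw [e]
      exact (hmom.comp_smul (hpos n).ne').const_mul _
    have h3 := ofReal_integral_norm_eq_lintegral_enorm h2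
    have h4 : ∀ y, ‖‖fderiv ℝ (κ n) y‖ * ‖y‖‖ₑ = ‖fderiv ℝ (κ n) y‖ₑ * ‖y‖ₑ := by
      intro y
      rw [enorm_mul, enorm_norm, enorm_norm]
    simp_rw [h4] at h3
    rw [← h3]
    refine ENNReal.ofReal_le_ofReal (le_of_eq ?_)
    have h5 : ∀ y, ‖‖fderiv ℝ (κ n) y‖ * ‖y‖‖ = ‖fderiv ℝ (κ n) y‖ * ‖y‖ := fun y =>
      Real.norm_of_nonneg (by positivity)
    simp_rw [h5, e]
    rw [integral_const_mul,
      Measure.integral_comp_smul volume (fun y => ‖fderiv ℝ ρ y‖ * ‖y‖)]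
    simp only [finrank_euclideanSpace, Fintype.card_fin, smul_eq_mul]
    rw [abs_of_pos (by have := hpos n; positivity), ← mul_assoc,
      mul_inv_cancel₀ (by have := hpos n; positivity), one_mul]

/-! ### Convergence of mollifications and of the commutator -/

section Estimates

variable {E : Type*} [NormedAddCommGroup E] [NormedSpace ℝ E] [CompleteSpace E]
  {κ : Space3 → ℝ} {u : ℝ × Space3 → Space3} {A : ℝ × Space3 → Space3 →L[ℝ] Space3}
  {R : ℝ × Space3 → E} {δ : ℝ} {η B : ℝ≥0∞} {Ω : Set Space3}

/-- Since κ has integral one, the error is an average of the increments R(x − y) − R(x) over |y| ≤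
δ. -/
theorem eLpNorm_moll_sub_le (hR : StronglyMeasurable R) (hR2 : MemLp R 2 volume)
    (hκ : ContDiff ℝ 1 κ) (hκs : tsupport κ ⊆ Metric.closedBall 0 δ)
    (hκ1 : ∫⁻ y, ‖κ y‖ₑ = 1) (hκi : ∫ y, κ y = 1)
    (hη : ∀ h : Space3, ‖h‖ ≤ δ →
      eLpNorm (fun z : ℝ × Space3 => R (z.1, z.2 - h) - R z) 2 volume ≤ η) :
    eLpNorm (fun z => moll κ R z - R z) 2 volume ≤ η := by
  have hκc : HasCompactSupport κ :=
    (isCompact_closedBall _ _).of_isClosed_subset (isClosed_tsupport _) hκs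
  have hpt : ∀ᵐ z : ℝ × Space3, ‖moll κ R z - R z‖ₑ ≤
      ∫⁻ y, ‖κ y‖ₑ * ‖R (z.1, z.2 - y) - R z‖ₑ := by
    filter_upwards [ae_of_ae_time (ae_memLp_slice hR hR2)] with z hz
    have i1 := integrable_kernel_of_memLp_slice (F := E) (continuous_moll_kernel hκ)
      (hasCompactSupport_moll_kernel hκc) hz z.2
    have i1' : Integrable fun y => κ y • R (z.1, z.2 - y) := i1
    have i2 : Integrable fun y => κ y • R z :=
      (hκ.continuous.integrable_of_hasCompactSupport hκc).smul_const _
    have e : moll κ R z - R z = ∫ y, κ y • (R (z.1, z.2 - y) - R z) := by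
      simp_rw [smul_sub]
      rw [integral_sub i1' i2, integral_smul_const, hκi, one_smul, moll_apply]
    rw [e]
    refine (enorm_integral_le_lintegral_enorm _).trans (lintegral_mono fun y => ?_)
    rw [enorm_smul]
  have hm : StronglyMeasurable fun p : (ℝ × Space3) × Space3 =>
      R (p.1.1, p.1.2 - p.2) - R p.1 :=
    (stronglyMeasurable_shift_pair hR).sub (hR.comp_measurable measurable_fst)
  rw [← ENNReal.pow_le_pow_left_iff two_ne_zero, eLpNorm_two_sq]
  calc _ ≤ ∫⁻ z : ℝ × Space3, (∫⁻ y, ‖κ y‖ₑ * ‖R (z.1, z.2 - y) - R z‖ₑ) ^ 2 := by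
        refine lintegral_mono_ae (hpt.mono fun z hz => ?_)
        gcongr
    _ ≤ _ := lintegral_sq_lintegral_mul_le
        (H := fun p : (ℝ × Space3) × Space3 => ‖R (p.1.1, p.1.2 - p.2) - R p.1‖ₑ)
        hκ.continuous.enorm.measurable hm.enorm
    _ ≤ (∫⁻ y, ‖κ y‖ₑ) * ∫⁻ y, ‖κ y‖ₑ * η ^ 2 := by
        refine mul_le_mul' le_rfl (lintegral_mono fun y => ?_)
        by_cases hy : y ∈ tsupport κ
        · gcongr
          rw [← eLpNorm_two_sq]
          gcongr
          exact hη y (by simpa using hκs hy)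
        · simp [image_eq_zero_of_notMem_tsupport hy]
    _ = _ := by rw [lintegral_mul_const _ hκ.continuous.enorm.measurable, hκ1]; ring

/-- One summand for each term of the commutator identity. In the first, the Taylor remainder of u is
at most |y|η in L²; in the second, A y supplies the factor |y|. This factor turns |∇κ| into its
first moment, bounded by B. The third term contains no derivative of κ. Cauchy–Schwarz in space-time
does the rest. -/
theorem lintegral_enorm_transportCommutator_le (hu : StronglyMeasurable u)
    (hu2 : MemLp u 2 volume) (hA : StronglyMeasurable A) (hA2 : MemLp A 2 volume)
    (hH : ∀ᵐ t, IsH10Limit Ω (fun x => u (t, x)) (fun x => A (t, x)))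
    (hR : StronglyMeasurable R) (hR2 : MemLp R 2 volume)
    (hκ : ContDiff ℝ 1 κ) (hκs : tsupport κ ⊆ Metric.closedBall 0 δ)
    (hκ1 : ∫⁻ y, ‖κ y‖ₑ = 1) (hB : ∫⁻ y, ‖fderiv ℝ κ y‖ₑ * ‖y‖ₑ ≤ B)
    (hηR : ∀ h : Space3, ‖h‖ ≤ δ →
      eLpNorm (fun z : ℝ × Space3 => R (z.1, z.2 - h) - R z) 2 volume ≤ η)
    (hηA : ∀ h : Space3, ‖h‖ ≤ δ →
      eLpNorm (fun z : ℝ × Space3 => A (z.1, z.2 - h) - A z) 2 volume ≤ η) :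
    ∫⁻ z, ‖transportCommutator κ u A R z‖ₑ ≤ B * (η * eLpNorm R 2 volume)
      + B * (eLpNorm A 2 volume * η) + ‖divCLM‖ₑ * (eLpNorm A 2 volume * η) := by
  have hκc : HasCompactSupport κ :=
    (isCompact_closedBall _ _).of_isClosed_subset (isClosed_tsupport _) hκs
  have hκ' := hκ.continuous_fderiv one_ne_zero
  -- the three parts of the commutator
  let f₁ : (ℝ × Space3) × Space3 → ℝ≥0∞ := fun p =>
    ‖u p.1 - u (p.1.1, p.1.2 - p.2) - A p.1 p.2‖ₑ * ‖R (p.1.1, p.1.2 - p.2)‖ₑ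
  let f₂ : (ℝ × Space3) × Space3 → ℝ≥0∞ := fun p =>
    ‖A p.1‖ₑ * ‖R (p.1.1, p.1.2 - p.2) - R p.1‖ₑ
  have mAy : StronglyMeasurable fun p : (ℝ × Space3) × Space3 => A p.1 p.2 :=
    (ContinuousLinearMap.apply ℝ Space3).flip.continuous₂.comp_stronglyMeasurable
      ((hA.comp_measurable measurable_fst).prodMk measurable_snd.stronglyMeasurable)
  have mf₁ : Measurable f₁ :=
    ((((hu.comp_measurable measurable_fst).sub (stronglyMeasurable_shift_pair hu)).sub
      mAy).enorm).mul (stronglyMeasurable_shift_pair hR).enorm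
  have mf₂ : Measurable f₂ := (hA.comp_measurable measurable_fst).enorm.mul
    ((stronglyMeasurable_shift_pair hR).sub (hR.comp_measurable measurable_fst)).enorm
  have mK : Measurable fun y => ‖fderiv ℝ κ y‖ₑ := hκ'.enorm.measurable
  have mk : Measurable fun y => ‖κ y‖ₑ := hκ.continuous.enorm.measurable
  have hpt : ∀ᵐ z : ℝ × Space3, ‖transportCommutator κ u A R z‖ₑ ≤
      ∫⁻ y, (‖fderiv ℝ κ y‖ₑ * f₁ (z, y) + ‖fderiv ℝ κ y‖ₑ * ‖y‖ₑ * f₂ (z, y)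
        + ‖divCLM‖ₑ * ‖κ y‖ₑ * f₂ (z, y)) := by
    filter_upwards [ae_of_ae_time (ae_commutator_eq (A := A) hu hu2 hR hR2 hκ hκc)] with z hz
    rw [hz z.2]
    refine (enorm_integral_le_lintegral_enorm _).trans (lintegral_mono fun y => ?_)
    refine (enorm_add_le _ _).trans (add_le_add ((enorm_add_le _ _).trans (add_le_add ?_ ?_)) ?_)
    · rw [enorm_smul]
      simp only [f₁]
      rw [← mul_assoc]
      gcongr
      exact (fderiv ℝ κ y).le_opENorm _
    · rw [enorm_smul]
      simp only [f₂]
      rw [← mul_assoc]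
      gcongr
      calc _ ≤ ‖fderiv ℝ κ y‖ₑ * ‖A (z.1, z.2) y‖ₑ := (fderiv ℝ κ y).le_opENorm _
        _ ≤ ‖fderiv ℝ κ y‖ₑ * (‖A z‖ₑ * ‖y‖ₑ) := by gcongr; exact (A z).le_opENorm y
        _ = _ := by ring
    · rw [enorm_smul, enorm_mul]
      calc _ ≤ ‖κ y‖ₑ * (‖divCLM‖ₑ * ‖A z‖ₑ) * ‖R (z.1, z.2 - y) - R (z.1, z.2)‖ₑ := by
            refine mul_le_mul' (mul_le_mul' le_rfl ?_) le_rfl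
            exact divCLM.le_opENorm (A z)
        _ = _ := by simp only [f₂]; ring
  -- The intermediate shifts s y, 0 < s ≤ 1, stay within the radius δ, so the modulus of A controls
  -- the whole Taylor remainder.
  have b₁ : ∀ y, ‖y‖ ≤ δ → ∫⁻ z, f₁ (z, y) ≤ ‖y‖ₑ * (η * eLpNorm R 2 volume) := by
    intro y hy
    refine (lintegral_enorm_mul_enorm_le
      (f := fun z : ℝ × Space3 => u z - u (z.1, z.2 - y) - A z y)
      (g := fun z : ℝ × Space3 => R (z.1, z.2 - y)) ?_ ?_).trans ?_
    · exact ((((hu.comp_measurable measurable_fst).sub (stronglyMeasurable_shift_pair hu)).sub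
        mAy).comp_measurable measurable_prodMk_right).aestronglyMeasurable
    · exact ((stronglyMeasurable_shift_pair hR).comp_measurable
        measurable_prodMk_right).aestronglyMeasurable
    · rw [eLpNorm_space_shift hR.aestronglyMeasurable, ← mul_assoc]
      gcongr
      refine eLpNorm_sub_shift_sub_le hu hA hu2 hA2 hH y fun s hs => hηA _ ?_
      rw [norm_smul, Real.norm_of_nonneg hs.1.le]
      exact (mul_le_of_le_one_left (norm_nonneg _) hs.2).trans hy
  have b₂ : ∀ y, ‖y‖ ≤ δ → ∫⁻ z, f₂ (z, y) ≤ eLpNorm A 2 volume * η := by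
    intro y hy
    refine (lintegral_enorm_mul_enorm_le (f := A)
      (g := fun z : ℝ × Space3 => R (z.1, z.2 - y) - R z) hA.aestronglyMeasurable
      (((stronglyMeasurable_shift_pair hR).sub (hR.comp_measurable measurable_fst)).comp_measurable
        measurable_prodMk_right).aestronglyMeasurable).trans ?_
    gcongr
    exact hηR y hy
  -- Beyond the radius δ the kernel and its gradient vanish, so the moduli are needed only for |y| ≤
  -- δ.
  have hy' : ∀ y, δ < ‖y‖ → κ y = 0 ∧ fderiv ℝ κ y = 0 := by
    intro y hy
    have : y ∉ tsupport κ := fun h => by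
      have := hκs h
      rw [mem_closedBall_zero_iff] at this
      linarith
    exact ⟨image_eq_zero_of_notMem_tsupport this, fderiv_of_notMem_tsupport (𝕜 := ℝ) this⟩
  have m₁ : Measurable fun p : (ℝ × Space3) × Space3 => ‖fderiv ℝ κ p.2‖ₑ * f₁ p :=
    (mK.comp measurable_snd).mul mf₁
  have m₂ : Measurable fun p : (ℝ × Space3) × Space3 => ‖fderiv ℝ κ p.2‖ₑ * ‖p.2‖ₑ * f₂ p :=
    ((mK.comp measurable_snd).mul measurable_snd.enorm).mul mf₂
  have m₃ : Measurable fun p : (ℝ × Space3) × Space3 => ‖divCLM‖ₑ * ‖κ p.2‖ₑ * f₂ p :=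
    ((mk.comp measurable_snd).const_mul _).mul mf₂
  have s₁ : ∀ y, Measurable fun z => f₁ (z, y) := fun y => mf₁.comp measurable_prodMk_right
  have s₂ : ∀ y, Measurable fun z => f₂ (z, y) := fun y => mf₂.comp measurable_prodMk_right
  calc _ ≤ _ := lintegral_mono_ae hpt
    _ = ∫⁻ y, ∫⁻ z, (‖fderiv ℝ κ y‖ₑ * f₁ (z, y) + ‖fderiv ℝ κ y‖ₑ * ‖y‖ₑ * f₂ (z, y)
        + ‖divCLM‖ₑ * ‖κ y‖ₑ * f₂ (z, y)) :=
        lintegral_lintegral_swap ((m₁.add m₂).add m₃).aemeasurable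
    _ ≤ ∫⁻ y, (‖fderiv ℝ κ y‖ₑ * ‖y‖ₑ * (η * eLpNorm R 2 volume)
        + ‖fderiv ℝ κ y‖ₑ * ‖y‖ₑ * (eLpNorm A 2 volume * η)
        + ‖divCLM‖ₑ * ‖κ y‖ₑ * (eLpNorm A 2 volume * η)) := by
        refine lintegral_mono fun y => ?_
        rw [lintegral_add_right _ ((s₂ y).const_mul _), lintegral_add_right _ ((s₂ y).const_mul _),
          lintegral_const_mul _ (s₁ y), lintegral_const_mul _ (s₂ y),
          lintegral_const_mul _ (s₂ y)]
        rcases le_or_gt ‖y‖ δ with hy | hy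
        · rw [mul_assoc ‖fderiv ℝ κ y‖ₑ ‖y‖ₑ (η * _)]
          gcongr
          · exact b₁ y hy
          · exact b₂ y hy
          · exact b₂ y hy
        · have h0 : ‖(0 : Space3 →L[ℝ] ℝ)‖ₑ = 0 := by
            rw [← ofReal_norm, norm_zero, ENNReal.ofReal_zero]
          simp [(hy' y hy).1, (hy' y hy).2, h0]
    _ ≤ _ := by
        have n₁ : Measurable fun y : Space3 => ‖fderiv ℝ κ y‖ₑ * ‖y‖ₑ := mK.mul measurable_enorm
        rw [lintegral_add_right _ ((mk.const_mul _).mul_const _),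
          lintegral_add_right _ (n₁.mul_const _), lintegral_mul_const _ n₁,
          lintegral_mul_const _ n₁, lintegral_mul_const _ (mk.const_mul _),
          lintegral_const_mul _ mk, hκ1, mul_one]
        gcongr

/-- Mollifications converge in `L²` and the DiPerna–Lions commutator tends to `0` in `L¹`. -/
theorem IsMollifierSeq.tendsto {κ : ℕ → Space3 → ℝ} (hκ : IsMollifierSeq κ B) (hB : B ≠ ⊤)
    (hu : StronglyMeasurable u)
    (hu2 : MemLp u 2 volume) (hA : StronglyMeasurable A) (hA2 : MemLp A 2 volume)
    (hH : ∀ᵐ t, IsH10Limit Ω (fun x => u (t, x)) (fun x => A (t, x)))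
    (hR : StronglyMeasurable R) (hR2 : MemLp R 2 volume) :
    Tendsto (fun n => eLpNorm (fun z => moll (κ n) R z - R z) 2 volume) atTop (𝓝 0) ∧
    Tendsto (fun n => ∫⁻ z, ‖transportCommutator (κ n) u A R z‖ₑ) atTop (𝓝 0) := by
  have hrad : Tendsto (fun n : ℕ => 1 / ((n : ℝ) + 1)) atTop (𝓝 0) :=
    tendsto_one_div_add_atTop_nhds_zero_nat
  have modulus : ∀ η : ℝ≥0∞, 0 < η → ∀ᶠ n : ℕ in atTop, ∀ h : Space3, ‖h‖ ≤ 1 / ((n : ℝ) + 1) →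
      eLpNorm (fun z : ℝ × Space3 => R (z.1, z.2 - h) - R z) 2 volume ≤ η ∧
      eLpNorm (fun z : ℝ × Space3 => A (z.1, z.2 - h) - A z) 2 volume ≤ η := by
    intro η hη
    have h1 := (tendsto_eLpNorm_space_shift hR2).eventually (gt_mem_nhds hη)
    have h2 := (tendsto_eLpNorm_space_shift hA2).eventually (gt_mem_nhds hη)
    obtain ⟨r, hr, hball⟩ := Metric.eventually_nhds_iff.1 (h1.and h2)
    filter_upwards [hrad.eventually (gt_mem_nhds hr)] with n hn h hh
    have := hball (y := h) (by rw [dist_zero_right]; exact hh.trans_lt hn)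
    exact ⟨this.1.le, this.2.le⟩
  refine ⟨?_, ?_⟩
  · rw [ENNReal.tendsto_nhds_zero]
    intro η hη
    filter_upwards [modulus η hη] with n hn
    exact eLpNorm_moll_sub_le hR hR2 ((hκ.contDiff n).of_le (by simp)) (hκ.tsupport_subset n)
      (hκ.lintegral_eq n) (hκ.integral_eq n) fun h hh => (hn h hh).1
  · set C : ℝ≥0∞ := B * eLpNorm R 2 volume + B * eLpNorm A 2 volume
      + ‖divCLM‖ₑ * eLpNorm A 2 volume with hC
    have hCt : C ≠ ⊤ := by
      have hd : ‖divCLM‖ₑ ≠ ⊤ := by rw [← ofReal_norm]; exact ENNReal.ofReal_ne_top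
      exact ENNReal.add_ne_top.2 ⟨ENNReal.add_ne_top.2 ⟨ENNReal.mul_ne_top hB hR2.2.ne,
        ENNReal.mul_ne_top hB hA2.2.ne⟩, ENNReal.mul_ne_top hd hA2.2.ne⟩
    rw [ENNReal.tendsto_nhds_zero]
    intro ε hε
    -- The estimate is linear in the modulus with constant C; the added 1 avoids dividing by zero.
    have hη : 0 < ε / (C + 1) :=
      ENNReal.div_pos hε.ne' (ENNReal.add_ne_top.2 ⟨hCt, ENNReal.one_ne_top⟩)
    filter_upwards [modulus _ hη] with n hn
    refine (lintegral_enorm_transportCommutator_le hu hu2 hA hA2 hH hR hR2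
      ((hκ.contDiff n).of_le (by simp)) (hκ.tsupport_subset n) (hκ.lintegral_eq n)
      (hκ.moment_le n) (fun h hh => (hn h hh).1) fun h hh => (hn h hh).2).trans ?_
    calc _ = ε / (C + 1) * C := by rw [hC]; ring
      _ ≤ ε / (C + 1) * (C + 1) := by gcongr; exact le_self_add
      _ ≤ ε := (ENNReal.div_mul_cancel (by simp)
        (ENNReal.add_ne_top.2 ⟨hCt, ENNReal.one_ne_top⟩)).le

end Estimates

/-! ### The mollified equation at a fixed point -/

section SliceBounds

variable {E : Type*} [NormedAddCommGroup E] [NormedSpace ℝ E]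
  {κ : Space3 → ℝ} {u : ℝ × Space3 → Space3} {R : ℝ × Space3 → E}

theorem hasFDerivAt_moll (hκ : ContDiff ℝ 1 κ) (hκc : HasCompactSupport κ) {t : ℝ}
    (hR : MemLp (fun x => R (t, x)) 2 volume) (x : Space3) :
    HasFDerivAt (fun x => moll κ R (t, x)) (mollGrad κ R (t, x)) x := by
  have hl : LocallyIntegrable (fun x => R (t, x)) volume := hR.locallyIntegrable one_le_two
  have h := hκc.hasFDerivAt_convolution_left (ContinuousLinearMap.lsmul ℝ ℝ) hκ hl x
  exact h

theorem contDiff_moll_slice (hκ : ContDiff ℝ 1 κ) (hκc : HasCompactSupport κ) {t : ℝ}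
    (hR : MemLp (fun x => R (t, x)) 2 volume) : ContDiff ℝ 1 fun x => moll κ R (t, x) := by
  have hl : LocallyIntegrable (fun x => R (t, x)) volume := hR.locallyIntegrable one_le_two
  exact hκc.contDiff_convolution_left (n := 1) (ContinuousLinearMap.lsmul ℝ ℝ)
    (by exact_mod_cast hκ) hl

theorem norm_moll_le {C : ℝ} (hC : ∀ y, ‖κ y‖ ≤ C) {t : ℝ}
    (hR : Integrable (fun x => R (t, x)) volume) (x : Space3) :
    ‖moll κ R (t, x)‖ ≤ C * ∫ y, ‖R (t, y)‖ := by
  have h1 : Integrable fun y => C * ‖R (t, x - y)‖ := ((hR.comp_sub_left x).norm).const_mul C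
  rw [moll_apply]
  refine (norm_integral_le_of_norm_le h1 (ae_of_all _ fun y => ?_)).trans_eq ?_
  · rw [norm_smul]
    gcongr
    exact hC y
  · rw [integral_const_mul, integral_sub_left_eq_self (fun y => ‖R (t, y)‖) volume x]

/-- The bound is independent of x and integrable in t for a solution; this is the source of time
regularity uniform in space. -/
theorem norm_mollFlux_le {C : ℝ} (hC : ∀ y, ‖fderiv ℝ κ y‖ ≤ C) {t : ℝ}
    (hu : MemLp (fun x => u (t, x)) 2 volume) (hR : MemLp (fun x => R (t, x)) 2 volume)
    (x : Space3) : ‖mollFlux κ u R (t, x)‖ ≤ C * ∫ y, ‖u (t, y)‖ * ‖R (t, y)‖ := by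
  have h0 : Integrable fun y => ‖u (t, y)‖ * ‖R (t, y)‖ := hu.norm.integrable_mul hR.norm
  have h1 : Integrable fun y => C * (‖u (t, x - y)‖ * ‖R (t, x - y)‖) :=
    (h0.comp_sub_left x).const_mul C
  refine (norm_integral_le_of_norm_le h1 (ae_of_all _ fun y => ?_)).trans_eq ?_
  · rw [norm_smul, ← mul_assoc]
    gcongr
    exact (fderiv ℝ κ y).le_of_opNorm_le (hC y) _
  · rw [integral_const_mul,
      integral_sub_left_eq_self (fun y => ‖u (t, y)‖ * ‖R (t, y)‖) volume x]

theorem integrable_fderiv_smul {φ : ℝ × Space3 → ℝ} (hφ : ContDiff ℝ 1 φ)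
    (hφc : HasCompactSupport φ) (hu2 : MemLp u 2 volume) (hR2 : MemLp R 2 volume) :
    Integrable fun z => fderiv ℝ φ z (1, u z) • R z := by
  have hφ' := hφ.continuous_fderiv one_ne_zero
  have hφc' := hφc.fderiv (𝕜 := ℝ)
  obtain ⟨C, hC⟩ := hφ'.bounded_above_of_compact_support hφc'
  have h1 : Integrable fun z => ‖fderiv ℝ φ z‖ * ‖R z‖ :=
    (hφ'.memLp_of_hasCompactSupport (p := 2) hφc').norm.integrable_mul hR2.norm
  have h2 : Integrable fun z => ‖u z‖ * ‖R z‖ := hu2.norm.integrable_mul hR2.norm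
  refine (h1.add (h2.const_mul C)).mono' ?_ (ae_of_all _ fun z => ?_)
  · exact (hφ'.aestronglyMeasurable.clm_apply' (aestronglyMeasurable_const.prodMk hu2.1)).smul hR2.1
  · have e : ((1 : ℝ), u z) = (1, 0) + (0, u z) := by simp
    simp only [Pi.add_apply]
    rw [norm_smul, ← mul_assoc, ← add_mul]
    gcongr
    rw [e, map_add]
    refine (norm_add_le _ _).trans (add_le_add ?_ ?_)
    · refine ((fderiv ℝ φ z).le_opNorm _).trans_eq ?_
      simp [Prod.norm_def]
    · refine ((fderiv ℝ φ z).le_of_opNorm_le (hC z) _).trans_eq ?_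
      simp [Prod.norm_def]

end SliceBounds

/-- A weak solution `R` of `∂ₜR + div(u ⊗ R) = 0` on `(0,T) × Ω`, with all functions
extended by zero, and the gradient `A` of the velocity `u ∈ L²(0,T;H¹₀(Ω))`. -/
structure IsTransportSolution {E : Type*} [NormedAddCommGroup E] [NormedSpace ℝ E] (T : ℝ)
    (Ω : Set Space3) (u : ℝ × Space3 → Space3) (A : ℝ × Space3 → Space3 →L[ℝ] Space3)
    (R : ℝ × Space3 → E) : Prop where
  isOpen : IsOpen Ω
  isBounded : Bornology.IsBounded Ω
  meas_u : StronglyMeasurable u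
  meas_A : StronglyMeasurable A
  meas_R : StronglyMeasurable R
  memLp_u : MemLp u 2 volume
  memLp_A : MemLp A 2 volume
  memLp_R : MemLp R 2 volume
  zero_u : ∀ z, z ∉ cyl T Ω → u z = 0
  zero_A : ∀ z, z ∉ cyl T Ω → A z = 0
  zero_R : ∀ z, z ∉ cyl T Ω → R z = 0
  limit : ∀ᵐ t, IsH10Limit Ω (fun x => u (t, x)) (fun x => A (t, x))
  eqn : ∀ φ : ℝ × Space3 → ℝ, IsTestOn (cyl T Ω) φ → ∫ z, fderiv ℝ φ z (1, u z) • R z = 0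

namespace IsTransportSolution

variable {E : Type*} [NormedAddCommGroup E] [NormedSpace ℝ E] {T : ℝ}
  {Ω : Set Space3} {u : ℝ × Space3 → Space3} {A : ℝ × Space3 → Space3 →L[ℝ] Space3}
  {R : ℝ × Space3 → E}

theorem isOpen_cyl (h : IsTransportSolution T Ω u A R) : IsOpen (cyl T Ω) :=
  isOpen_Ioo.prod h.isOpen

theorem measurableSet_cyl (h : IsTransportSolution T Ω u A R) : MeasurableSet (cyl T Ω) :=
  h.isOpen_cyl.measurableSet

theorem volume_cyl_lt_top (h : IsTransportSolution T Ω u A R) : volume (cyl T Ω) < ⊤ := by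
  have : Bornology.IsBounded (cyl T Ω) := (Metric.isBounded_Ioo 0 T).prod h.isBounded
  exact this.measure_lt_top

theorem integrable_of_memLp {F : Type*} [NormedAddCommGroup F]
    (h : IsTransportSolution T Ω u A R) {f : ℝ × Space3 → F}
    (hf : MemLp f 2 volume) (h0 : ∀ z, z ∉ cyl T Ω → f z = 0) : Integrable f := by
  have : IsFiniteMeasure (volume.restrict (cyl T Ω)) := ⟨by simpa using h.volume_cyl_lt_top⟩
  have h1 : IntegrableOn f (cyl T Ω) := (hf.restrict _).integrable one_le_two
  exact (integrableOn_iff_integrable_of_support_subset fun z hz => by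
    by_contra h'; exact hz (h0 z h')).1 h1

theorem integrable_R (h : IsTransportSolution T Ω u A R) : Integrable R :=
  h.integrable_of_memLp h.memLp_R h.zero_R

theorem integrable_norm_mul (h : IsTransportSolution T Ω u A R) :
    Integrable fun z => ‖u z‖ * ‖R z‖ :=
  h.memLp_u.norm.integrable_mul h.memLp_R.norm

theorem ae_slice (h : IsTransportSolution T Ω u A R) :
    ∀ᵐ t, MemLp (fun x => u (t, x)) 2 volume ∧ MemLp (fun x => A (t, x)) 2 volume ∧
      MemLp (fun x => R (t, x)) 2 volume ∧ Integrable (fun x => R (t, x)) := by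
  have h1 := h.integrable_R
  rw [Measure.volume_eq_prod] at h1
  filter_upwards [ae_memLp_slice h.meas_u h.memLp_u, ae_memLp_slice h.meas_A h.memLp_A,
    ae_memLp_slice h.meas_R h.memLp_R, h1.prod_right_ae] with t a b c d
  exact ⟨a, b, c, d⟩

variable {κ : Space3 → ℝ} {δ : ℝ}

theorem integrable_mollFlux_time (h : IsTransportSolution T Ω u A R) (hκ : ContDiff ℝ 1 κ)
    (hκc : HasCompactSupport κ) (x : Space3) : Integrable fun t => mollFlux κ u R (t, x) := by
  obtain ⟨C, hC⟩ := (hκ.continuous_fderiv one_ne_zero).bounded_above_of_compact_support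
    (hκc.fderiv (𝕜 := ℝ))
  have h1 := h.integrable_norm_mul
  rw [Measure.volume_eq_prod] at h1
  refine (h1.integral_prod_left.const_mul C).mono' ?_ ?_
  · exact ((stronglyMeasurable_mollFlux hκ h.meas_u h.meas_R).comp_measurable
      measurable_prodMk_right).aestronglyMeasurable
  · filter_upwards [h.ae_slice] with t ht
    exact norm_mollFlux_le hC ht.1 ht.2.2.1 x

theorem integrable_moll_time (h : IsTransportSolution T Ω u A R) (hκ : ContDiff ℝ 1 κ)
    (hκc : HasCompactSupport κ) (x : Space3) : Integrable fun t => moll κ R (t, x) := by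
  obtain ⟨C, hC⟩ := hκ.continuous.bounded_above_of_compact_support hκc
  have h1 := h.integrable_R.norm
  rw [Measure.volume_eq_prod] at h1
  refine (h1.integral_prod_left.const_mul C).mono' ?_ ?_
  · exact ((stronglyMeasurable_spaceConv (continuous_moll_kernel hκ) h.meas_R).comp_measurable
      measurable_prodMk_right).aestronglyMeasurable
  · filter_upwards [h.ae_slice] with t ht
    exact norm_moll_le hC ht.2.2.2 x

/-- Test the equation with θ(t)κ(x − y) as a function of (t, y). It is admissible because the ball
of radius δ about x lies in Ω, and it says that the mollification at x has weak time derivative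
−`mollFlux`. -/
theorem integral_deriv_smul_moll [CompleteSpace E] (h : IsTransportSolution T Ω u A R) (hκ : ContDiff ℝ ∞ κ)
    (hκs : tsupport κ ⊆ Metric.closedBall 0 δ) {x : Space3} (hx : Metric.closedBall x δ ⊆ Ω)
    {θ : ℝ → ℝ} (hθ : IsTestOn (Ioo 0 T) θ) :
    ∫ t, (deriv θ t • moll κ R (t, x) + θ t • (-mollFlux κ u R (t, x))) = 0 := by
  have hκc : HasCompactSupport κ :=
    (isCompact_closedBall _ _).of_isClosed_subset (isClosed_tsupport _) hκs
  let φ : ℝ × Space3 → ℝ := fun z => θ z.1 * κ (x - z.2)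
  have hφd : ContDiff ℝ ∞ φ :=
    (hθ.1.comp contDiff_fst).mul (hκ.comp (contDiff_const.sub contDiff_snd))
  have hsub : tsupport φ ⊆ tsupport θ ×ˢ Metric.closedBall x δ := by
    refine closure_minimal (fun z hz => ?_) ((isClosed_tsupport _).prod Metric.isClosed_closedBall)
    refine ⟨subset_tsupport _ fun h0 => hz (by simp [φ, h0]), ?_⟩
    have h1 : x - z.2 ∈ tsupport κ := subset_tsupport _ fun h0 => hz (by simp [φ, h0])
    have h2 := hκs h1
    rw [mem_closedBall_zero_iff] at h2
    rw [mem_closedBall_iff_norm']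
    exact h2
  have hφ : IsTestOn (cyl T Ω) φ :=
    ⟨hφd, (hθ.2.1.isCompact.prod (isCompact_closedBall x δ)).of_isClosed_subset
      (isClosed_tsupport _) hsub, hsub.trans (prod_mono hθ.2.2 hx)⟩
  have hder : ∀ z : ℝ × Space3, ∀ w : Space3, fderiv ℝ φ z (1, w) =
      deriv θ z.1 * κ (x - z.2) - θ z.1 * fderiv ℝ κ (x - z.2) w := by
    intro z w
    have h1 : HasFDerivAt (fun z : ℝ × Space3 => θ z.1)
        ((ContinuousLinearMap.toSpanSingleton ℝ (deriv θ z.1)).comp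
          (ContinuousLinearMap.fst ℝ ℝ Space3)) z :=
      HasFDerivAt.comp z (hθ.differentiable z.1).hasDerivAt.hasFDerivAt hasFDerivAt_fst
    have h2 : HasFDerivAt (fun z : ℝ × Space3 => κ (x - z.2))
        ((fderiv ℝ κ (x - z.2)).comp (-(ContinuousLinearMap.snd ℝ ℝ Space3))) z :=
      HasFDerivAt.comp z ((hκ.differentiable (by simp)) (x - z.2)).hasFDerivAt
        (hasFDerivAt_snd.const_sub x)
    have h3 : fderiv ℝ φ z = _ := (h1.mul h2).fderiv
    rw [h3]
    simp
    ring
  have hint := integrable_fderiv_smul (hφd.of_le (by simp)) hφ.2.1 h.memLp_u h.memLp_R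
  have h0 := h.eqn φ hφ
  rw [Measure.volume_eq_prod] at hint h0
  rw [integral_prod _ hint] at h0
  rw [← h0]
  refine integral_congr_ae ?_
  filter_upwards [h.ae_slice] with t ht
  have i1 : Integrable fun y => κ y • R (t, x - y) :=
    integrable_kernel_of_memLp_slice (F := E) (continuous_moll_kernel (hκ.of_le (by simp)))
      (hasCompactSupport_moll_kernel hκc) ht.2.2.1 x
  have i2 : Integrable fun y => fderiv ℝ κ y (u (t, x - y)) • R (t, x - y) :=
    integrable_mollFlux_slice (hκ.of_le (by simp)) hκc ht.1 ht.2.2.1 x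
  rw [← integral_sub_left_eq_self (fun y => fderiv ℝ φ (t, y) (1, u (t, y)) • R (t, y)) volume x]
  have e : ∀ y, fderiv ℝ φ (t, x - y) (1, u (t, x - y)) • R (t, x - y) =
      deriv θ t • κ y • R (t, x - y) - θ t • fderiv ℝ κ y (u (t, x - y)) • R (t, x - y) := by
    intro y
    rw [hder]
    simp only [sub_sub_cancel, sub_smul, mul_smul]
  simp_rw [e]
  have j1 : Integrable fun y => deriv θ t • κ y • R (t, x - y) := i1.smul _
  have j2 : Integrable fun y => θ t • fderiv ℝ κ y (u (t, x - y)) • R (t, x - y) := i2.smul _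
  rw [integral_sub j1 j2, integral_smul, integral_smul, moll_apply, mollFlux]
  simp [sub_eq_add_neg]

/-- Renormalization of the mollified equation at a fixed point of space. -/
theorem integral_deriv_mul_comp_moll [CompleteSpace E] (h : IsTransportSolution T Ω u A R) (hκ : ContDiff ℝ ∞ κ)
    (hκs : tsupport κ ⊆ Metric.closedBall 0 δ) {x : Space3} (hx : Metric.closedBall x δ ⊆ Ω)
    {β : E → ℝ} (hβ : ContDiff ℝ 1 β) {C : ℝ} (hC : ∀ X, ‖fderiv ℝ β X‖ ≤ C)
    {θ : ℝ → ℝ} (hθ : IsTestOn (Ioo 0 T) θ) :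
    ∫ t, (deriv θ t * β (moll κ R (t, x))
      - θ t * fderiv ℝ β (moll κ R (t, x)) (mollFlux κ u R (t, x))) = 0 := by
  have hκc : HasCompactSupport κ :=
    (isCompact_closedBall _ _).of_isClosed_subset (isClosed_tsupport _) hκs
  -- For T ≤ 0 the time interval is empty, so θ and its derivative vanish identically.
  rcases lt_or_ge 0 T with hT | hT
  swap
  · have hz : ∀ t, θ t = 0 ∧ deriv θ t = 0 := by
      intro t
      have ht : t ∉ Ioo 0 T := by rw [Ioo_eq_empty (not_lt.2 hT)]; simp
      exact ⟨hθ.eq_zero_of_notMem ht, by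
        rw [← fderiv_apply_one_eq_deriv, hθ.fderiv_eq_zero_of_notMem ht]; rfl⟩
    simp [hz]
  have hF : Integrable fun t => -mollFlux κ u R (t, x) :=
    (h.integrable_mollFlux_time (hκ.of_le (by simp)) hκc x).neg
  -- At fixed x the mollification is a.e. a primitive of minus the flux, so the one-variable chain
  -- rule applies without any continuity in time.
  obtain ⟨c, hc⟩ := ae_eq_add_primitive_of_weak_deriv hT
    (h.integrable_moll_time (hκ.of_le (by simp)) hκc x).integrableOn hF (fun θ hθ => by
      rw [setIntegral_eq_integral_of_forall_compl_eq_zero]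
      · exact h.integral_deriv_smul_moll hκ hκs hx hθ
      · intro t ht
        rw [hθ.eq_zero_of_notMem ht, ← fderiv_apply_one_eq_deriv,
          hθ.fderiv_eq_zero_of_notMem ht]
        simp)
  have key := integral_deriv_smul_comp_primitive hF 0 c hβ hC (hθ.1.of_le (by simp)) hθ.2.1
  rw [← key]
  refine integral_congr_ae ?_
  rw [ae_restrict_iff' measurableSet_Ioo] at hc
  filter_upwards [hc] with t ht
  by_cases hmem : t ∈ Ioo 0 T
  · rw [← ht hmem]
    simp [sub_eq_add_neg]
  · rw [hθ.eq_zero_of_notMem hmem, ← fderiv_apply_one_eq_deriv,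
          hθ.fderiv_eq_zero_of_notMem hmem]
    simp

end IsTransportSolution

/-! ### Renormalization of the mollified equation -/

theorem memLp_mul_of_norm_le {X F G : Type*} [TopologicalSpace X] [T2Space X] [MeasurableSpace X]
    [OpensMeasurableSpace X] [SecondCountableTopology X] {μ : Measure X}
    [IsFiniteMeasureOnCompacts μ] [NormedAddCommGroup F] [NormedSpace ℝ F] [NormedAddCommGroup G]
    {ψ : X → F} (hψ : Continuous ψ) (hψc : HasCompactSupport ψ) {g : X → ℝ} {D : X → G}
    {a C : ℝ} {p : ℝ≥0∞} (hg : AEStronglyMeasurable g μ) (hD : MemLp D p μ)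
    (h : ∀ x, ‖g x‖ ≤ a + C * ‖D x‖) : MemLp (fun x => g x • ψ x) p μ := by
  obtain ⟨M, hM⟩ := hψ.bounded_above_of_compact_support hψc
  have h1 : MemLp (fun x => |a| * ‖ψ x‖ + |C| * M * ‖D x‖) p μ :=
    ((hψ.memLp_of_hasCompactSupport hψc).norm.const_mul _).add (hD.norm.const_mul _)
  refine h1.mono' (hg.smul hψ.aestronglyMeasurable) (ae_of_all _ fun x => ?_)
  rw [norm_smul]
  have h2 : ‖g x‖ ≤ |a| + |C| * ‖D x‖ := (h x).trans
    (add_le_add (le_abs_self a) (mul_le_mul_of_nonneg_right (le_abs_self C) (norm_nonneg _)))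
  calc ‖g x‖ * ‖ψ x‖ ≤ (|a| + |C| * ‖D x‖) * ‖ψ x‖ := by gcongr
    _ = |a| * ‖ψ x‖ + |C| * ‖D x‖ * ‖ψ x‖ := by ring
    _ ≤ |a| * ‖ψ x‖ + |C| * ‖D x‖ * M := by gcongr; exact hM x
    _ = _ := by ring

theorem norm_comp_le_of_fderiv_bound {E F : Type*} [NormedAddCommGroup E] [NormedSpace ℝ E]
    [NormedAddCommGroup F] [NormedSpace ℝ F] {β : E → F} (hβ : ContDiff ℝ 1 β) {C : ℝ}
    (hC : ∀ X, ‖fderiv ℝ β X‖ ≤ C) (X : E) : ‖β X‖ ≤ ‖β 0‖ + C * ‖X‖ := by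
  have h1 := norm_image_sub_le_of_fderiv_bound hβ hC X 0
  have h2 := norm_sub_norm_le (β X) (β 0)
  rw [sub_zero] at h1
  linarith

namespace IsTransportSolution

variable {E : Type*} [NormedAddCommGroup E] [NormedSpace ℝ E] {T : ℝ}
  {Ω : Set Space3} {u : ℝ × Space3 → Space3} {A : ℝ × Space3 → Space3 →L[ℝ] Space3}
  {R : ℝ × Space3 → E} {κ : Space3 → ℝ} {δ : ℝ}

theorem memLp_moll (h : IsTransportSolution T Ω u A R) (hκ : ContDiff ℝ 1 κ)
    (hκc : HasCompactSupport κ) : MemLp (moll κ R) 2 volume :=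
  memLp_spaceConv (continuous_moll_kernel hκ) (hasCompactSupport_moll_kernel hκc) h.meas_R
    h.memLp_R

theorem stronglyMeasurable_moll (h : IsTransportSolution T Ω u A R) (hκ : ContDiff ℝ 1 κ) :
    StronglyMeasurable (moll κ R) :=
  stronglyMeasurable_spaceConv (continuous_moll_kernel hκ) h.meas_R

theorem memLp_mollGrad (h : IsTransportSolution T Ω u A R) (hκ : ContDiff ℝ 1 κ)
    (hκc : HasCompactSupport κ) : MemLp (mollGrad κ R) 2 volume :=
  memLp_spaceConv (continuous_mollGrad_kernel hκ) (hasCompactSupport_mollGrad_kernel hκc) h.meas_R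
    h.memLp_R

theorem memLp_divOf (h : IsTransportSolution T Ω u A R) :
    MemLp (fun z => divOf (A z)) 2 volume :=
  divCLM.comp_memLp' h.memLp_A

/-- Functions of the solution with linear growth, against a test function. -/
theorem memLp_comp_smul {G F : Type*} [NormedAddCommGroup G] [NormedSpace ℝ G]
    [NormedAddCommGroup F] [NormedSpace ℝ F] {ψ : ℝ × Space3 → F} (hψ : Continuous ψ)
    (hψc : HasCompactSupport ψ) {D : ℝ × Space3 → G} (hD : MemLp D 2 volume) {β : G → ℝ}
    (hβ : ContDiff ℝ 1 β) {C : ℝ} (hC : ∀ X, ‖fderiv ℝ β X‖ ≤ C) :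
    MemLp (fun z => β (D z) • ψ z) 2 volume :=
  memLp_mul_of_norm_le hψ hψc (hβ.continuous.comp_aestronglyMeasurable hD.1) hD
    fun z => norm_comp_le_of_fderiv_bound hβ hC (D z)

theorem integrable_smul_fderiv_comp {G : Type*} [NormedAddCommGroup G] [NormedSpace ℝ G]
    {ψ : ℝ × Space3 → ℝ} (hψ : Continuous ψ)
    (hψc : HasCompactSupport ψ) {D F : ℝ × Space3 → G} (hD : AEStronglyMeasurable D volume)
    {β : G → ℝ} (hβ : ContDiff ℝ 1 β) {C : ℝ} (hC : ∀ X, ‖fderiv ℝ β X‖ ≤ C)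
    (hF : Integrable F) :
    Integrable (fun z => ψ z * fderiv ℝ β (D z) (F z)) volume := by
  obtain ⟨M, hM⟩ := hψ.bounded_above_of_compact_support hψc
  have h1 : Integrable fun z => fderiv ℝ β (D z) (F z) := by
    refine (hF.norm.const_mul C).mono' (((hβ.continuous_fderiv
      one_ne_zero).comp_aestronglyMeasurable hD).clm_apply' hF.1) (ae_of_all _ fun z => ?_)
    exact (fderiv ℝ β (D z)).le_of_opNorm_le (hC _) _
  exact integrable_bounded_smul h1 hψ.aestronglyMeasurable hM

/-- Fubini with the time integral inside. Each line through the support of φ in the time direction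
gives a test function of t alone, for which the fixed-point identity holds; the condition on balls
guarantees that x is admissible. -/
theorem integral_time_comp_moll [CompleteSpace E] (h : IsTransportSolution T Ω u A R)
    (hκ : ContDiff ℝ ∞ κ) (hκs : tsupport κ ⊆ Metric.closedBall 0 δ)
    {β : E → ℝ} (hβ : ContDiff ℝ 1 β) {C : ℝ} (hC : ∀ X, ‖fderiv ℝ β X‖ ≤ C)
    {φ : ℝ × Space3 → ℝ} (hφ : IsTestOn (cyl T Ω) φ)
    (hφδ : ∀ z ∈ tsupport φ, Metric.closedBall z.2 δ ⊆ Ω) :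
    Integrable (fun z => fderiv ℝ φ z (1, 0) * β (moll κ R z)
      - φ z * fderiv ℝ β (moll κ R z) (mollFlux κ u R z)) ∧
    ∫ z, (fderiv ℝ φ z (1, 0) * β (moll κ R z)
      - φ z * fderiv ℝ β (moll κ R z) (mollFlux κ u R z)) = 0 := by
  have hκ1 : ContDiff ℝ 1 κ := hκ.of_le (by simp)
  have hκc : HasCompactSupport κ :=
    (isCompact_closedBall _ _).of_isClosed_subset (isClosed_tsupport _) hκs
  have hD := h.memLp_moll hκ1 hκc
  have hφ' : Continuous fun z => fderiv ℝ φ z (1, 0) :=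
    (hφ.1.continuous_fderiv (by simp)).clm_apply continuous_const
  have hφ'0 : ∀ z, z ∉ tsupport φ → fderiv ℝ φ z (1, 0) = 0 := fun z hz => by
    rw [fderiv_of_notMem_tsupport (𝕜 := ℝ) hz]; rfl
  have hφ'c : HasCompactSupport fun z => fderiv ℝ φ z (1, 0) :=
    HasCompactSupport.intro hφ.2.1 hφ'0
  have i1 : Integrable fun z => fderiv ℝ φ z (1, 0) * β (moll κ R z) := by
    refine h.integrable_of_memLp ?_ fun z hz => by
      rw [hφ'0 z fun h' => hz (hφ.2.2 h'), zero_mul]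
    simpa [mul_comm] using memLp_comp_smul hφ' hφ'c hD hβ hC
  have i2 : Integrable fun z => φ z * fderiv ℝ β (moll κ R z) (mollFlux κ u R z) :=
    integrable_smul_fderiv_comp hφ.1.continuous hφ.2.1 hD.1 hβ hC
      (integrable_mollFlux hκ1 hκc h.meas_u h.memLp_u h.meas_R h.memLp_R)
  have i3 : Integrable (fun z => fderiv ℝ φ z (1, 0) * β (moll κ R z)
      - φ z * fderiv ℝ β (moll κ R z) (mollFlux κ u R z)) (volume.prod volume) := i1.sub i2
  refine ⟨i3, ?_⟩
  rw [Measure.volume_eq_prod, integral_prod_symm _ i3]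
  refine (integral_congr_ae (ae_of_all _ fun x => ?_)).trans (integral_zero _ _)
  by_cases hx : ∃ t, (t, x) ∈ tsupport φ
  · obtain ⟨t, ht⟩ := hx
    have hsub : tsupport (fun t => φ (t, x)) ⊆ (fun t => (t, x)) ⁻¹' tsupport φ :=
      closure_minimal (fun s hs => subset_tsupport φ hs)
        ((isClosed_tsupport φ).preimage (by fun_prop))
    have hθ : IsTestOn (Ioo 0 T) fun t => φ (t, x) := by
      refine ⟨hφ.1.comp (contDiff_id.prodMk contDiff_const), ?_, fun s hs => ?_⟩
      · exact (hφ.2.1.isCompact.image continuous_fst).of_isClosed_subset (isClosed_tsupport _)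
          fun s hs => ⟨(s, x), hsub hs, rfl⟩
      · exact (hφ.2.2 (hsub hs)).1
    have key := h.integral_deriv_mul_comp_moll hκ hκs (hφδ _ ht) hβ hC hθ
    refine Eq.trans (integral_congr_ae (ae_of_all _ fun s => ?_)) key
    have hd : HasDerivAt (fun t => φ (t, x)) (fderiv ℝ φ (s, x) (1, 0)) s :=
      HasFDerivAt.comp_hasDerivAt s (hφ.differentiable (s, x)).hasFDerivAt
        ((hasDerivAt_id s).prodMk (hasDerivAt_const s x))
    simp only [hd.deriv]
  · push Not at hx
    simp [hφ'0 _ (hx _), image_eq_zero_of_notMem_tsupport (hx _)]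

/-- At almost every time, φ(t, ·)β(κ ∗ R) is a compactly supported C¹ function and u(t) is in H¹₀.
The divergence identity therefore applies, and the product and chain rules expand its gradient. -/
theorem integral_space_comp_moll (h : IsTransportSolution T Ω u A R)
    (hκ : ContDiff ℝ 1 κ) (hκc : HasCompactSupport κ)
    {β : E → ℝ} (hβ : ContDiff ℝ 1 β) {C : ℝ} (hC : ∀ X, ‖fderiv ℝ β X‖ ≤ C)
    {φ : ℝ × Space3 → ℝ} (hφ : ContDiff ℝ 1 φ) (hφc : HasCompactSupport φ) :
    Integrable (fun z => φ z * β (moll κ R z) * divOf (A z)) ∧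
    Integrable (fun z => β (moll κ R z) * fderiv ℝ φ z (0, u z)) ∧
    Integrable (fun z => φ z * fderiv ℝ β (moll κ R z) (mollGrad κ R z (u z))) ∧
    ∫ z, (φ z * β (moll κ R z) * divOf (A z) + β (moll κ R z) * fderiv ℝ φ z (0, u z)
      + φ z * fderiv ℝ β (moll κ R z) (mollGrad κ R z (u z))) = 0 := by
  have hD := h.memLp_moll hκ hκc
  have i1 : Integrable fun z => φ z * β (moll κ R z) * divOf (A z) := by
    have m : MemLp (fun z => φ z * β (moll κ R z)) 2 volume := by
      simpa [mul_comm] using memLp_comp_smul hφ.continuous hφc hD hβ hC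
    exact m.integrable_mul h.memLp_divOf
  have i2 : Integrable fun z => β (moll κ R z) * fderiv ℝ φ z (0, u z) := by
    have h1 := memLp_comp_smul (hφ.continuous_fderiv one_ne_zero) (hφc.fderiv (𝕜 := ℝ)) hD hβ hC
    have h2 : MemLp (fun z => ((0 : ℝ), u z)) 2 volume :=
      (ContinuousLinearMap.inr ℝ ℝ Space3).comp_memLp' h.memLp_u
    exact h1.integrable_clm_apply h2
  have i3 : Integrable fun z => φ z * fderiv ℝ β (moll κ R z) (mollGrad κ R z (u z)) :=
    integrable_smul_fderiv_comp hφ.continuous hφc hD.1 hβ hC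
      ((h.memLp_mollGrad hκ hκc).integrable_clm_apply h.memLp_u)
  refine ⟨i1, i2, i3, ?_⟩
  have i4 : Integrable (fun z => φ z * β (moll κ R z) * divOf (A z)
      + β (moll κ R z) * fderiv ℝ φ z (0, u z)
      + φ z * fderiv ℝ β (moll κ R z) (mollGrad κ R z (u z))) (volume.prod volume) :=
    (i1.add i2).add i3
  rw [Measure.volume_eq_prod, integral_prod _ i4]
  refine (integral_congr_ae ?_).trans (integral_zero _ _)
  filter_upwards [h.ae_slice, h.limit] with t ht hl
  have hζd : ContDiff ℝ 1 fun x => φ (t, x) * β (moll κ R (t, x)) :=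
    (hφ.comp (contDiff_const.prodMk contDiff_id)).mul
      (hβ.comp (contDiff_moll_slice hκ hκc ht.2.2.1))
  have hζc : HasCompactSupport fun x => φ (t, x) * β (moll κ R (t, x)) := by
    refine HasCompactSupport.intro (hφc.isCompact.image continuous_snd) fun x hx => ?_
    rw [image_eq_zero_of_notMem_tsupport (f := φ) fun h' => hx ⟨_, h', rfl⟩, zero_mul]
  refine Eq.trans (integral_congr_ae (ae_of_all _ fun x => ?_))
    (hl.integral_mul_divOf_add_eq_zero ht.1 ht.2.1 hζd hζc)
  have h1 : HasFDerivAt (fun x => φ (t, x))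
      ((fderiv ℝ φ (t, x)).comp (ContinuousLinearMap.inr ℝ ℝ Space3)) x :=
    HasFDerivAt.comp x ((hφ.differentiable one_ne_zero) (t, x)).hasFDerivAt
      (hasFDerivAt_prodMk_right t x)
  have h2 : HasFDerivAt (fun x => β (moll κ R (t, x)))
      ((fderiv ℝ β (moll κ R (t, x))).comp (mollGrad κ R (t, x))) x :=
    HasFDerivAt.comp x ((hβ.differentiable one_ne_zero) _).hasFDerivAt
      (hasFDerivAt_moll hκ hκc ht.2.2.1 x)
  have h3 := (h1.mul h2).fderiv
  simp only at h3 ⊢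
  erw [h3]
  simp
  ring

/-- Renormalization of the mollified equation, with the commutator as source. -/
theorem integral_renormalized_moll [CompleteSpace E] (h : IsTransportSolution T Ω u A R)
    (hκ : ContDiff ℝ ∞ κ) (hκs : tsupport κ ⊆ Metric.closedBall 0 δ)
    {β : E → ℝ} (hβ : ContDiff ℝ 1 β) {C : ℝ} (hC : ∀ X, ‖fderiv ℝ β X‖ ≤ C)
    {φ : ℝ × Space3 → ℝ} (hφ : IsTestOn (cyl T Ω) φ)
    (hφδ : ∀ z ∈ tsupport φ, Metric.closedBall z.2 δ ⊆ Ω) :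
    ∫ z, (fderiv ℝ φ z (1, u z) * β (moll κ R z)
      + (β (moll κ R z) - fderiv ℝ β (moll κ R z) (moll κ R z)) * divOf (A z) * φ z
      + φ z * fderiv ℝ β (moll κ R z) (transportCommutator κ u A R z)) = 0 := by
  have hκ1 : ContDiff ℝ 1 κ := hκ.of_le (by simp)
  have hκc : HasCompactSupport κ :=
    (isCompact_closedBall _ _).of_isClosed_subset (isClosed_tsupport _) hκs
  obtain ⟨i1, i2, i3, e2⟩ := h.integral_space_comp_moll hκ1 hκc hβ hC
    (hφ.1.of_le (by simp)) hφ.2.1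
  obtain ⟨j1, e1⟩ := h.integral_time_comp_moll hκ hκs hβ hC hφ hφδ
  have j2 : Integrable fun z => (φ z * β (moll κ R z) * divOf (A z)
      + β (moll κ R z) * fderiv ℝ φ z (0, u z)
      + φ z * fderiv ℝ β (moll κ R z) (mollGrad κ R z (u z))) := (i1.add i2).add i3
  -- In the sum of the time and space identities, the convective term minus the flux is the
  -- commutator minus div u times the mollification; the latter yields −∇β(X)·X.
  have e3 := integral_add j1 j2
  rw [e1, e2, add_zero] at e3
  rw [← e3]
  refine integral_congr_ae (ae_of_all _ fun z => ?_)
  have e4 : fderiv ℝ φ z (1, u z) = fderiv ℝ φ z (1, 0) + fderiv ℝ φ z (0, u z) := by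
    rw [← map_add]; simp
  simp only [transportCommutator, e4, map_sub, map_add, map_smul, smul_eq_mul]
  ring

end IsTransportSolution

/-! ### Passage to the limit: the renormalized equation -/

section Nemytskii

variable {α G : Type*} [MeasurableSpace α] {μ : Measure α} [NormedAddCommGroup G] [NormedSpace ℝ G]

theorem MeasureTheory.MemLp.integrable_smul' {a : α → ℝ} {f : α → G} (ha : MemLp a 2 μ)
    (hf : MemLp f 2 μ) : Integrable (fun x => a x • f x) μ :=
  memLp_one_iff_integrable.1 (hf.smul ha)

theorem integrable_comp_mul {β : G → ℝ} (hβ : ContDiff ℝ 1 β) {C : ℝ}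
    (hC : ∀ X, ‖fderiv ℝ β X‖ ≤ C) {D : α → G} {W : α → ℝ} (hD : MemLp D 2 μ)
    (hW : MemLp W 2 μ) (hW1 : Integrable W μ) : Integrable (fun x => β (D x) * W x) μ := by
  have h1 : Integrable (fun x => ‖D x‖ * ‖W x‖) μ := hD.norm.integrable_mul hW.norm
  refine ((hW1.norm.const_mul ‖β 0‖).add (h1.const_mul C)).mono'
    ((hβ.continuous.comp_aestronglyMeasurable hD.1).mul hW.1) (ae_of_all _ fun x => ?_)
  rw [norm_mul]
  refine (mul_le_mul_of_nonneg_right (norm_comp_le_of_fderiv_bound hβ hC (D x))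
    (norm_nonneg _)).trans_eq ?_
  simp only [Pi.add_apply]
  ring

/-- A bounded gradient makes β Lipschitz, so β(Dₙ) − β(D') is controlled in L² and pairs with W in
L². -/
theorem tendsto_integral_comp_mul {β : G → ℝ} (hβ : ContDiff ℝ 1 β) {C : ℝ}
    (hC : ∀ X, ‖fderiv ℝ β X‖ ≤ C) {D : ℕ → α → G} {D' : α → G} {W : α → ℝ}
    (hD : ∀ n, MemLp (D n) 2 μ) (hD' : MemLp D' 2 μ)
    (hW : MemLp W 2 μ) (hW1 : Integrable W μ)
    (h : Tendsto (fun n => eLpNorm (fun x => D n x - D' x) 2 μ) atTop (𝓝 0)) :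
    Tendsto (fun n => ∫ x, β (D n x) * W x ∂μ) atTop (𝓝 (∫ x, β (D' x) * W x ∂μ)) := by
  refine tendsto_integral_of_L1 _ (integrable_comp_mul hβ hC hD' hW hW1).1
    (Eventually.of_forall fun n => integrable_comp_mul hβ hC (hD n) hW hW1) ?_
  have h1 : Tendsto (fun n => ENNReal.ofReal C * (eLpNorm (fun x => D n x - D' x) 2 μ *
      eLpNorm W 2 μ)) atTop (𝓝 0) := by
    simpa using ENNReal.Tendsto.const_mul (a := ENNReal.ofReal C)
      (ENNReal.Tendsto.mul_const (b := eLpNorm W 2 μ) h (Or.inr hW.2.ne)) (Or.inr ENNReal.ofReal_ne_top)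
  refine tendsto_of_tendsto_of_tendsto_of_le_of_le tendsto_const_nhds h1 (fun _ => zero_le) ?_
  intro n
  refine le_trans ?_ (mul_le_mul_right (lintegral_enorm_mul_enorm_le ((hD n).1.sub hD'.1) hW.1) _)
  have hm : AEMeasurable (fun x => ‖(D n - D') x‖ₑ * ‖W x‖ₑ) μ :=
    ((hD n).1.sub hD'.1).enorm.mul hW.1.enorm
  rw [← lintegral_const_mul'' _ hm]
  refine lintegral_mono fun x => ?_
  simp only [Pi.sub_apply]
  rw [← sub_mul, enorm_mul, ← mul_assoc]
  gcongr
  have h2 := norm_image_sub_le_of_fderiv_bound hβ hC (D n x) (D' x)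
  have hC0 : 0 ≤ C := (norm_nonneg _).trans (hC 0)
  rw [← ofReal_norm, ← ofReal_norm, ← ENNReal.ofReal_mul hC0]
  exact ENNReal.ofReal_le_ofReal h2

end Nemytskii

theorem MeasureTheory.MemLp.fderiv_one_apply {u : ℝ × Space3 → Space3} (hu : MemLp u 2 volume)
    {φ : ℝ × Space3 → ℝ} (hφ : ContDiff ℝ 1 φ) (hφc : HasCompactSupport φ) :
    MemLp (fun z => fderiv ℝ φ z (1, u z)) 2 volume := by
  have hφ' := hφ.continuous_fderiv one_ne_zero
  have hφc' := hφc.fderiv (𝕜 := ℝ)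
  obtain ⟨C, hC⟩ := hφ'.bounded_above_of_compact_support hφc'
  have h1 : MemLp (fun z => ‖fderiv ℝ φ z‖ + C * ‖u z‖) 2 volume :=
    (hφ'.memLp_of_hasCompactSupport hφc').norm.add (hu.norm.const_mul C)
  refine h1.mono' (hφ'.aestronglyMeasurable.clm_apply'
    (aestronglyMeasurable_const.prodMk hu.1)) (ae_of_all _ fun z => ?_)
  have e : ((1 : ℝ), u z) = (1, 0) + (0, u z) := by simp
  rw [e, map_add]
  refine (norm_add_le _ _).trans (add_le_add ?_ ?_)
  · refine ((fderiv ℝ φ z).le_opNorm _).trans_eq ?_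
    simp [Prod.norm_def]
  · refine ((fderiv ℝ φ z).le_of_opNorm_le (hC z) _).trans_eq ?_
    simp [Prod.norm_def]

namespace IsTransportSolution

variable {E : Type*} [NormedAddCommGroup E] [NormedSpace ℝ E] {T : ℝ}
  {Ω : Set Space3} {u : ℝ × Space3 → Space3} {A : ℝ × Space3 → Space3 →L[ℝ] Space3}
  {R : ℝ × Space3 → E}

theorem memLp_divOf_mul (h : IsTransportSolution T Ω u A R) {φ : ℝ × Space3 → ℝ}
    (hφ : Continuous φ) (hφc : HasCompactSupport φ) :
    MemLp (fun z => divOf (A z) * φ z) 2 volume := by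
  obtain ⟨C, hC⟩ := hφ.bounded_above_of_compact_support hφc
  refine (h.memLp_divOf.norm.const_mul C).mono' (h.memLp_divOf.1.mul hφ.aestronglyMeasurable)
    (ae_of_all _ fun z => ?_)
  rw [norm_mul, mul_comm]
  gcongr
  exact hC z

theorem integrable_transportCommutator (h : IsTransportSolution T Ω u A R) {κ : Space3 → ℝ}
    (hκ : ContDiff ℝ 1 κ) (hκc : HasCompactSupport κ) :
    Integrable (transportCommutator κ u A R) :=
  (((h.memLp_mollGrad hκ hκc).integrable_clm_apply h.memLp_u).add
    (h.memLp_divOf.integrable_smul' (h.memLp_moll hκ hκc))).sub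
    (integrable_mollFlux hκ hκc h.meas_u h.memLp_u h.meas_R h.memLp_R)

/-- The renormalized equation. -/
theorem renormalized [CompleteSpace E] (h : IsTransportSolution T Ω u A R)
    {β : E → ℝ} (hβ : ContDiff ℝ 1 β) {C : ℝ} (hC : ∀ X, ‖fderiv ℝ β X‖ ≤ C)
    {φ : ℝ × Space3 → ℝ} (hφ : IsTestOn (cyl T Ω) φ) :
    ∫ z, (fderiv ℝ φ z (1, u z) * β (R z)
      + (β (R z) - fderiv ℝ β (R z) (R z)) * divOf (A z) * φ z) = 0 := by
  obtain ⟨κ, B, hB, hκ⟩ := exists_isMollifierSeq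
  obtain ⟨h1, h2⟩ := hκ.tendsto hB h.meas_u h.memLp_u h.meas_A h.memLp_A h.limit h.meas_R h.memLp_R
  have hκ1 : ∀ n, ContDiff ℝ 1 (κ n) := fun n => (hκ.contDiff n).of_le (by simp)
  have hκc := hκ.hasCompactSupport
  have hD : ∀ n, MemLp (moll (κ n) R) 2 volume := fun n => h.memLp_moll (hκ1 n) (hκc n)
  -- The gradient of β is merely continuous and bounded, so its composition converges only
  -- pointwise; hence the passage to an a.e. convergent subsequence.
  obtain ⟨ns, hns, hae⟩ := (tendstoInMeasure_of_tendsto_eLpNorm two_ne_zero (fun n => (hD n).1)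
    h.memLp_R.1 h1).exists_seq_tendsto_ae
  have hφ1 : ContDiff ℝ 1 φ := hφ.1.of_le (by simp)
  obtain ⟨M, hM⟩ := hφ.1.continuous.bounded_above_of_compact_support hφ.2.1
  set a : ℝ × Space3 → ℝ := fun z => divOf (A z) * φ z with ha
  have ha2 : MemLp a 2 volume := h.memLp_divOf_mul hφ.1.continuous hφ.2.1
  -- W collects all factors of β(Rₙ). The remaining terms, the commutator and −div u φ Rₙ, are the
  -- argument of ∇β(Rₙ) and converge in L¹.
  set W : ℝ × Space3 → ℝ := fun z => fderiv ℝ φ z (1, u z) + a z with hW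
  have hW2 : MemLp W 2 volume := (h.memLp_u.fderiv_one_apply hφ1 hφ.2.1).add ha2
  have hW1 : Integrable W := h.integrable_of_memLp hW2 fun z hz => by
    simp [hW, ha, hφ.eq_zero_of_notMem hz, hφ.fderiv_eq_zero_of_notMem hz]
  set r : ℕ → ℝ × Space3 → E := fun n => transportCommutator (κ n) u A R with hr
  have hr1 : ∀ n, Integrable (fun z => φ z • r n z) := fun n =>
    integrable_bounded_smul (h.integrable_transportCommutator (hκ1 n) (hκc n))
      hφ.1.continuous.aestronglyMeasurable hM
  have hf : ∀ n, Integrable fun z => φ z • r n z - a z • moll (κ n) R z := fun n =>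
    (hr1 n).sub (ha2.integrable_smul' (hD n))
  have hf' : Integrable fun z => -(a z • R z) := (ha2.integrable_smul' h.memLp_R).neg
  have hβ' : Continuous (fderiv ℝ β) := hβ.continuous_fderiv one_ne_zero
  have t1 := (tendsto_integral_comp_mul hβ hC hD h.memLp_R hW2 hW1 h1).comp hns.tendsto_atTop
  have hlim : Tendsto (fun n => ∫⁻ z, ‖φ z • r n z - a z • moll (κ n) R z - -(a z • R z)‖ₑ)
      atTop (𝓝 0) := by
    have b1 : Tendsto (fun n => ENNReal.ofReal M * ∫⁻ z, ‖r n z‖ₑ) atTop (𝓝 0) := by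
      simpa using ENNReal.Tendsto.const_mul h2 (Or.inr ENNReal.ofReal_ne_top)
    have b2 : Tendsto (fun n => eLpNorm a 2 volume * eLpNorm (fun z => moll (κ n) R z - R z) 2
        volume) atTop (𝓝 0) := by
      simpa using ENNReal.Tendsto.const_mul h1 (Or.inr ha2.2.ne)
    have b3 := b1.add b2
    rw [add_zero] at b3
    refine tendsto_of_tendsto_of_tendsto_of_le_of_le tendsto_const_nhds b3 (fun _ => zero_le) ?_
    intro n
    refine le_trans ?_ (add_le_add_right (lintegral_enorm_mul_enorm_le ha2.1
      ((hD n).1.sub h.memLp_R.1)) _)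
    rw [← lintegral_const_mul'' _ (h.integrable_transportCommutator (hκ1 n) (hκc n)).1.enorm,
      ← lintegral_add_left' (((h.integrable_transportCommutator (hκ1 n)
        (hκc n)).1.enorm).const_mul _)]
    refine lintegral_mono fun z => ?_
    have e : φ z • r n z - a z • moll (κ n) R z - -(a z • R z) =
        φ z • r n z - a z • (moll (κ n) R z - R z) := by rw [smul_sub]; abel
    rw [e]
    refine enorm_sub_le.trans (add_le_add ?_ ?_)
    · rw [enorm_smul]
      gcongr
      rw [← ofReal_norm]
      exact ENNReal.ofReal_le_ofReal (hM z)
    · rw [enorm_smul]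
      rfl
  have t2 := tendsto_integral_clm_apply (C := C) (m := fun k z => fderiv ℝ β (moll (κ (ns k)) R z))
    (m' := fun z => fderiv ℝ β (R z))
    (fun k => hβ'.comp_aestronglyMeasurable (hD (ns k)).1) (fun k => ae_of_all _ fun z => hC _)
    (hae.mono fun z hz => (hβ'.tendsto _).comp hz) (fun k => hf (ns k)) hf'
    (hlim.comp hns.tendsto_atTop)
  have t3 := t1.add t2
  have hβ'' : ∀ n (F : ℝ × Space3 → E), Integrable F → Integrable fun z =>
      fderiv ℝ β (moll (κ n) R z) (F z) := fun n F hF =>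
    (hF.norm.const_mul C).mono' ((hβ'.comp_aestronglyMeasurable (hD n).1).clm_apply' hF.1)
      (ae_of_all _ fun z => (fderiv ℝ β (moll (κ n) R z)).le_of_opNorm_le (hC _) _)
  have hzero : ∀ᶠ n in atTop, (∫ z, β (moll (κ n) R z) * W z) + ∫ z, fderiv ℝ β (moll (κ n) R z)
      (φ z • r n z - a z • moll (κ n) R z) = 0 := by
    have hK : IsCompact (Prod.snd '' tsupport φ) := hφ.2.1.isCompact.image continuous_snd
    have hKΩ : Prod.snd '' tsupport φ ⊆ Ω := by
      rintro _ ⟨z, hz, rfl⟩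
      exact (hφ.2.2 hz).2
    -- The spatial projection of the support is a compact subset of Ω, so for large n every ball
    -- required by the mollified identity lies in Ω.
    obtain ⟨ε, hε, hεΩ⟩ := hK.exists_cthickening_subset_open h.isOpen hKΩ
    have hrad : Tendsto (fun n : ℕ => 1 / ((n : ℝ) + 1)) atTop (𝓝 0) :=
      tendsto_one_div_add_atTop_nhds_zero_nat
    filter_upwards [hrad.eventually (gt_mem_nhds hε)] with n hn
    have key := h.integral_renormalized_moll (hκ.contDiff n) (hκ.tsupport_subset n) hβ hC hφ
      fun z hz => (Metric.closedBall_subset_closedBall hn.le).trans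
        ((Metric.closedBall_subset_cthickening (mem_image_of_mem Prod.snd hz) ε).trans hεΩ)
    rw [← integral_add (integrable_comp_mul hβ hC (hD n) hW2 hW1) (hβ'' n _ (hf n)), ← key]
    refine integral_congr_ae (ae_of_all _ fun z => ?_)
    simp only [hW, ha, hr, map_sub, map_smul, smul_eq_mul]
    ring
  have t4 := tendsto_nhds_unique t3 (tendsto_const_nhds.congr' ((hns.tendsto_atTop.eventually
    hzero).mono fun k hk => hk.symm))
  have i5 : Integrable fun z => fderiv ℝ β (R z) (-(a z • R z)) :=
    (hf'.norm.const_mul C).mono' ((hβ'.comp_aestronglyMeasurable h.memLp_R.1).clm_apply' hf'.1)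
      (ae_of_all _ fun z => (fderiv ℝ β (R z)).le_of_opNorm_le (hC _) _)
  rw [← integral_add (integrable_comp_mul hβ hC h.memLp_R hW2 hW1) i5] at t4
  rw [← t4]
  refine integral_congr_ae (ae_of_all _ fun z => ?_)
  simp only [hW, ha, map_neg, map_smul, smul_eq_mul]
  ring

end IsTransportSolution

/-! ### A smooth approximation of the norm -/

theorem Real.le_sqrt_sq_add_sq_left (a b : ℝ) : a ≤ Real.sqrt (a ^ 2 + b ^ 2) :=
  Real.le_sqrt_of_sq_le (by nlinarith [sq_nonneg b])

theorem Real.le_sqrt_sq_add_sq_right (a b : ℝ) : b ≤ Real.sqrt (a ^ 2 + b ^ 2) :=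
  Real.le_sqrt_of_sq_le (by nlinarith [sq_nonneg a])

section SmoothNorm

variable {E : Type*} [NormedAddCommGroup E] {ε : ℝ}

/-- A smooth approximation of the norm. -/
noncomputable def smoothNorm (ε : ℝ) (X : E) : ℝ := Real.sqrt (‖X‖ ^ 2 + ε ^ 2) - ε

theorem abs_smoothNorm_sub_norm_le (hε : 0 < ε) (X : E) : |smoothNorm ε X - ‖X‖| ≤ ε := by
  have h1 : Real.sqrt (‖X‖ ^ 2 + ε ^ 2) ≤ ‖X‖ + ε :=
    Real.sqrt_le_iff.2 ⟨by positivity, by nlinarith [norm_nonneg X]⟩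
  have h2 := Real.le_sqrt_sq_add_sq_left ‖X‖ ε
  rw [smoothNorm, abs_le]
  constructor <;> linarith

theorem abs_smoothNorm_le (hε : 0 < ε) (X : E) : |smoothNorm ε X| ≤ ‖X‖ := by
  have h1 : Real.sqrt (‖X‖ ^ 2 + ε ^ 2) ≤ ‖X‖ + ε :=
    Real.sqrt_le_iff.2 ⟨by positivity, by nlinarith [norm_nonneg X]⟩
  have h2 := Real.le_sqrt_sq_add_sq_right ‖X‖ ε
  rw [smoothNorm, abs_of_nonneg (by linarith)]
  linarith

variable [InnerProductSpace ℝ E]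

theorem hasFDerivAt_smoothNorm (hε : 0 < ε) (X : E) :
    HasFDerivAt (smoothNorm ε) ((Real.sqrt (‖X‖ ^ 2 + ε ^ 2))⁻¹ • innerSL ℝ X) X := by
  have h0 : ‖X‖ ^ 2 + ε ^ 2 ≠ 0 := by positivity
  have h1 : HasFDerivAt (fun X : E => ‖X‖ ^ 2 + ε ^ 2) (2 • innerSL ℝ X) X :=
    (HasStrictFDerivAt.hasFDerivAt (hasStrictFDerivAt_norm_sq X)).add_const _
  have h2 := (h1.sqrt h0).sub_const ε
  have e : (1 / (2 * Real.sqrt (‖X‖ ^ 2 + ε ^ 2))) • 2 • innerSL ℝ X =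
      (Real.sqrt (‖X‖ ^ 2 + ε ^ 2))⁻¹ • innerSL ℝ X := by
    ext Y
    simp
    ring
  rw [e] at h2
  exact h2

theorem contDiff_smoothNorm (hε : 0 < ε) : ContDiff ℝ 1 (smoothNorm ε : E → ℝ) :=
  (((contDiff_norm_sq ℝ).add contDiff_const).sqrt fun X => by positivity).sub contDiff_const

theorem norm_fderiv_smoothNorm_le (hε : 0 < ε) (X : E) : ‖fderiv ℝ (smoothNorm ε) X‖ ≤ 1 := by
  have h0 := hε.trans_le (Real.le_sqrt_sq_add_sq_right ‖X‖ ε)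
  rw [(hasFDerivAt_smoothNorm hε X).fderiv, norm_smul, norm_inv, innerSL_apply_norm,
    Real.norm_of_nonneg h0.le, inv_mul_le_iff₀ h0, mul_one]
  exact Real.le_sqrt_sq_add_sq_left ‖X‖ ε

/-- The norm is homogeneous of degree one, so this expression would vanish for it. For the
approximation it equals ε²/s − ε with s ≥ ε, and div u therefore disappears from the L¹ estimate as
ε → 0. -/
theorem abs_smoothNorm_sub_fderiv_le (hε : 0 < ε) (X : E) :
    |smoothNorm ε X - fderiv ℝ (smoothNorm ε) X X| ≤ ε := by
  have h0 := Real.le_sqrt_sq_add_sq_right ‖X‖ ε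
  have h1 := Real.sq_sqrt (show 0 ≤ ‖X‖ ^ 2 + ε ^ 2 by positivity)
  rw [(hasFDerivAt_smoothNorm hε X).fderiv, smoothNorm]
  simp only [_root_.smul_apply, innerSL_apply_apply, real_inner_self_eq_norm_sq,
    smul_eq_mul]
  set s := Real.sqrt (‖X‖ ^ 2 + ε ^ 2)
  have hs : 0 < s := hε.trans_le h0
  have e : s - ε - s⁻¹ * ‖X‖ ^ 2 = s⁻¹ * ε ^ 2 - ε := by
    field_simp
    linarith
  have h2 : s⁻¹ * ε ^ 2 ≤ ε := by
    rw [inv_mul_le_iff₀ hs]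
    nlinarith
  have h3 : 0 ≤ s⁻¹ * ε ^ 2 := by positivity
  rw [e, abs_le]
  constructor <;> linarith

end SmoothNorm

/-! ### L¹ estimates uniform in time -/

theorem tsupport_time_mul_space_subset (θ : ℝ → ℝ) (χ : Space3 → ℝ) :
    tsupport (fun z : ℝ × Space3 => θ z.1 * χ z.2) ⊆ tsupport θ ×ˢ tsupport χ := by
  refine closure_minimal (fun z hz => ?_) ((isClosed_tsupport _).prod (isClosed_tsupport _))
  exact ⟨subset_tsupport _ fun h0 => hz (by simp [h0]),
    subset_tsupport _ fun h0 => hz (by simp [h0])⟩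

theorem IsTestOn.time_mul_space {Ω : Set Space3} {I : Set ℝ} {θ : ℝ → ℝ} {χ : Space3 → ℝ}
    (hθ : IsTestOn I θ) (hχ : IsTestOn Ω χ) :
    IsTestOn (I ×ˢ Ω) fun z : ℝ × Space3 => θ z.1 * χ z.2 := by
  have hsub := tsupport_time_mul_space_subset θ χ
  exact ⟨(hθ.1.comp contDiff_fst).mul (hχ.1.comp contDiff_snd),
    (hθ.2.1.isCompact.prod hχ.2.1.isCompact).of_isClosed_subset (isClosed_tsupport _) hsub,
    hsub.trans (prod_mono hθ.2.2 hχ.2.2)⟩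

theorem fderiv_time_mul_space {θ : ℝ → ℝ} {χ : Space3 → ℝ} (hθ : Differentiable ℝ θ)
    (hχ : Differentiable ℝ χ) (z : ℝ × Space3) (s : ℝ) (w : Space3) :
    fderiv ℝ (fun z : ℝ × Space3 => θ z.1 * χ z.2) z (s, w) =
      s * deriv θ z.1 * χ z.2 + θ z.1 * fderiv ℝ χ z.2 w := by
  have h1 : HasFDerivAt (fun z : ℝ × Space3 => θ z.1)
      ((ContinuousLinearMap.toSpanSingleton ℝ (deriv θ z.1)).comp
        (ContinuousLinearMap.fst ℝ ℝ Space3)) z :=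
    HasFDerivAt.comp z (hθ z.1).hasDerivAt.hasFDerivAt hasFDerivAt_fst
  have h2 : HasFDerivAt (fun z : ℝ × Space3 => χ z.2)
      ((fderiv ℝ χ z.2).comp (ContinuousLinearMap.snd ℝ ℝ Space3)) z :=
    HasFDerivAt.comp z (hχ z.2).hasFDerivAt hasFDerivAt_snd
  have h3 : fderiv ℝ (fun z : ℝ × Space3 => θ z.1 * χ z.2) z = _ := (h1.mul h2).fderiv
  rw [h3]
  simp
  ring

/-- Integrating a weak identity in space. -/
theorem exists_ae_integral_eq_add_primitive {b f : ℝ × Space3 → ℝ} {a T : ℝ} (hT : a < T)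
    (hb : Integrable b) (hf : Integrable f)
    (h : ∀ θ : ℝ → ℝ, IsTestOn (Ioo a T) θ → ∫ z, (deriv θ z.1 * b z + θ z.1 * f z) = 0) :
    ∃ c : ℝ, ∀ᵐ t ∂(volume.restrict (Ioo a T)),
      ∫ x, b (t, x) = c + ∫ s in a..t, ∫ x, f (s, x) := by
  have hb' : Integrable b (volume.prod volume) := hb
  have hf' : Integrable f (volume.prod volume) := hf
  refine ae_eq_add_primitive_of_weak_deriv hT hb'.integral_prod_left.integrableOn
    hf'.integral_prod_left fun θ hθ => ?_
  obtain ⟨M, hM⟩ := hθ.1.continuous.bounded_above_of_compact_support hθ.2.1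
  have hθ' : Continuous (deriv θ) := hθ.1.continuous_deriv (by simp)
  obtain ⟨M', hM'⟩ := hθ'.bounded_above_of_compact_support hθ.2.1.deriv
  have i1 : Integrable (fun z : ℝ × Space3 => deriv θ z.1 * b z) (volume.prod volume) :=
    integrable_bounded_smul hb' (hθ'.comp continuous_fst).aestronglyMeasurable fun z => hM' z.1
  have i2 : Integrable (fun z : ℝ × Space3 => θ z.1 * f z) (volume.prod volume) :=
    integrable_bounded_smul hf' (hθ.1.continuous.comp continuous_fst).aestronglyMeasurable
      fun z => hM z.1
  have i3 : Integrable (fun z : ℝ × Space3 => deriv θ z.1 * b z + θ z.1 * f z)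
    (volume.prod volume) := i1.add i2
  rw [setIntegral_eq_integral_of_forall_compl_eq_zero, ← h θ hθ, Measure.volume_eq_prod,
    integral_prod _ i3]
  · refine integral_congr_ae ?_
    filter_upwards [hb'.prod_right_ae, hf'.prod_right_ae] with t hbt hft
    have j1 : Integrable fun x => deriv θ t * b (t, x) := hbt.const_mul _
    have j2 : Integrable fun x => θ t * f (t, x) := hft.const_mul _
    rw [integral_add j1 j2, integral_const_mul, integral_const_mul]
    rfl
  · intro t ht
    rw [hθ.eq_zero_of_notMem ht, ← fderiv_apply_one_eq_deriv, hθ.fderiv_eq_zero_of_notMem ht]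
    simp

/-- A function with integrable weak derivative is bounded by its mean and the variation. -/
theorem ae_mul_le_of_eq_add_primitive {m f : ℝ → ℝ} {T c : ℝ} (hT : 0 < T)
    (hm : IntegrableOn m (Ioo 0 T)) (hf : Integrable f)
    (h : ∀ᵐ t ∂(volume.restrict (Ioo 0 T)), m t = c + ∫ s in 0..t, f s) :
    ∀ᵐ t ∂(volume.restrict (Ioo 0 T)), T * m t ≤ (∫ s in Ioo 0 T, m s) + T * ∫ s, |f s| := by
  filter_upwards [h] with t ht
  -- Values at two times differ by at most the total variation; averaging over s in (0, T) gives the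
  -- claim.
  have h1 : ∀ᵐ s ∂(volume.restrict (Ioo 0 T)), m t ≤ m s + ∫ s, |f s| := by
    filter_upwards [h] with s hs
    have e : m t - m s = ∫ r in s..t, f r := by
      rw [ht, hs, add_sub_add_left_eq_sub, intervalIntegral.integral_interval_sub_left]
        <;> exact hf.intervalIntegrable
    have h2 : |∫ r in s..t, f r| ≤ ∫ s, |f s| := by
      have h3 : ‖∫ r in s..t, f r‖ ≤ ∫ r in uIoc s t, ‖f r‖ :=
        intervalIntegral.norm_integral_le_integral_norm_uIoc
      exact h3.trans <| setIntegral_le_integral hf.abs (ae_of_all _ fun s => abs_nonneg _)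
    have := (le_abs_self _).trans h2
    linarith
  have h3 := integral_mono_ae (μ := volume.restrict (Ioo 0 T)) (integrable_const (m t))
    (hm.add (integrable_const _)) h1
  simp only [Pi.add_apply] at h3
  rw [integral_add hm (integrable_const _)] at h3
  simpa [hT.le] using h3

namespace IsTransportSolution

variable {E : Type*} [NormedAddCommGroup E] [InnerProductSpace ℝ E] [CompleteSpace E] {T : ℝ}
  {Ω : Set Space3} {u : ℝ × Space3 → Space3} {A : ℝ × Space3 → Space3 →L[ℝ] Space3}
  {R : ℝ × Space3 → E} {κ : Space3 → ℝ} {δ : ℝ}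

/-- Renormalize with β close to the norm and test with θ(t)χ(x). This bounds the weak time
derivative of ∫ χβ(D), hence its variation, and a function of one variable is bounded by its mean
plus its variation. Neither positivity nor the mass of κ is used, so the kernel may be a difference
of mollifiers. -/
theorem ae_mul_integral_norm_moll_le (h : IsTransportSolution T Ω u A R) (hT : 0 < T)
    (hκ : ContDiff ℝ ∞ κ) (hκs : tsupport κ ⊆ Metric.closedBall 0 δ)
    {χ : Space3 → ℝ} (hχ : IsTestOn Ω χ) (hχ0 : ∀ x, 0 ≤ χ x)
    (hχδ : ∀ x ∈ tsupport χ, Metric.closedBall x δ ⊆ Ω) :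
    ∀ᵐ t ∂(volume.restrict (Ioo 0 T)), T * ∫ x, χ x * ‖moll κ R (t, x)‖ ≤
      (∫ z, χ z.2 * ‖moll κ R z‖) + T * ∫ z, (‖moll κ R z‖ * |fderiv ℝ χ z.2 (u z)|
        + χ z.2 * ‖transportCommutator κ u A R z‖) := by
  have hκ1 : ContDiff ℝ 1 κ := hκ.of_le (by simp)
  have hκc : HasCompactSupport κ :=
    (isCompact_closedBall _ _).of_isClosed_subset (isClosed_tsupport _) hκs
  have hχ1 : ContDiff ℝ 1 χ := hχ.1.of_le (by simp)
  have hχc : Continuous fun z : ℝ × Space3 => χ z.2 := hχ.1.continuous.comp continuous_snd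
  have hχ' : Continuous fun z : ℝ × Space3 => fderiv ℝ χ z.2 :=
    (hχ1.continuous_fderiv one_ne_zero).comp continuous_snd
  obtain ⟨M, hM⟩ := hχ.1.continuous.bounded_above_of_compact_support hχ.2.1
  obtain ⟨M', hM'⟩ := (hχ1.continuous_fderiv one_ne_zero).bounded_above_of_compact_support
    (hχ.2.1.fderiv (𝕜 := ℝ))
  set D := moll κ R with hDdef
  have hD2 : MemLp D 2 volume := h.memLp_moll hκ1 hκc
  have hD1 : Integrable D := integrable_spaceConv (continuous_moll_kernel hκ1)
    (hasCompactSupport_moll_kernel hκc) h.meas_R h.integrable_R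
  set r := transportCommutator κ u A R with hrdef
  have hr : Integrable r := h.integrable_transportCommutator hκ1 hκc
  have hdiv : Integrable fun z => divOf (A z) :=
    h.integrable_of_memLp h.memLp_divOf fun z hz => by rw [h.zero_A z hz]; simp [divOf]
  have hχu : AEStronglyMeasurable (fun z => fderiv ℝ χ z.2 (u z)) volume :=
    hχ'.aestronglyMeasurable.clm_apply' h.memLp_u.1
  have k1 : Integrable fun z => χ z.2 * ‖D z‖ :=
    integrable_bounded_smul hD1.norm hχc.aestronglyMeasurable fun z => hM z.2
  have k2 : Integrable fun z => ‖D z‖ * |fderiv ℝ χ z.2 (u z)| := by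
    have hDu : Integrable fun z => ‖D z‖ * ‖u z‖ := hD2.norm.integrable_mul h.memLp_u.norm
    refine (hDu.const_mul M').mono' (hD1.1.norm.mul hχu.norm) (ae_of_all _ fun z => ?_)
    rw [norm_mul, norm_norm, Real.norm_eq_abs, abs_abs, ← Real.norm_eq_abs, mul_left_comm]
    gcongr
    exact (fderiv ℝ χ z.2).le_of_opNorm_le (hM' _) _
  have k3 : Integrable fun z => χ z.2 * ‖r z‖ :=
    integrable_bounded_smul hr.norm hχc.aestronglyMeasurable fun z => hM z.2
  have k4 : Integrable fun z => χ z.2 * |divOf (A z)| :=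
    integrable_bounded_smul hdiv.abs hχc.aestronglyMeasurable fun z => hM z.2
  set P := ∫ z, χ z.2 * ‖D z‖ with hP
  set J := ∫ z, (‖D z‖ * |fderiv ℝ χ z.2 (u z)| + χ z.2 * ‖r z‖) with hJ
  set L := ∫ z, χ z.2 * |divOf (A z)| with hL
  have hχint : Integrable χ := hχ.1.continuous.integrable_of_hasCompactSupport hχ.2.1
  have step : ∀ ε : ℝ, 0 < ε → ∀ᵐ t ∂(volume.restrict (Ioo 0 T)),
      T * ((∫ x, χ x * ‖D (t, x)‖) - ε * ∫ x, χ x) ≤ P + T * (J + ε * L) := by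
    intro ε hε
    have hβ : ContDiff ℝ 1 (smoothNorm ε : E → ℝ) := contDiff_smoothNorm hε
    have hβ' : Continuous (fderiv ℝ (smoothNorm ε : E → ℝ)) := hβ.continuous_fderiv one_ne_zero
    have hC : ∀ X : E, ‖fderiv ℝ (smoothNorm ε) X‖ ≤ 1 := norm_fderiv_smoothNorm_le hε
    set b : ℝ × Space3 → ℝ := fun z => χ z.2 * smoothNorm ε (D z) with hb
    set f : ℝ × Space3 → ℝ := fun z => fderiv ℝ χ z.2 (u z) * smoothNorm ε (D z)
      + (smoothNorm ε (D z) - fderiv ℝ (smoothNorm ε) (D z) (D z)) * divOf (A z) * χ z.2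
      + χ z.2 * fderiv ℝ (smoothNorm ε) (D z) (r z) with hf
    have mβ : AEStronglyMeasurable (fun z => smoothNorm ε (D z)) volume :=
      hβ.continuous.comp_aestronglyMeasurable hD1.1
    have mβ' : AEStronglyMeasurable (fun z => fderiv ℝ (smoothNorm ε) (D z)) volume :=
      hβ'.comp_aestronglyMeasurable hD1.1
    have hbi : Integrable b := by
      refine k1.mono' (hχc.aestronglyMeasurable.mul mβ) (ae_of_all _ fun z => ?_)
      rw [norm_mul, Real.norm_of_nonneg (hχ0 _)]
      exact mul_le_mul_of_nonneg_left (abs_smoothNorm_le hε _) (hχ0 _)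
    -- The density of the time derivative: the gradient of β has norm at most one, and div u enters
    -- only with the factor ε.
    have hfb : ∀ z, ‖f z‖ ≤ (‖D z‖ * |fderiv ℝ χ z.2 (u z)| + χ z.2 * ‖r z‖)
        + ε * (χ z.2 * |divOf (A z)|) := by
      intro z
      have b1 : ‖fderiv ℝ χ z.2 (u z) * smoothNorm ε (D z)‖ ≤ ‖D z‖ * |fderiv ℝ χ z.2 (u z)| := by
        rw [norm_mul, mul_comm]
        exact mul_le_mul_of_nonneg_right (abs_smoothNorm_le hε _) (abs_nonneg _)
      have b2 : ‖(smoothNorm ε (D z) - fderiv ℝ (smoothNorm ε) (D z) (D z)) * divOf (A z) * χ z.2‖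
          ≤ ε * (χ z.2 * |divOf (A z)|) := by
        rw [norm_mul, norm_mul, Real.norm_of_nonneg (hχ0 _), mul_assoc, mul_comm (χ z.2)]
        exact mul_le_mul_of_nonneg_right (abs_smoothNorm_sub_fderiv_le hε _)
          (mul_nonneg (abs_nonneg _) (hχ0 _))
      have b3 : ‖χ z.2 * fderiv ℝ (smoothNorm ε) (D z) (r z)‖ ≤ χ z.2 * ‖r z‖ := by
        rw [norm_mul, Real.norm_of_nonneg (hχ0 _)]
        refine mul_le_mul_of_nonneg_left ?_ (hχ0 _)
        simpa using (fderiv ℝ (smoothNorm ε) (D z)).le_of_opNorm_le (hC _) (r z)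
      have := norm_add₃_le (a := fderiv ℝ χ z.2 (u z) * smoothNorm ε (D z))
        (b := (smoothNorm ε (D z) - fderiv ℝ (smoothNorm ε) (D z) (D z)) * divOf (A z) * χ z.2)
        (c := χ z.2 * fderiv ℝ (smoothNorm ε) (D z) (r z))
      simp only [hf]
      linarith
    have hJi : Integrable fun z => (‖D z‖ * |fderiv ℝ χ z.2 (u z)| + χ z.2 * ‖r z‖)
        + ε * (χ z.2 * |divOf (A z)|) := (k2.add k3).add (k4.const_mul ε)
    have hfm : AEStronglyMeasurable f volume :=
      ((hχu.mul mβ).add (((mβ.sub (mβ'.clm_apply' hD1.1)).mul hdiv.1).mul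
        hχc.aestronglyMeasurable)).add (hχc.aestronglyMeasurable.mul (mβ'.clm_apply' hr.1))
    have hfi : Integrable f := hJi.mono' hfm (ae_of_all _ hfb)
    obtain ⟨c, hc⟩ := exists_ae_integral_eq_add_primitive hT hbi hfi fun θ hθ => by
      have key := h.integral_renormalized_moll hκ hκs hβ hC (hθ.time_mul_space hχ)
        fun z hz => hχδ z.2 (tsupport_time_mul_space_subset θ χ hz).2
      rw [← key]
      refine integral_congr_ae (ae_of_all _ fun z => ?_)
      simp only [hb, hf, fderiv_time_mul_space hθ.differentiable hχ.differentiable]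
      ring
    have hbi' : Integrable b (volume.prod volume) := hbi
    have hfi' : Integrable f (volume.prod volume) := hfi
    have hfin := ae_mul_le_of_eq_add_primitive hT hbi'.integral_prod_left.integrableOn
      hfi'.integral_prod_left hc
    have e1 : ∫ s in Ioo 0 T, ∫ x, b (s, x) ≤ P := by
      refine (Real.le_norm_self _).trans ((norm_integral_le_integral_norm _).trans ?_)
      refine (setIntegral_le_integral hbi'.integral_prod_left.norm
        (ae_of_all _ fun s => norm_nonneg _)).trans ?_
      have k1' : Integrable (fun z : ℝ × Space3 => χ z.2 * ‖D z‖) (volume.prod volume) := k1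
      rw [hP, Measure.volume_eq_prod, integral_prod _ k1']
      refine integral_mono_ae hbi'.integral_prod_left.norm k1'.integral_prod_left ?_
      filter_upwards [k1'.prod_right_ae] with s hs
      refine norm_integral_le_of_norm_le hs (ae_of_all _ fun x => ?_)
      simp only [hb]
      rw [norm_mul, Real.norm_of_nonneg (hχ0 _)]
      exact mul_le_mul_of_nonneg_left (abs_smoothNorm_le hε _) (hχ0 _)
    have e2 : ∫ s, |∫ x, f (s, x)| ≤ J + ε * L := by
      have k5 : Integrable fun z => ‖D z‖ * |fderiv ℝ χ z.2 (u z)| + χ z.2 * ‖r z‖ := k2.add k3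
      rw [hJ, hL, ← integral_const_mul, ← integral_add k5 (k4.const_mul ε)]
      have hJi' : Integrable (fun z => (‖D z‖ * |fderiv ℝ χ z.2 (u z)| + χ z.2 * ‖r z‖)
        + ε * (χ z.2 * |divOf (A z)|)) (volume.prod volume) := hJi
      rw [Measure.volume_eq_prod, integral_prod _ hJi']
      refine integral_mono_ae hfi'.integral_prod_left.abs hJi'.integral_prod_left ?_
      filter_upwards [hJi'.prod_right_ae] with s hs
      exact norm_integral_le_of_norm_le hs (ae_of_all _ fun x => hfb (s, x))
    have k1' : Integrable (fun z : ℝ × Space3 => χ z.2 * ‖D z‖) (volume.prod volume) := k1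
    filter_upwards [hfin, ae_restrict_of_ae k1'.prod_right_ae,
      ae_restrict_of_ae hbi'.prod_right_ae] with t ht hkt hbt
    have e3 : (∫ x, χ x * ‖D (t, x)‖) - ε * ∫ x, χ x ≤ ∫ x, b (t, x) := by
      rw [← integral_const_mul, ← integral_sub hkt (hχint.const_mul ε)]
      refine integral_mono (hkt.sub (hχint.const_mul ε)) hbt fun x => ?_
      have := (abs_le.1 (abs_smoothNorm_sub_norm_le hε (D (t, x)))).1
      simp only [hb]
      nlinarith [hχ0 x]
    calc T * ((∫ x, χ x * ‖D (t, x)‖) - ε * ∫ x, χ x) ≤ T * ∫ x, b (t, x) := by gcongr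
      _ ≤ _ := ht
      _ ≤ P + T * (J + ε * L) := by gcongr
  -- A sequence of values of ε keeps the exceptional set of times null in the limit ε → 0.
  have hall := ae_all_iff.2 fun k : ℕ => step (1 / ((k : ℝ) + 1)) Nat.one_div_pos_of_nat
  filter_upwards [hall] with t ht
  have hrad : Tendsto (fun n : ℕ => 1 / ((n : ℝ) + 1)) atTop (𝓝 0) :=
    tendsto_one_div_add_atTop_nhds_zero_nat
  refine le_of_tendsto_of_tendsto' (f := fun k : ℕ => T * ((∫ x, χ x * ‖D (t, x)‖) -
    1 / ((k : ℝ) + 1) * ∫ x, χ x)) (g := fun k : ℕ => P + T * (J + 1 / ((k : ℝ) + 1) * L))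
    (b := atTop) ?_ ?_ ht
  · have := ((hrad.mul_const (∫ x, χ x)).const_sub (∫ x, χ x * ‖D (t, x)‖)).const_mul T
    simpa using this
  · have := (((hrad.mul_const L).const_add J).const_mul T).const_add P
    simpa using this

end IsTransportSolution

/-! ### Uniform-in-time convergence of the mollifications -/

section MollLinear

variable {E : Type*} [NormedAddCommGroup E] [NormedSpace ℝ E] {u : ℝ × Space3 → Space3}
  {A : ℝ × Space3 → Space3 →L[ℝ] Space3} {R : ℝ × Space3 → E}

/-- Linearity in the kernel lets a difference of two mollifications be estimated as a single
mollification. -/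
theorem ae_moll_sub {κ₁ κ₂ : Space3 → ℝ} (hκ₁ : ContDiff ℝ 1 κ₁) (hκ₁c : HasCompactSupport κ₁)
    (hκ₂ : ContDiff ℝ 1 κ₂) (hκ₂c : HasCompactSupport κ₂) (hu : StronglyMeasurable u)
    (hu2 : MemLp u 2 volume) (hR : StronglyMeasurable R) (hR2 : MemLp R 2 volume) :
    ∀ᵐ t, ∀ x, moll (κ₁ - κ₂) R (t, x) = moll κ₁ R (t, x) - moll κ₂ R (t, x) ∧
      transportCommutator (κ₁ - κ₂) u A R (t, x) =
        transportCommutator κ₁ u A R (t, x) - transportCommutator κ₂ u A R (t, x) := by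
  filter_upwards [ae_memLp_slice hu hu2, ae_memLp_slice hR hR2] with t hut hRt x
  have hf : ∀ y, fderiv ℝ (κ₁ - κ₂) y = fderiv ℝ κ₁ y - fderiv ℝ κ₂ y := fun y =>
    fderiv_sub (hκ₁.differentiable one_ne_zero y) (hκ₂.differentiable one_ne_zero y)
  have e1 : moll (κ₁ - κ₂) R (t, x) = moll κ₁ R (t, x) - moll κ₂ R (t, x) := by
    have i1 : Integrable fun y => κ₁ y • R (t, x - y) := integrable_kernel_of_memLp_slice (F := E)
      (continuous_moll_kernel hκ₁) (hasCompactSupport_moll_kernel hκ₁c) hRt x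
    have i2 : Integrable fun y => κ₂ y • R (t, x - y) := integrable_kernel_of_memLp_slice (F := E)
      (continuous_moll_kernel hκ₂) (hasCompactSupport_moll_kernel hκ₂c) hRt x
    simp only [moll_apply]
    rw [← integral_sub i1 i2]
    simp only [Pi.sub_apply, sub_smul]
  have e2 : mollGrad (κ₁ - κ₂) R (t, x) = mollGrad κ₁ R (t, x) - mollGrad κ₂ R (t, x) := by
    have i1 := integrable_kernel_of_memLp_slice (F := Space3 →L[ℝ] E)
      (continuous_mollGrad_kernel hκ₁) (hasCompactSupport_mollGrad_kernel hκ₁c) hRt x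
    have i2 := integrable_kernel_of_memLp_slice (F := Space3 →L[ℝ] E)
      (continuous_mollGrad_kernel hκ₂) (hasCompactSupport_mollGrad_kernel hκ₂c) hRt x
    simp only [mollGrad, spaceConv]
    rw [← integral_sub i1 i2]
    simp only [hf, map_sub, _root_.sub_apply]
  have e3 : mollFlux (κ₁ - κ₂) u R (t, x) = mollFlux κ₁ u R (t, x) - mollFlux κ₂ u R (t, x) := by
    have i1 := integrable_mollFlux_slice hκ₁ hκ₁c hut hRt x
    have i2 := integrable_mollFlux_slice hκ₂ hκ₂c hut hRt x
    simp only [mollFlux]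
    rw [← integral_sub i1 i2]
    simp only [hf, _root_.sub_apply, sub_smul]
  refine ⟨e1, ?_⟩
  simp only [transportCommutator, e1, e2, e3, _root_.sub_apply, smul_sub]
  abel

end MollLinear

namespace IsTransportSolution

variable {E : Type*} [NormedAddCommGroup E] [InnerProductSpace ℝ E] [CompleteSpace E] {T : ℝ}
  {Ω : Set Space3} {u : ℝ × Space3 → Space3} {A : ℝ × Space3 → Space3 →L[ℝ] Space3}
  {R : ℝ × Space3 → E} {κ : Space3 → ℝ} {δ : ℝ}

/-- Cauchy–Schwarz in the mean-plus-variation bound. What matters is that K and M depend on χ, u and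
T but not on the kernel. -/
theorem exists_ae_lintegral_moll_le (h : IsTransportSolution T Ω u A R) (hT : 0 < T)
    {χ : Space3 → ℝ} (hχ : IsTestOn Ω χ) (hχ0 : ∀ x, 0 ≤ χ x) :
    ∃ K M : ℝ≥0∞, K ≠ ⊤ ∧ M ≠ ⊤ ∧ ∀ (κ : Space3 → ℝ) (δ : ℝ), ContDiff ℝ ∞ κ →
      tsupport κ ⊆ Metric.closedBall 0 δ → (∀ x ∈ tsupport χ, Metric.closedBall x δ ⊆ Ω) →
      ∀ᵐ t ∂(volume.restrict (Ioo 0 T)), ∫⁻ x, ‖χ x‖ₑ * ‖moll κ R (t, x)‖ₑ ≤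
        K * eLpNorm (moll κ R) 2 volume + M * ∫⁻ z, ‖transportCommutator κ u A R z‖ₑ := by
  have hχ1 : ContDiff ℝ 1 χ := hχ.1.of_le (by simp)
  have hχc : Continuous fun z : ℝ × Space3 => χ z.2 := hχ.1.continuous.comp continuous_snd
  have hχ' : Continuous fun z : ℝ × Space3 => fderiv ℝ χ z.2 :=
    (hχ1.continuous_fderiv one_ne_zero).comp continuous_snd
  obtain ⟨M, hM⟩ := hχ.1.continuous.bounded_above_of_compact_support hχ.2.1
  obtain ⟨M', hM'⟩ := (hχ1.continuous_fderiv one_ne_zero).bounded_above_of_compact_support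
    (hχ.2.1.fderiv (𝕜 := ℝ))
  -- χ alone is not square integrable over all times. Cutting it to the cylinder loses nothing,
  -- since D vanishes outside (0, T) and χ outside Ω.
  set χ₁ : ℝ × Space3 → ℝ := (cyl T Ω).indicator fun z => χ z.2 with hχ₁
  set W : ℝ × Space3 → ℝ := fun z => fderiv ℝ χ z.2 (u z) with hW
  have hW2 : MemLp W 2 volume := (h.memLp_u.norm.const_mul M').mono'
    (hχ'.aestronglyMeasurable.clm_apply' h.memLp_u.1)
    (ae_of_all _ fun z => (fderiv ℝ χ z.2).le_of_opNorm_le (hM' _) _)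
  have hχ₁2 : MemLp χ₁ 2 volume := by
    have : IsFiniteMeasure (volume.restrict (cyl T Ω)) := ⟨by simpa using h.volume_cyl_lt_top⟩
    exact (memLp_indicator_iff_restrict h.measurableSet_cyl).2
      (MemLp.of_bound hχc.aestronglyMeasurable M (ae_of_all _ fun z => hM z.2))
  refine ⟨ENNReal.ofReal T⁻¹ * eLpNorm χ₁ 2 volume + eLpNorm W 2 volume, ENNReal.ofReal M,
    ENNReal.add_ne_top.2 ⟨ENNReal.mul_ne_top ENNReal.ofReal_ne_top hχ₁2.2.ne, hW2.2.ne⟩,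
    ENNReal.ofReal_ne_top, fun κ δ hκ hκs hχδ => ?_⟩
  have hκ1 : ContDiff ℝ 1 κ := hκ.of_le (by simp)
  have hκc : HasCompactSupport κ :=
    (isCompact_closedBall _ _).of_isClosed_subset (isClosed_tsupport _) hκs
  set D := moll κ R with hDdef
  have hD2 : MemLp D 2 volume := h.memLp_moll hκ1 hκc
  have hD1 : Integrable D := integrable_spaceConv (continuous_moll_kernel hκ1)
    (hasCompactSupport_moll_kernel hκc) h.meas_R h.integrable_R
  have hD0 : ∀ z : ℝ × Space3, z.1 ∉ Ioo 0 T → D z = 0 := by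
    intro z hz
    have hz' : ∀ y, R (z.1, z.2 - y) = 0 := fun y => h.zero_R _ fun h' => hz h'.1
    rw [hDdef, moll_apply]
    simp [hz']
  set r := transportCommutator κ u A R with hrdef
  have hr : Integrable r := h.integrable_transportCommutator hκ1 hκc
  have k1 : Integrable fun z => χ z.2 * ‖D z‖ :=
    integrable_bounded_smul hD1.norm hχc.aestronglyMeasurable fun z => hM z.2
  have k2 : Integrable fun z => ‖D z‖ * |W z| := hD2.norm.integrable_mul hW2.norm
  have k3 : Integrable fun z => χ z.2 * ‖r z‖ :=
    integrable_bounded_smul hr.norm hχc.aestronglyMeasurable fun z => hM z.2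
  have k1' : Integrable (fun z : ℝ × Space3 => χ z.2 * ‖D z‖) (volume.prod volume) := k1
  have hP : ENNReal.ofReal (∫ z, χ z.2 * ‖D z‖) ≤ eLpNorm χ₁ 2 volume * eLpNorm D 2 volume := by
    rw [ofReal_integral_eq_lintegral_ofReal k1
      (ae_of_all _ fun z => mul_nonneg (hχ0 _) (norm_nonneg _))]
    refine (lintegral_mono fun z => ?_).trans (lintegral_enorm_mul_enorm_le hχ₁2.1 hD2.1)
    rw [ENNReal.ofReal_mul (hχ0 _), ofReal_norm]
    by_cases hz : z ∈ cyl T Ω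
    · rw [hχ₁, indicator_of_mem hz, ← ofReal_norm (χ z.2), Real.norm_of_nonneg (hχ0 _)]
    · by_cases hz1 : z.1 ∈ Ioo 0 T
      · rw [hχ.eq_zero_of_notMem fun h' => hz ⟨hz1, h'⟩]
        simp
      · simp [hD0 z hz1]
  have hJ : ENNReal.ofReal (∫ z, (‖D z‖ * |W z| + χ z.2 * ‖r z‖)) ≤
      eLpNorm W 2 volume * eLpNorm D 2 volume + ENNReal.ofReal M * ∫⁻ z, ‖r z‖ₑ := by
    rw [integral_add k2 k3]
    refine ENNReal.ofReal_add_le.trans (add_le_add ?_ ?_)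
    · rw [ofReal_integral_eq_lintegral_ofReal k2
        (ae_of_all _ fun z => mul_nonneg (norm_nonneg _) (abs_nonneg _)), mul_comm]
      refine (lintegral_mono fun z => ?_).trans (lintegral_enorm_mul_enorm_le hD2.1 hW2.1)
      rw [ENNReal.ofReal_mul (norm_nonneg _), ofReal_norm, ← Real.norm_eq_abs, ofReal_norm]
    · rw [ofReal_integral_eq_lintegral_ofReal k3
        (ae_of_all _ fun z => mul_nonneg (hχ0 _) (norm_nonneg _)),
        ← lintegral_const_mul'' _ hr.1.enorm]
      refine lintegral_mono fun z => ?_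
      rw [ENNReal.ofReal_mul (hχ0 _), ofReal_norm]
      gcongr
      exact (Real.le_norm_self _).trans (hM _)
  filter_upwards [h.ae_mul_integral_norm_moll_le hT hκ hκs hχ hχ0 hχδ,
    ae_restrict_of_ae k1'.prod_right_ae] with t ht hkt
  have e1 : ∫⁻ x, ‖χ x‖ₑ * ‖D (t, x)‖ₑ = ENNReal.ofReal (∫ x, χ x * ‖D (t, x)‖) := by
    rw [ofReal_integral_eq_lintegral_ofReal hkt
      (ae_of_all _ fun z => mul_nonneg (hχ0 _) (norm_nonneg _))]
    refine lintegral_congr fun x => ?_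
    rw [ENNReal.ofReal_mul (hχ0 _), ofReal_norm, ← ofReal_norm (χ x), Real.norm_of_nonneg (hχ0 _)]
  have e2 : ∫ x, χ x * ‖D (t, x)‖ ≤ T⁻¹ * (∫ z, χ z.2 * ‖D z‖) +
      ∫ z, (‖D z‖ * |W z| + χ z.2 * ‖r z‖) := by
    have h3 := mul_le_mul_of_nonneg_left ht (inv_nonneg.2 hT.le)
    rw [inv_mul_cancel_left₀ hT.ne', mul_add, inv_mul_cancel_left₀ hT.ne'] at h3
    exact h3
  rw [e1]
  refine (ENNReal.ofReal_le_ofReal e2).trans (ENNReal.ofReal_add_le.trans ?_)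
  rw [ENNReal.ofReal_mul (inv_nonneg.2 hT.le), add_mul, add_assoc, mul_assoc]
  gcongr

/-- Apply the previous bound to κₙ − κₘ: it is small uniformly in time by convergence of Rₙ in L²
and of the commutators in L¹. Then let m → ∞. -/
theorem exists_tendsto_ae_lintegral_moll_sub_le (h : IsTransportSolution T Ω u A R) (hT : 0 < T)
    {κ : ℕ → Space3 → ℝ} {B : ℝ≥0∞} (hκ : IsMollifierSeq κ B) (hB : B ≠ ⊤)
    {χ : Space3 → ℝ} (hχ : IsTestOn Ω χ) (hχ0 : ∀ x, 0 ≤ χ x) :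
    ∃ a : ℕ → ℝ≥0∞, Tendsto a atTop (𝓝 0) ∧
      ∀ n : ℕ, (∀ x ∈ tsupport χ, Metric.closedBall x (1 / ((n : ℝ) + 1)) ⊆ Ω) →
        ∀ᵐ t ∂(volume.restrict (Ioo 0 T)),
          ∫⁻ x, ‖χ x‖ₑ * ‖moll (κ n) R (t, x) - R (t, x)‖ₑ ≤ a n := by
  obtain ⟨K, M, hK, hM, hKM⟩ := h.exists_ae_lintegral_moll_le hT hχ hχ0
  obtain ⟨h1, h2⟩ := hκ.tendsto hB h.meas_u h.memLp_u h.meas_A h.memLp_A h.limit h.meas_R h.memLp_R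
  have hκ1 : ∀ n, ContDiff ℝ 1 (κ n) := fun n => (hκ.contDiff n).of_le (by simp)
  have hκc := hκ.hasCompactSupport
  have hD : ∀ n, MemLp (moll (κ n) R) 2 volume := fun n => h.memLp_moll (hκ1 n) (hκc n)
  have hr : ∀ n, Integrable (transportCommutator (κ n) u A R) := fun n =>
    h.integrable_transportCommutator (hκ1 n) (hκc n)
  obtain ⟨ns, hns, hae⟩ := (tendstoInMeasure_of_tendsto_eLpNorm two_ne_zero (fun n => (hD n).1)
    h.memLp_R.1 h1).exists_seq_tendsto_ae
  set a : ℕ → ℝ≥0∞ := fun n => K * eLpNorm (fun z => moll (κ n) R z - R z) 2 volume +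
    M * ∫⁻ z, ‖transportCommutator (κ n) u A R z‖ₑ with ha
  have ha0 : Tendsto a atTop (𝓝 0) := by
    have := (ENNReal.Tendsto.const_mul h1 (Or.inr hK)).add
      (ENNReal.Tendsto.const_mul h2 (Or.inr hM))
    simpa using this
  refine ⟨a, ha0, fun n hn => ?_⟩
  have hpair : ∀ m, n ≤ m → ∀ᵐ t ∂(volume.restrict (Ioo 0 T)),
      ∫⁻ x, ‖χ x‖ₑ * ‖moll (κ n) R (t, x) - moll (κ m) R (t, x)‖ₑ ≤ a n + a m := by
    intro m hm
    have hrad : 1 / ((m : ℝ) + 1) ≤ 1 / ((n : ℝ) + 1) := by gcongr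
    have hs : tsupport (κ n - κ m) ⊆ Metric.closedBall 0 (1 / ((n : ℝ) + 1)) :=
      (tsupport_sub _ _).trans (union_subset (hκ.tsupport_subset n)
        ((hκ.tsupport_subset m).trans (Metric.closedBall_subset_closedBall hrad)))
    have hsub := ae_moll_sub (A := A) (hκ1 n) (hκc n) (hκ1 m) (hκc m) h.meas_u h.memLp_u h.meas_R
      h.memLp_R
    have hsubz : ∀ᵐ z : ℝ × Space3, moll (κ n - κ m) R z = moll (κ n) R z - moll (κ m) R z ∧
        transportCommutator (κ n - κ m) u A R z =
          transportCommutator (κ n) u A R z - transportCommutator (κ m) u A R z := by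
      filter_upwards [ae_of_ae_time hsub] with z hz using hz z.2
    have b1 : eLpNorm (moll (κ n - κ m) R) 2 volume ≤
        eLpNorm (fun z => moll (κ n) R z - R z) 2 volume +
          eLpNorm (fun z => moll (κ m) R z - R z) 2 volume := by
      refine le_trans (le_of_eq (eLpNorm_congr_ae ?_)) (eLpNorm_sub_le
        ((hD n).1.sub h.memLp_R.1) ((hD m).1.sub h.memLp_R.1) one_le_two)
      filter_upwards [hsubz] with z hz
      simp [hz.1]
    have b2 : ∫⁻ z, ‖transportCommutator (κ n - κ m) u A R z‖ₑ ≤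
        (∫⁻ z, ‖transportCommutator (κ n) u A R z‖ₑ) +
          ∫⁻ z, ‖transportCommutator (κ m) u A R z‖ₑ := by
      rw [← lintegral_add_left' (hr n).1.enorm]
      refine lintegral_mono_ae ?_
      filter_upwards [hsubz] with z hz
      rw [hz.2]
      exact enorm_sub_le
    filter_upwards [hKM (κ n - κ m) _ ((hκ.contDiff n).sub (hκ.contDiff m)) hs hn,
      ae_restrict_of_ae hsub] with t ht hst
    have e : ∫⁻ x, ‖χ x‖ₑ * ‖moll (κ n) R (t, x) - moll (κ m) R (t, x)‖ₑ =
        ∫⁻ x, ‖χ x‖ₑ * ‖moll (κ n - κ m) R (t, x)‖ₑ :=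
      lintegral_congr fun x => by rw [(hst x).1]
    rw [e]
    refine ht.trans ?_
    calc _ ≤ K * (eLpNorm (fun z => moll (κ n) R z - R z) 2 volume +
          eLpNorm (fun z => moll (κ m) R z - R z) 2 volume) +
          M * ((∫⁻ z, ‖transportCommutator (κ n) u A R z‖ₑ) +
          ∫⁻ z, ‖transportCommutator (κ m) u A R z‖ₑ) := by gcongr
      _ = a n + a m := by simp only [ha]; ring
  -- A single null set of times serves every m ≥ n.
  have hall := ae_all_iff.2 fun m => eventually_imp_distrib_left.2 (hpair m)
  have hae' : ∀ᵐ z ∂((volume : Measure ℝ).prod (volume : Measure Space3)),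
    Tendsto (fun i => moll (κ (ns i)) R z) atTop (𝓝 (R z)) := hae
  have hmeas : ∀ k, StronglyMeasurable (moll (κ k) R) := fun k => h.stronglyMeasurable_moll (hκ1 k)
  filter_upwards [hall, ae_restrict_of_ae (Measure.ae_ae_of_ae_prod hae')] with t ht hlim
  -- Fatou's lemma along the subsequence on which the mollifications converge a.e.; at fixed time
  -- this convergence holds for almost every x.
  have hF : ∫⁻ x, ‖χ x‖ₑ * ‖moll (κ n) R (t, x) - R (t, x)‖ₑ ≤
      liminf (fun k => ∫⁻ x, ‖χ x‖ₑ * ‖moll (κ n) R (t, x) - moll (κ (ns k)) R (t, x)‖ₑ)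
        atTop := by
    refine le_trans (le_of_eq (lintegral_congr_ae ?_)) (lintegral_liminf_le' fun k => ?_)
    · filter_upwards [hlim] with x hx
      have h3 : Tendsto (fun k => ‖χ x‖ₑ * ‖moll (κ n) R (t, x) - moll (κ (ns k)) R (t, x)‖ₑ) atTop
          (𝓝 (‖χ x‖ₑ * ‖moll (κ n) R (t, x) - R (t, x)‖ₑ)) :=
        ENNReal.Tendsto.const_mul ((tendsto_const_nhds.sub hx).enorm) (Or.inr enorm_ne_top)
      exact h3.liminf_eq.symm
    · exact (hχ.1.continuous.enorm.measurable.mul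
        (((hmeas n).sub (hmeas (ns k))).comp_measurable measurable_prodMk_left).enorm).aemeasurable
  refine hF.trans ?_
  have h4 : Tendsto (fun k => a n + a (ns k)) atTop (𝓝 (a n)) := by
    simpa using (ha0.comp hns.tendsto_atTop).const_add (a n)
  rw [← h4.liminf_eq]
  refine liminf_le_liminf ?_
  filter_upwards [eventually_ge_atTop n] with k hk
  exact ht (ns k) (hk.trans (hns.id_le k))

end IsTransportSolution

/-! ### Continuity in time with values in L¹ -/

/-- A smooth cutoff which is `1` outside a set of small measure. -/
theorem exists_isTestOn_eq_one_off_small {Ω : Set Space3} (hΩ : IsOpen Ω) (hΩv : volume Ω ≠ ⊤)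
    {ε : ℝ≥0∞} (hε : ε ≠ 0) : ∃ χ : Space3 → ℝ, IsTestOn Ω χ ∧ (∀ x, 0 ≤ χ x) ∧ (∀ x, χ x ≤ 1) ∧
      ∃ E, MeasurableSet E ∧ volume E < ε ∧ ∀ x ∈ Ω, x ∉ E → χ x = 1 := by
  -- Inner regularity: χ is 1 on a compact set K exhausting Ω up to small measure, and the
  -- exceptional set is Ω \ K.
  obtain ⟨K, hKΩ, hK, hKε⟩ := hΩ.measurableSet.exists_isCompact_sdiff_lt hΩv hε
  obtain ⟨V, hV, hKV, hVΩ, hVc⟩ := exists_open_between_and_isCompact_closure hK hΩ hKΩ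
  obtain ⟨χ, hχ, hr, hs, h1⟩ := exists_contMDiff_support_eq_eq_one_iff (modelWithCornersSelf ℝ Space3) (n := ⊤)
    hV hK.isClosed hKV
  refine ⟨χ, ⟨hχ.contDiff, ?_, ?_⟩, fun x => (hr ⟨x, rfl⟩).1, fun x => (hr ⟨x, rfl⟩).2,
    Ω \ K, hΩ.measurableSet.diff hK.measurableSet, hKε, fun x hx hxE => ?_⟩
  · rw [HasCompactSupport, tsupport, hs]
    exact hVc
  · rw [tsupport, hs]
    exact hVΩ
  · refine (h1 x).1 ?_
    by_contra h'
    exact hxE ⟨hx, h'⟩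

/-- Extension by continuity of a map that is uniformly continuous on a set of full measure. -/
theorem exists_continuousOn_Icc_extension {X : Type*} [PseudoEMetricSpace X] [CompleteSpace X]
    [T0Space X] {T : ℝ} (hT : 0 < T) {S : Set ℝ} (hS : S ⊆ Ioo 0 T)
    (hfull : ∀ᵐ t ∂(volume.restrict (Ioo 0 T)), t ∈ S) {f : ℝ → X}
    (hf : ∀ ε : ℝ≥0∞, ε ≠ 0 → ∃ δ : ℝ, 0 < δ ∧ ∀ s ∈ S, ∀ t ∈ S, |t - s| < δ →
      edist (f t) (f s) ≤ ε) :
    ∃ F : ℝ → X, ContinuousOn F (Icc 0 T) ∧ ∀ t ∈ S, F t = f t := by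
  -- A set of full measure is dense, since nonempty open sets have positive measure.
  have hcl : Icc 0 T ⊆ closure S := by
    rw [← closure_Ioo hT.ne]
    refine closure_minimal (fun t ht => ?_) isClosed_closure
    rw [mem_closure_iff]
    intro U hU htU
    by_contra hemp
    have h1 : U ∩ Ioo 0 T ⊆ {t | ¬ (t ∈ Ioo 0 T → t ∈ S)} := fun s hs h' =>
      hemp ⟨s, hs.1, h' hs.2⟩
    rw [ae_restrict_iff' measurableSet_Ioo] at hfull
    have h2 : volume (U ∩ Ioo 0 T) = 0 := measure_mono_null h1 hfull
    exact ((hU.inter isOpen_Ioo).measure_pos volume ⟨t, htU, ht⟩).ne' h2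
  have hlim : ∀ x ∈ Icc 0 T, ∃ y, Tendsto f (𝓝[S] x) (𝓝 y) := by
    intro x hx
    have : (𝓝[S] x).NeBot := mem_closure_iff_nhdsWithin_neBot.1 (hcl hx)
    have hc : Cauchy (map f (𝓝[S] x)) := by
      rw [EMetric.cauchy_iff]
      refine ⟨map_neBot.ne, fun ε hε => ?_⟩
      obtain ⟨η, hη, hηε⟩ := exists_between hε
      obtain ⟨δ, hδ, h⟩ := hf η hη.ne'
      refine ⟨f '' (Metric.ball x (δ / 2) ∩ S), image_mem_map (inter_mem
        (mem_nhdsWithin_of_mem_nhds (Metric.ball_mem_nhds x (by positivity)))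
        self_mem_nhdsWithin), ?_⟩
      rintro _ ⟨s, hs, rfl⟩ _ ⟨t, ht, rfl⟩
      refine (h t ht.2 s hs.2 ?_).trans_lt hηε
      have h1 := Metric.mem_ball.1 hs.1
      have h2 := Metric.mem_ball.1 ht.1
      have h3 := dist_triangle_right s t x
      rw [Real.dist_eq] at h3
      linarith
    exact CompleteSpace.complete hc
  have hcS : ContinuousOn f S := by
    intro x hx
    obtain ⟨y, hy⟩ := hlim x (Ioo_subset_Icc_self (hS hx))
    -- The filter of neighbourhoods within S contains the point x itself, which forces the limit to
    -- be f x.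
    have hxy : f x = y := by
      have h1 : Tendsto f (pure x) (𝓝 y) := hy.mono_left (pure_le_nhdsWithin hx)
      exact tendsto_nhds_unique (tendsto_pure_nhds f x) h1
    rw [ContinuousWithinAt, hxy]
    exact hy
  exact ⟨extendFrom S f, continuousOn_extendFrom hcl hlim, extendFrom_extends hcS⟩

namespace IsTransportSolution

section Modulus

variable {E : Type*} [NormedAddCommGroup E] [NormedSpace ℝ E] [CompleteSpace E] {T : ℝ}
  {Ω : Set Space3} {u : ℝ × Space3 → Space3} {A : ℝ × Space3 → Space3 →L[ℝ] Space3}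
  {R : ℝ × Space3 → E} {κ : Space3 → ℝ} {δ : ℝ}

/-- Mollified solutions are uniformly continuous in time. -/
theorem exists_modulus_moll (h : IsTransportSolution T Ω u A R) (hT : 0 < T)
    (hκ : ContDiff ℝ ∞ κ) (hκs : tsupport κ ⊆ Metric.closedBall 0 δ) :
    ∃ Q : ℝ → ℝ, Continuous Q ∧ ∃ S : Set ℝ, (∀ᵐ t ∂(volume.restrict (Ioo 0 T)), t ∈ S) ∧
      ∀ s ∈ S, ∀ t ∈ S, ∀ x, Metric.closedBall x δ ⊆ Ω →
        ‖moll κ R (t, x) - moll κ R (s, x)‖ ≤ |Q t - Q s| := by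
  have hκ1 : ContDiff ℝ 1 κ := hκ.of_le (by simp)
  have hκc : HasCompactSupport κ :=
    (isCompact_closedBall _ _).of_isClosed_subset (isClosed_tsupport _) hκs
  obtain ⟨C, hC⟩ := (hκ1.continuous_fderiv one_ne_zero).bounded_above_of_compact_support
    (hκc.fderiv (𝕜 := ℝ))
  have hC0 : 0 ≤ C := (norm_nonneg _).trans (hC 0)
  set q : ℝ → ℝ := fun t => C * ∫ y, ‖u (t, y)‖ * ‖R (t, y)‖ with hq
  have hqi : Integrable q := by
    have h1 := h.integrable_norm_mul
    rw [Measure.volume_eq_prod] at h1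
    exact h1.integral_prod_left.const_mul C
  have hq0 : ∀ t, 0 ≤ q t := fun t => mul_nonneg hC0
    (integral_nonneg fun y => mul_nonneg (norm_nonneg _) (norm_nonneg _))
  -- For each x the primitive formula fails on a null set of times depending on x. A countable dense
  -- set of points gives one null set.
  obtain ⟨D, hDs, hDc, hDd⟩ := (TopologicalSpace.IsSeparable.of_separableSpace
    {x : Space3 | Metric.closedBall x δ ⊆ Ω}).exists_countable_dense_subset
  have hprim : ∀ x : Space3, Metric.closedBall x δ ⊆ Ω → ∃ c : E,
      ∀ᵐ t ∂(volume.restrict (Ioo 0 T)), moll κ R (t, x) =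
        c + ∫ s in 0..t, -mollFlux κ u R (s, x) := by
    intro x hx
    refine ae_eq_add_primitive_of_weak_deriv hT (h.integrable_moll_time hκ1 hκc x).integrableOn
      (h.integrable_mollFlux_time hκ1 hκc x).neg fun θ hθ => ?_
    rw [setIntegral_eq_integral_of_forall_compl_eq_zero]
    · exact h.integral_deriv_smul_moll hκ hκs hx hθ
    · intro t ht
      rw [hθ.eq_zero_of_notMem ht, ← fderiv_apply_one_eq_deriv, hθ.fderiv_eq_zero_of_notMem ht]
      simp
  choose! c hc using hprim
  refine ⟨fun t => ∫ s in 0..t, q s, continuous_intervalIntegral_of_integrable hqi 0,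
    {t | MemLp (fun x => R (t, x)) 2 volume ∧ ∀ x ∈ D, moll κ R (t, x) =
        c x + ∫ s in 0..t, -mollFlux κ u R (s, x)}, ?_, ?_⟩
  · filter_upwards [ae_restrict_of_ae h.ae_slice,
      (ae_ball_iff hDc).2 fun x hx => hc x (hDs hx)] with t ht hcx
    exact ⟨ht.2.2.1, hcx⟩
  · intro s hs t ht x hx
    -- Mollifications are continuous in x at the selected times while the bound does not depend on
    -- x, so the inequality extends from the dense set.
    have hclosed : IsClosed {x | ‖moll κ R (t, x) - moll κ R (s, x)‖ ≤
        |(∫ r in 0..t, q r) - ∫ r in 0..s, q r|} :=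
      isClosed_le ((contDiff_moll_slice hκ1 hκc ht.1).continuous.sub
        (contDiff_moll_slice hκ1 hκc hs.1).continuous).norm continuous_const
    refine closure_minimal (fun y hy => ?_) hclosed (hDd hx)
    have hFi := (h.integrable_mollFlux_time (u := u) hκ1 hκc y).neg
    have e1 : moll κ R (t, y) - moll κ R (s, y) = ∫ r in s..t, -mollFlux κ u R (r, y) := by
      rw [ht.2 y hy, hs.2 y hy, add_sub_add_left_eq_sub,
        intervalIntegral.integral_interval_sub_left] <;> exact hFi.intervalIntegrable
    have e2 : (∫ r in 0..t, q r) - ∫ r in 0..s, q r = ∫ r in s..t, q r := by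
      rw [intervalIntegral.integral_interval_sub_left] <;> exact hqi.intervalIntegrable
    rw [mem_ofPred_eq, e1, e2]
    refine intervalIntegral.norm_integral_le_abs_of_norm_le ?_ hqi.intervalIntegrable
    refine ae_restrict_of_ae ?_
    filter_upwards [h.ae_slice] with r hr
    rw [norm_neg]
    exact norm_mollFlux_le hC hr.1 hr.2.2.1 y

end Modulus

end IsTransportSolution

/-- Hölder's inequality; for γ > 1 the exponent is positive, so an L^γ bound gives
equi-integrability. -/
theorem lintegral_enorm_restrict_le {E : Type*} [NormedAddCommGroup E] {f : Space3 → E} {γ : ℝ}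
    (hγ : 1 ≤ γ) (hf : AEStronglyMeasurable f volume) (B : Set Space3) :
    ∫⁻ x in B, ‖f x‖ₑ ≤ eLpNorm f (ENNReal.ofReal γ) volume * volume B ^ (1 - γ⁻¹) := by
  have h1 : (1 : ℝ≥0∞) ≤ ENNReal.ofReal γ := by simpa using ENNReal.ofReal_le_ofReal hγ
  have h2 := eLpNorm_le_eLpNorm_mul_rpow_measure_univ h1 (hf.restrict (s := B))
  rw [eLpNorm_one_eq_lintegral_enorm, ENNReal.toReal_one, ENNReal.toReal_ofReal (by linarith),
    Measure.restrict_apply_univ, div_one, one_div] at h2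
  exact h2.trans (mul_le_mul_left (eLpNorm_restrict_le _ _ _ _) _)

/-- Splitting an `L¹` distance with a cutoff and a reference. -/
theorem lintegral_enorm_sub_le_of_cutoff {E : Type*} [NormedAddCommGroup E] {Ω B : Set Space3}
    (hB : MeasurableSet B) {χ : Space3 → ℝ} (hχm : Measurable χ)
    (hχ : ∀ x ∈ Ω, x ∉ B → χ x = 1) {f g F G : Space3 → E} (hf : AEStronglyMeasurable f volume)
    (hg : AEStronglyMeasurable g volume) (hF : AEStronglyMeasurable F volume)
    (hG : AEStronglyMeasurable G volume) (hf0 : ∀ x ∉ Ω, f x = 0) (hg0 : ∀ x ∉ Ω, g x = 0) :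
    ∫⁻ x, ‖f x - g x‖ₑ ≤ (∫⁻ x, ‖χ x‖ₑ * ‖F x - f x‖ₑ) + (∫⁻ x, ‖χ x‖ₑ * ‖G x - g x‖ₑ) +
      (∫⁻ x, ‖χ x‖ₑ * ‖F x - G x‖ₑ) + (∫⁻ x in B, ‖f x‖ₑ) + ∫⁻ x in B, ‖g x‖ₑ := by
  have m1 : AEMeasurable (fun x => ‖χ x‖ₑ * ‖F x - f x‖ₑ) volume :=
    hχm.enorm.aemeasurable.mul (hF.sub hf).enorm
  have m2 : AEMeasurable (fun x => ‖χ x‖ₑ * ‖G x - g x‖ₑ) volume :=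
    hχm.enorm.aemeasurable.mul (hG.sub hg).enorm
  have m3 : AEMeasurable (fun x => ‖χ x‖ₑ * ‖F x - G x‖ₑ) volume :=
    hχm.enorm.aemeasurable.mul (hF.sub hG).enorm
  have m4 : AEMeasurable (fun x => ‖χ x‖ₑ * ‖F x - f x‖ₑ + ‖χ x‖ₑ * ‖G x - g x‖ₑ) volume :=
    m1.add m2
  have m5 : AEMeasurable (fun x => ‖χ x‖ₑ * ‖F x - f x‖ₑ + ‖χ x‖ₑ * ‖G x - g x‖ₑ +
    ‖χ x‖ₑ * ‖F x - G x‖ₑ) volume := m4.add m3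
  have m6 : AEMeasurable (fun x => ‖χ x‖ₑ * ‖F x - f x‖ₑ + ‖χ x‖ₑ * ‖G x - g x‖ₑ +
    ‖χ x‖ₑ * ‖F x - G x‖ₑ + B.indicator (fun x => ‖f x‖ₑ) x) volume :=
    m5.add (hf.enorm.indicator hB)
  rw [← lintegral_indicator hB, ← lintegral_indicator hB, ← lintegral_add_left' m1,
    ← lintegral_add_left' m4, ← lintegral_add_left' m5, ← lintegral_add_left' m6]
  refine lintegral_mono fun x => ?_
  by_cases hx : x ∈ Ω
  · by_cases hxB : x ∈ B
    · rw [indicator_of_mem hxB, indicator_of_mem hxB]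
      refine enorm_sub_le.trans ?_
      rw [add_assoc]
      exact le_add_self
    · rw [hχ x hx hxB, indicator_of_notMem hxB, indicator_of_notMem hxB, enorm_one]
      simp only [one_mul, add_zero]
      have e : f x - g x = -(F x - f x) + (G x - g x) + (F x - G x) := by abel
      rw [e]
      refine (enorm_add_le _ _).trans (add_le_add ((enorm_add_le _ _).trans ?_) le_rfl)
      rw [enorm_neg]
  · rw [hf0 x hx, hg0 x hx, sub_self, enorm_zero]
    exact zero_le

namespace IsTransportSolution

variable {E : Type*} [NormedAddCommGroup E] [InnerProductSpace ℝ E] [CompleteSpace E] {T : ℝ}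
  {Ω : Set Space3} {u : ℝ × Space3 → Space3} {A : ℝ × Space3 → Space3 →L[ℝ] Space3}
  {R : ℝ × Space3 → E}

/-- Five contributions: the mollification error at each of the two times, the increment of the
mollified function between them, and the mass of R at each time on a set of small measure where the
cutoff is not 1. The cutoff is chosen first through the L^γ bound, then the mollifier, then δ. -/
theorem exists_uniform_modulus (h : IsTransportSolution T Ω u A R) (hT : 0 < T) {γ : ℝ}
    (hγ : 1 < γ) {C : NNReal} (hC : ∀ᵐ t ∂(volume.restrict (Ioo 0 T)),
      eLpNorm (fun x => R (t, x)) (ENNReal.ofReal γ) volume ≤ C) :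
    ∃ S : Set ℝ, S ⊆ Ioo 0 T ∧ (∀ᵐ t ∂(volume.restrict (Ioo 0 T)), t ∈ S) ∧
      (∀ t ∈ S, Integrable fun x => R (t, x)) ∧
      ∀ ε : ℝ≥0∞, ε ≠ 0 → ∃ δ : ℝ, 0 < δ ∧ ∀ s ∈ S, ∀ t ∈ S, |t - s| < δ →
        ∫⁻ x, ‖R (t, x) - R (s, x)‖ₑ ≤ ε := by
  obtain ⟨κ, B, hB, hκ⟩ := exists_isMollifierSeq
  have hκ1 : ∀ n, ContDiff ℝ 1 (κ n) := fun n => (hκ.contDiff n).of_le (by simp)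
  have hmeas : ∀ n, StronglyMeasurable (moll (κ n) R) := fun n => h.stronglyMeasurable_moll (hκ1 n)
  have hcut : ∀ j : ℕ, ∃ χ : Space3 → ℝ, IsTestOn Ω χ ∧ (∀ x, 0 ≤ χ x) ∧ (∀ x, χ x ≤ 1) ∧
      ∃ E, MeasurableSet E ∧ volume E < ENNReal.ofReal (1 / ((j : ℝ) + 1)) ∧
        ∀ x ∈ Ω, x ∉ E → χ x = 1 := fun j =>
    exists_isTestOn_eq_one_off_small h.isOpen h.isBounded.measure_lt_top.ne
      (ENNReal.ofReal_pos.2 Nat.one_div_pos_of_nat).ne'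
  choose χ hχ hχ0 hχ1 G hGm hG hχG using hcut
  choose a ha hab using fun j => h.exists_tendsto_ae_lintegral_moll_sub_le hT hκ hB (hχ j) (hχ0 j)
  choose Q hQ S₁ hS₁ hmod using fun n => h.exists_modulus_moll hT (hκ.contDiff n)
    (hκ.tsupport_subset n)
  -- The good times: all countably many almost-everywhere estimates hold there simultaneously.
  set S : Set ℝ := {t | t ∈ Ioo 0 T ∧ (∀ j n : ℕ, (∀ x ∈ tsupport (χ j),
      Metric.closedBall x (1 / ((n : ℝ) + 1)) ⊆ Ω) →
      ∫⁻ x, ‖χ j x‖ₑ * ‖moll (κ n) R (t, x) - R (t, x)‖ₑ ≤ a j n) ∧ (∀ n, t ∈ S₁ n) ∧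
      eLpNorm (fun x => R (t, x)) (ENNReal.ofReal γ) volume ≤ C ∧
      Integrable fun x => R (t, x)} with hS
  refine ⟨S, fun t ht => ht.1, ?_, fun t ht => ht.2.2.2.2, fun ε hε => ?_⟩
  · filter_upwards [ae_restrict_mem measurableSet_Ioo, hC, ae_restrict_of_ae h.ae_slice,
      ae_all_iff.2 hS₁, ae_all_iff.2 fun j => ae_all_iff.2 fun n =>
      eventually_imp_distrib_left.2 (hab j n)] with t h1 h2 h3 h4 h5
    exact ⟨h1, h5, h4, h2, h3.2.2.2⟩
  set η : ℝ≥0∞ := ε / 5 with hη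
  have hη0 : 0 < η := ENNReal.div_pos hε (by norm_num)
  have hexp : 0 < 1 - γ⁻¹ := by
    have := inv_lt_one_of_one_lt₀ hγ
    linarith
  have hrad : Tendsto (fun n : ℕ => 1 / ((n : ℝ) + 1)) atTop (𝓝 0) :=
    tendsto_one_div_add_atTop_nhds_zero_nat
  obtain ⟨j, hj⟩ : ∃ j : ℕ, (C : ℝ≥0∞) * ENNReal.ofReal (1 / ((j : ℝ) + 1)) ^ (1 - γ⁻¹) < η := by
    have t1 : Tendsto (fun j : ℕ => (C : ℝ≥0∞) * ENNReal.ofReal (1 / ((j : ℝ) + 1)) ^ (1 - γ⁻¹))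
        atTop (𝓝 0) := by
      have t2 := (ENNReal.continuous_rpow_const (y := 1 - γ⁻¹)).tendsto 0
      have t3 : Tendsto (fun j : ℕ => ENNReal.ofReal (1 / ((j : ℝ) + 1))) atTop (𝓝 0) := by
        simpa using ENNReal.tendsto_ofReal hrad
      have t4 := ENNReal.Tendsto.const_mul (a := C) (t2.comp t3) (Or.inr ENNReal.coe_ne_top)
      simpa [ENNReal.zero_rpow_of_pos hexp] using t4
    exact (t1.eventually (gt_mem_nhds hη0)).exists
  obtain ⟨r, hr, hrΩ⟩ := (hχ j).2.1.isCompact.exists_cthickening_subset_open h.isOpen (hχ j).2.2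
  obtain ⟨n, hn, hnr⟩ := (((ha j).eventually (gt_mem_nhds hη0)).and
    (hrad.eventually (gt_mem_nhds hr))).exists
  have hsupp : ∀ x ∈ tsupport (χ j), Metric.closedBall x (1 / ((n : ℝ) + 1)) ⊆ Ω := fun x hx =>
    (Metric.closedBall_subset_closedBall hnr.le).trans
      ((Metric.closedBall_subset_cthickening hx r).trans hrΩ)
  have hχi : ∫⁻ x, ‖χ j x‖ₑ ≠ ⊤ :=
    ((hχ j).1.continuous.integrable_of_hasCompactSupport (hχ j).2.1).2.ne
  obtain ⟨ζ, hζ, hζη⟩ : ∃ ζ : ℝ, 0 < ζ ∧ ENNReal.ofReal ζ * ∫⁻ x, ‖χ j x‖ₑ < η := by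
    have t1 : Tendsto (fun m : ℕ => ENNReal.ofReal (1 / ((m : ℝ) + 1)) * ∫⁻ x, ‖χ j x‖ₑ)
        atTop (𝓝 0) := by
      have t3 : Tendsto (fun j : ℕ => ENNReal.ofReal (1 / ((j : ℝ) + 1))) atTop (𝓝 0) := by
        simpa using ENNReal.tendsto_ofReal hrad
      simpa using ENNReal.Tendsto.mul_const t3 (Or.inr hχi)
    obtain ⟨m, hm⟩ := (t1.eventually (gt_mem_nhds hη0)).exists
    exact ⟨_, Nat.one_div_pos_of_nat, hm⟩
  obtain ⟨δ, hδ, hδζ⟩ := Metric.uniformContinuousOn_iff.1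
    (isCompact_Icc.uniformContinuousOn_of_continuous (hQ n).continuousOn (s := Icc 0 T)) ζ hζ
  refine ⟨δ, hδ, fun s hs t ht hst => ?_⟩
  have hR0 : ∀ τ, ∀ x ∉ Ω, R (τ, x) = 0 := fun τ x hx => h.zero_R _ fun h' => hx h'.2
  have hmod' : ∀ x, ‖χ j x‖ₑ * ‖moll (κ n) R (t, x) - moll (κ n) R (s, x)‖ₑ ≤
      ENNReal.ofReal ζ * ‖χ j x‖ₑ := by
    intro x
    by_cases hx : x ∈ tsupport (χ j)
    · rw [mul_comm]
      gcongr
      rw [← ofReal_norm]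
      refine ENNReal.ofReal_le_ofReal ((hmod n s (hs.2.2.1 n) t (ht.2.2.1 n) x (hsupp x hx)).trans ?_)
      have := hδζ t (Ioo_subset_Icc_self ht.1) s (Ioo_subset_Icc_self hs.1) hst
      exact this.le
    · rw [image_eq_zero_of_notMem_tsupport hx]
      simp
  have hsm : ∀ {τ}, τ ∈ S → ∫⁻ x in G j, ‖R (τ, x)‖ₑ ≤ η := fun {τ} hτ => by
    refine (lintegral_enorm_restrict_le hγ.le hτ.2.2.2.2.1 (G j)).trans (le_trans ?_ hj.le)
    gcongr
    · exact hτ.2.2.2.1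
    · exact (hG j).le
  refine (lintegral_enorm_sub_le_of_cutoff (hGm j)
    (hχ j).1.continuous.measurable (hχG j) (F := fun x => moll (κ n) R (t, x))
    (G := fun x => moll (κ n) R (s, x)) ht.2.2.2.2.1 hs.2.2.2.2.1
    ((hmeas n).comp_measurable measurable_prodMk_left).aestronglyMeasurable
    ((hmeas n).comp_measurable measurable_prodMk_left).aestronglyMeasurable
    (hR0 t) (hR0 s)).trans ?_
  have b3 : ∫⁻ x, ‖χ j x‖ₑ * ‖moll (κ n) R (t, x) - moll (κ n) R (s, x)‖ₑ ≤ η := by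
    refine (lintegral_mono hmod').trans ?_
    rw [lintegral_const_mul _ (hχ j).1.continuous.measurable.enorm]
    exact hζη.le
  calc _ ≤ η + η + η + η + η := by
        gcongr
        · exact (ht.2.1 j n hsupp).trans hn.le
        · exact (hs.2.1 j n hsupp).trans hn.le
        · exact hsm ht
        · exact hsm hs
    _ = 5 * η := by ring
    _ ≤ ε := ENNReal.mul_div_le

/-- Solutions in `L^∞(0,T;L^γ)` are continuous in time with values in `L¹`. -/
theorem exists_continuousOn_representative (h : IsTransportSolution T Ω u A R) (hT : 0 < T) {γ : ℝ}
    (hγ : 1 < γ) {C : NNReal} (hC : ∀ᵐ t ∂(volume.restrict (Ioo 0 T)),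
      eLpNorm (fun x => R (t, x)) (ENNReal.ofReal γ) volume ≤ C) :
    ∃ Rc : ℝ → Lp E 1 (volume.restrict Ω), ContinuousOn Rc (Icc 0 T) ∧
      ∀ᵐ t ∂(volume.restrict (Ioo 0 T)), Rc t =ᵐ[volume.restrict Ω] fun x => R (t, x) := by
  obtain ⟨S, hST, hfull, hint, hunif⟩ := h.exists_uniform_modulus hT hγ hC
  have hmem : ∀ t ∈ S, MemLp (fun x => R (t, x)) 1 (volume.restrict Ω) := fun t ht =>
    memLp_one_iff_integrable.2 (hint t ht).integrableOn
  classical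
  obtain ⟨F, hF, hFS⟩ := exists_continuousOn_Icc_extension hT hST hfull
    (f := fun t => if ht : t ∈ S then (hmem t ht).toLp _ else 0) (fun ε hε => by
      obtain ⟨δ, hδ, hb⟩ := hunif ε hε
      refine ⟨δ, hδ, fun s hs t ht hst => ?_⟩
      simp only [dif_pos hs, dif_pos ht]
      rw [Lp.edist_toLp_toLp, eLpNorm_one_eq_lintegral_enorm]
      exact (setLIntegral_le_lintegral _ _).trans (hb s hs t ht hst))
  refine ⟨F, hF, hfull.mono fun t ht => ?_⟩
  rw [hFS t ht, dif_pos ht]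
  exact (hmem t ht).coeFn_toLp

end IsTransportSolution

/-! ### Cutoffs adapted to the velocity -/

theorem exists_bound_deriv_smoothTransition :
    ∃ C : ℝ, 0 ≤ C ∧ (∀ t, |deriv Real.smoothTransition t| ≤ C) ∧
      ∀ t, 1 < t → deriv Real.smoothTransition t = 0 := by
  have h1 : ∀ t, 1 < t → deriv Real.smoothTransition t = 0 := fun t ht => by
    have : Real.smoothTransition =ᶠ[𝓝 t] fun _ => 1 := by
      filter_upwards [lt_mem_nhds ht] with s hs using Real.smoothTransition.one_of_one_le hs.le
    rw [this.deriv_eq, deriv_const]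
  have h0 : ∀ t, t < 0 → deriv Real.smoothTransition t = 0 := fun t ht => by
    have : Real.smoothTransition =ᶠ[𝓝 t] fun _ => 0 := by
      filter_upwards [gt_mem_nhds ht] with s hs using Real.smoothTransition.zero_of_nonpos hs.le
    rw [this.deriv_eq, deriv_const]
  have hc : HasCompactSupport (deriv Real.smoothTransition) :=
    HasCompactSupport.intro (isCompact_Icc (a := (0 : ℝ)) (b := 1)) fun t ht => by
      by_cases h : t < 0
      · exact h0 t h
      · exact h1 t (not_le.1 fun h' => ht ⟨not_lt.1 h, h'⟩)
  obtain ⟨C, hC⟩ := ((Real.smoothTransition.contDiff (n := 1)).continuous_deriv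
    le_rfl).bounded_above_of_compact_support hc
  exact ⟨C, (norm_nonneg _).trans (hC 0), hC, h1⟩

/-- Cutoff functions built from a smooth function `S` whose gradient is controlled by `√S`. -/
theorem exists_cutoff_of_sq : ∃ C : ℝ, 0 ≤ C ∧ ∀ (m : ℝ) (S g : Space3 → ℝ), 0 < m →
    ContDiff ℝ ∞ S → (∀ x, 0 ≤ S x) → (∀ x, 0 ≤ g x) →
    (∀ x, ‖fderiv ℝ S x‖ ≤ 2 * Real.sqrt (S x) * g x) →
    ∃ χ : Space3 → ℝ, ContDiff ℝ ∞ χ ∧ (∀ x, 0 ≤ χ x) ∧ (∀ x, χ x ≤ 1) ∧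
      (∀ x, 1 ≤ m ^ 2 * S x → χ x = 1) ∧ (∀ x, χ x ≠ 0 → 1 / 2 ≤ m ^ 2 * S x) ∧
      (∀ x, 1 < m ^ 2 * S x → fderiv ℝ χ x = 0) ∧ ∀ x, ‖fderiv ℝ χ x‖ ≤ C * g x * m := by
  obtain ⟨C, hC0, hC, hC1⟩ := exists_bound_deriv_smoothTransition
  refine ⟨4 * C, by positivity, fun m S g hm hS hS0 hg0 hSg => ?_⟩
  have hσ : ContDiff ℝ ∞ Real.smoothTransition := Real.smoothTransition.contDiff (n := ⊤)
  have hder : ∀ x, fderiv ℝ (fun x => Real.smoothTransition (2 * (m ^ 2 * S x) - 1)) x =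
      deriv Real.smoothTransition (2 * (m ^ 2 * S x) - 1) • (2 : ℝ) • (m ^ 2) • fderiv ℝ S x := by
    intro x
    have h1 := (hS.differentiable (by simp) x).hasFDerivAt
    have h2 := ((h1.const_mul (m ^ 2)).const_mul 2).sub_const 1
    exact ((hσ.differentiable (by simp) _).hasDerivAt.comp_hasFDerivAt x h2).fderiv
  have hz : ∀ x, 1 < m ^ 2 * S x →
      fderiv ℝ (fun x => Real.smoothTransition (2 * (m ^ 2 * S x) - 1)) x = 0 := fun x hx => by
    rw [hder, hC1 _ (by linarith), zero_smul]
  -- The argument 2m²S − 1 runs through the unit interval as m²S goes from 1/2 to 1.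
  refine ⟨fun x => Real.smoothTransition (2 * (m ^ 2 * S x) - 1),
    hσ.comp ((contDiff_const.mul (contDiff_const.mul hS)).sub contDiff_const),
    fun x => Real.smoothTransition.nonneg _, fun x => Real.smoothTransition.le_one _,
    fun x hx => Real.smoothTransition.one_of_one_le (by linarith), fun x hx => ?_, hz,
    fun x => ?_⟩
  · by_contra h'
    exact hx (Real.smoothTransition.zero_of_nonpos (by linarith))
  · by_cases hx : 1 < m ^ 2 * S x
    · rw [hz x hx, norm_zero]
      have := hg0 x
      positivity
    -- The chain rule gives m²√S g; where the gradient can be nonzero, m√S ≤ 1 absorbs one factor m.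
    · have hms : m * Real.sqrt (S x) ≤ 1 := by
        have h1 : Real.sqrt (m ^ 2 * S x) ≤ 1 := Real.sqrt_le_one.2 (not_lt.1 hx)
        rwa [Real.sqrt_mul (by positivity), Real.sqrt_sq hm.le] at h1
      rw [hder, norm_smul, norm_smul, norm_smul, Real.norm_eq_abs, Real.norm_of_nonneg (by positivity),
        Real.norm_of_nonneg (by positivity)]
      have := hg0 x
      calc _ ≤ C * (2 * (m ^ 2 * (2 * Real.sqrt (S x) * g x))) := by
            gcongr
            · exact hC _
            · exact hSg x
        _ = 4 * C * g x * m * (m * Real.sqrt (S x)) := by ring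
        _ ≤ 4 * C * g x * m * 1 := by gcongr
        _ = _ := mul_one _

/-- Cauchy–Schwarz in the sum. It supplies the control of ∇S by √S that the cutoff construction
requires. -/
theorem norm_fderiv_weighted_sum_le {ι : Type*} (s : Finset ι) {w : ι → ℝ} (hw : ∀ j, 0 ≤ w j)
    {e : ι → Space3 → Space3} (he : ∀ j, ContDiff ℝ ∞ (e j)) (x : Space3) :
    ‖fderiv ℝ (fun x => ∑ j ∈ s, w j * ‖e j x‖ ^ 2) x‖ ≤
      2 * Real.sqrt (∑ j ∈ s, w j * ‖e j x‖ ^ 2) *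
        Real.sqrt (∑ j ∈ s, w j * ‖fderiv ℝ (e j) x‖ ^ 2) := by
  have h1 : ∀ j ∈ s, HasFDerivAt (fun x => w j * ‖e j x‖ ^ 2)
      (w j • 2 • (innerSL ℝ (e j x)).comp (fderiv ℝ (e j) x)) x := fun j _ =>
    (((he j).differentiable (by simp) x).hasFDerivAt.norm_sq).const_mul (w j)
  rw [(HasFDerivAt.fun_sum h1).fderiv]
  refine (norm_sum_le _ _).trans ?_
  have h2 := Real.sum_mul_le_sqrt_mul_sqrt s (fun j => Real.sqrt (w j) * ‖e j x‖)
    fun j => Real.sqrt (w j) * ‖fderiv ℝ (e j) x‖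
  simp only [mul_pow, Real.sq_sqrt (hw _)] at h2
  rw [mul_assoc]
  refine le_trans ?_ (mul_le_mul_of_nonneg_left h2 zero_le_two)
  rw [Finset.mul_sum]
  refine Finset.sum_le_sum fun j _ => ?_
  rw [norm_smul, Real.norm_of_nonneg (hw j), ← Nat.cast_smul_eq_nsmul ℝ, norm_smul]
  have h3 := (innerSL ℝ (e j x)).opNorm_comp_le (fderiv ℝ (e j) x)
  rw [innerSL_apply_norm] at h3
  have h4 := Real.mul_self_sqrt (hw j)
  calc w j * (‖((2 : ℕ) : ℝ)‖ * ‖(innerSL ℝ (e j x)).comp (fderiv ℝ (e j) x)‖)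
      ≤ w j * (2 * (‖e j x‖ * ‖fderiv ℝ (e j) x‖)) := by
        have := hw j
        gcongr
        simp
    _ = (Real.sqrt (w j) * Real.sqrt (w j)) * (2 * (‖e j x‖ * ‖fderiv ℝ (e j) x‖)) := by rw [h4]
    _ = _ := by ring

/-- The weights of the values of a bounded index function. -/
noncomputable def indexWeight (I : Set ℝ) (k : ℝ → ℕ) (j : ℕ) : ℝ :=
  if j = 0 then 1 else (volume (I ∩ k ⁻¹' {j})).toReal

theorem indexWeight_nonneg (I : Set ℝ) (k : ℝ → ℕ) (j : ℕ) : 0 ≤ indexWeight I k j := by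
  rw [indexWeight]
  split_ifs <;> positivity

/-- Grouping times by the value of k turns the integral of b(k t) into a finite sum. The index 0
contributes nothing to the integral, so its slot, with weight one, is free to carry an unrelated
term a 0. -/
theorem ofReal_sum_indexWeight {I : Set ℝ} (hIv : volume I ≠ ⊤)
    {k : ℝ → ℕ} (hk : Measurable k) {N : ℕ} (hN : ∀ t, k t ≤ N) {a b : ℕ → ℝ}
    (ha : ∀ j, 0 ≤ a j) (hab : ∀ j, a (j + 1) = b (j + 1)) (hb : b 0 = 0) :
    ENNReal.ofReal (∑ j ∈ Finset.range (N + 1), indexWeight I k j * a j) =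
      ENNReal.ofReal (a 0) + ∫⁻ t in I, ENNReal.ofReal (b (k t)) := by
  have hw : ∀ j, 0 ≤ indexWeight I k j * a j := fun j =>
    mul_nonneg (indexWeight_nonneg I k j) (ha j)
  have hsum : ∀ t, ENNReal.ofReal (b (k t)) = ∑ j ∈ Finset.range (N + 1),
      (k ⁻¹' {j}).indicator (fun _ => ENNReal.ofReal (b j)) t := by
    intro t
    rw [Finset.sum_eq_single (k t)]
    · simp
    · intro j _ hj
      exact indicator_of_notMem (s := k ⁻¹' {j}) (fun h' => hj (Eq.symm h')) _
    · intro h'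
      exact absurd (Finset.mem_range.2 (Nat.lt_succ_of_le (hN t))) h'
  simp_rw [hsum]
  rw [lintegral_finsetSum _ fun j _ => measurable_const.indicator (hk (measurableSet_singleton j)),
    ENNReal.ofReal_sum_of_nonneg fun j _ => hw j, Finset.sum_range_succ', Finset.sum_range_succ',
    add_comm]
  congr 1
  · simp [indexWeight]
  · rw [hb, ENNReal.ofReal_zero]
    simp only [indicator_zero, lintegral_zero, add_zero]
    refine Finset.sum_congr rfl fun j _ => ?_
    rw [lintegral_indicator_const (hk (measurableSet_singleton _)),
      Measure.restrict_apply (hk (measurableSet_singleton _)), hab, indexWeight,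
      if_neg j.succ_ne_zero, ENNReal.ofReal_mul ENNReal.toReal_nonneg, mul_comm, inter_comm I,
      ENNReal.ofReal_toReal (measure_ne_top_of_subset inter_subset_right hIv)]

theorem lintegral_time_restrict {f : ℝ × Space3 → ℝ≥0∞} (hf : Measurable f) (I : Set ℝ)
    (P : Set Space3) :
    ∫⁻ z in I ×ˢ P, f z = ∫⁻ x in P, ∫⁻ t in I, f (t, x) := by
  rw [Measure.volume_eq_prod, ← Measure.prod_restrict, lintegral_prod_symm _ hf.aemeasurable]

namespace IsTransportSolution

variable {E : Type*} [NormedAddCommGroup E] [NormedSpace ℝ E] {T : ℝ}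
  {Ω : Set Space3} {u : ℝ × Space3 → Space3} {A : ℝ × Space3 → Space3 →L[ℝ] Space3}
  {R : ℝ × Space3 → E}

/-- Cutoff functions adapted to a velocity in `L²(0,T;H¹₀)`, at a fixed scale. -/
theorem exists_cutoff_step (h : IsTransportSolution T Ω u A R) {ρ : Space3 → ℝ}
    (hρ : ContDiff ℝ ∞ ρ) (hρs : Function.support ρ = Ω) :
    ∃ K : ℝ≥0∞, K ≠ ⊤ ∧ ∀ m : ℝ, 0 < m → ∃ χ : Space3 → ℝ, IsTestOn Ω χ ∧ (∀ x, 0 ≤ χ x) ∧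
      (∀ x, χ x ≤ 1) ∧ (∀ x, 1 ≤ m ^ 2 * ρ x ^ 2 → χ x = 1) ∧
      ∫⁻ z, ‖fderiv ℝ χ z.2 (u z)‖ₑ ≤ K * (ENNReal.ofReal (1 / m) +
        volume {x | x ∈ Ω ∧ m ^ 2 * ρ x ^ 2 ≤ 1} ^ (1 / 2 : ℝ)) := by
  obtain ⟨C, hC0, hC⟩ := exists_cutoff_of_sq
  obtain ⟨d, k, hd, hd0, hk, hkN, hk0, hlim, hlim'⟩ :=
    exists_simple_approx h.meas_u h.meas_A h.memLp_u h.memLp_A h.limit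
  set v₀ : Space3 := EuclideanSpace.single 0 1 with hv₀
  have hv₀n : ‖v₀‖ = 1 := by simp [hv₀]
  -- Slot 0 holds ρ times a unit vector, so that S ≥ ρ², which is positive on Ω.
  set e : ℕ → Space3 → Space3 := fun j => if j = 0 then fun x => ρ x • v₀ else d j with he
  have hed : ∀ j, ContDiff ℝ ∞ (e j) := by
    intro j
    simp only [he]
    split_ifs
    · exact hρ.smul contDiff_const
    · exact (hd j).1
  have hI : volume (Ioo 0 T) ≠ ⊤ := measure_Ioo_lt_top.ne
  have hΩm : MeasurableSet Ω := h.isOpen.measurableSet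
  set K₀ : ℝ≥0∞ := ENNReal.ofReal C ^ 2 * (ENNReal.ofReal T *
    ((∫⁻ x in Ω, ‖fderiv ℝ (e 0) x‖ₑ ^ 2) + (eLpNorm A 2 volume + 1) ^ 2)) with hK₀
  have hK₀t : K₀ ≠ ⊤ := by
    have h1 : ∫⁻ x in Ω, ‖fderiv ℝ (e 0) x‖ₑ ^ 2 < ⊤ := by
      obtain ⟨M, hM⟩ := h.isBounded.isCompact_closure.exists_bound_of_continuousOn
        ((hed 0).continuous_fderiv (by simp)).continuousOn
      refine (setLIntegral_mono measurable_const (g := fun _ => ENNReal.ofReal M ^ 2)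
        fun x hx => ?_).trans_lt ?_
      · gcongr
        rw [← ofReal_norm]
        exact ENNReal.ofReal_le_ofReal (hM x (subset_closure hx))
      · rw [setLIntegral_const]
        exact ENNReal.mul_lt_top (ENNReal.pow_lt_top ENNReal.ofReal_lt_top)
          h.isBounded.measure_lt_top
    exact ENNReal.mul_ne_top (ENNReal.pow_ne_top ENNReal.ofReal_ne_top)
      (ENNReal.mul_ne_top ENNReal.ofReal_ne_top (ENNReal.add_ne_top.2 ⟨h1.ne,
        ENNReal.pow_ne_top (ENNReal.add_ne_top.2 ⟨h.memLp_A.2.ne, ENNReal.one_ne_top⟩)⟩))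
  refine ⟨K₀ ^ (1 / 2 : ℝ), ENNReal.rpow_ne_top_of_nonneg (by norm_num) hK₀t, fun m hm => ?_⟩
  -- The threshold 1/m² gives m‖u − v‖ ≤ 1/m. For the gradients an error below 1 suffices, as only a
  -- bound independent of m is needed.
  obtain ⟨N, hN1, hN2⟩ := ((hlim.eventually (gt_mem_nhds (show (0 : ℝ≥0∞) <
    ENNReal.ofReal (1 / m ^ 2) from ENNReal.ofReal_pos.2 (by positivity)))).and
    (hlim'.eventually (gt_mem_nhds one_pos))).exists
  set w : ℕ → ℝ := indexWeight (Ioo 0 T) (k N) with hw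
  have hw0 : ∀ j, 0 ≤ w j := indexWeight_nonneg _ _
  -- S(x) is ρ(x)² plus the time integral of |v(t, x)|², with v the simple approximation; being a
  -- finite sum, it is smooth.
  set S : Space3 → ℝ := fun x => ∑ j ∈ Finset.range (N + 1), w j * ‖e j x‖ ^ 2 with hS
  set g : Space3 → ℝ := fun x =>
    Real.sqrt (∑ j ∈ Finset.range (N + 1), w j * ‖fderiv ℝ (e j) x‖ ^ 2) with hg
  have hgc : Continuous g := (continuous_finsetSum _ fun j _ => continuous_const.mul
    (((hed j).continuous_fderiv (by simp)).norm.pow 2)).sqrt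
  have hS0 : ∀ x, 0 ≤ S x := fun x => Finset.sum_nonneg fun j _ =>
    mul_nonneg (hw0 j) (sq_nonneg _)
  have hSd : ContDiff ℝ ∞ S := ContDiff.sum fun j _ =>
    contDiff_const.mul ((hed j).norm_sq ℝ)
  obtain ⟨χ, hχd, hχ0, hχ1, hχS, hχs, hχ', hχg⟩ := hC m S g hm hSd hS0
    (fun x => Real.sqrt_nonneg _) (fun x => norm_fderiv_weighted_sum_le _ hw0 hed x)
  have hρS : ∀ x, ρ x ^ 2 ≤ S x := by
    intro x
    have h1 := Finset.single_le_sum (f := fun j => w j * ‖e j x‖ ^ 2)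
      (fun j _ => mul_nonneg (hw0 j) (sq_nonneg _)) (Finset.mem_range.2 N.succ_pos)
    refine le_trans (le_of_eq ?_) h1
    simp [hw, indexWeight, he, norm_smul, hv₀n]
  have hSout : ∀ x, x ∉ Ω → S x = 0 := by
    intro x hx
    refine Finset.sum_eq_zero fun j _ => ?_
    have : e j x = 0 := by
      simp only [he]
      split_ifs
      · have : ρ x = 0 := by
          by_contra h'
          exact hx (hρs ▸ h')
        simp [this]
      · exact (hd j).eq_zero_of_notMem hx
    rw [this]
    simp
  have hSc : Continuous S := hSd.continuous
  -- S vanishes outside Ω while m²S ≥ 1/2 on the closed support of χ, so that support stays inside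
  -- Ω.
  have htest : IsTestOn Ω χ := by
    have hcl : IsClosed {x | 1 / 2 ≤ m ^ 2 * S x} :=
      isClosed_le continuous_const (continuous_const.mul hSc)
    have hsub : tsupport χ ⊆ {x | 1 / 2 ≤ m ^ 2 * S x} := closure_minimal (fun x hx => hχs x hx) hcl
    have hsubΩ : tsupport χ ⊆ Ω := by
      intro x hx
      by_contra h'
      have h1 : 1 / 2 ≤ m ^ 2 * S x := hsub hx
      rw [hSout x h'] at h1
      norm_num at h1
    exact ⟨hχd, Metric.isCompact_of_isClosed_isBounded (isClosed_tsupport _)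
      (h.isBounded.subset hsubΩ), hsubΩ⟩
  refine ⟨χ, htest, hχ0, hχ1, fun x hx => hχS x (hx.trans ?_), ?_⟩
  · exact mul_le_mul_of_nonneg_left (hρS x) (by positivity)
  -- Within Ω, the gradient of χ can be nonzero only on P.
  set P : Set Space3 := {x | x ∈ Ω ∧ m ^ 2 * S x ≤ 1} with hP
  have hPm : MeasurableSet P :=
    hΩm.inter (isClosed_le (continuous_const.mul hSc) continuous_const).measurableSet
  set v : ℝ × Space3 → Space3 := fun z => d (k N z.1) z.2 with hv
  set G : ℝ × Space3 → Space3 →L[ℝ] Space3 := fun z => fderiv ℝ (d (k N z.1)) z.2 with hG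
  have hkm : Measurable fun z : ℝ × Space3 => (k N z.1, z) :=
    ((hk N).comp measurable_fst).prodMk measurable_id
  have hvm : Measurable v := (measurable_from_prod_countable_right
    (f := fun p : ℕ × (ℝ × Space3) => d p.1 p.2.2) fun j =>
      ((hd j).1.continuous.comp continuous_snd).measurable).comp hkm
  have hGm : Measurable G := (measurable_from_prod_countable_right
    (f := fun p : ℕ × (ℝ × Space3) => fderiv ℝ (d p.1) p.2.2) fun j =>
      ((hd j).continuous_fderiv.comp continuous_snd).measurable).comp hkm
  have hofv : ∀ y : Space3, ENNReal.ofReal (‖y‖ ^ 2) = ‖y‖ₑ ^ 2 := fun y => by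
    rw [ENNReal.ofReal_pow (norm_nonneg _), ofReal_norm]
  have hofG : ∀ B : Space3 →L[ℝ] Space3, ENNReal.ofReal (‖B‖ ^ 2) = ‖B‖ₑ ^ 2 := fun B => by
    rw [ENNReal.ofReal_pow (norm_nonneg _), ofReal_norm]
  have hSv : ∀ x, ∫⁻ t in Ioo 0 T, ‖v (t, x)‖ₑ ^ 2 ≤ ENNReal.ofReal (S x) := by
    intro x
    rw [hS, ofReal_sum_indexWeight hI (hk N) (hkN N) (b := fun j => ‖d j x‖ ^ 2)
      (fun j => sq_nonneg _) (fun j => by simp [he]) (by simp [hd0])]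
    simp_rw [hofv]
    exact le_add_self
  have hgG : ∀ x, ENNReal.ofReal (g x) ^ 2 =
      ‖fderiv ℝ (e 0) x‖ₑ ^ 2 + ∫⁻ t in Ioo 0 T, ‖G (t, x)‖ₑ ^ 2 := by
    intro x
    rw [← ENNReal.ofReal_pow (Real.sqrt_nonneg _), Real.sq_sqrt (Finset.sum_nonneg fun j _ =>
      mul_nonneg (hw0 j) (sq_nonneg _)), ofReal_sum_indexWeight hI (hk N) (hkN N)
      (b := fun j => ‖fderiv ℝ (d j) x‖ ^ 2)
      (fun j => sq_nonneg _) (fun j => by simp [he]) (by simp [hd0])]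
    simp_rw [hofG]
    rfl
  -- In |∇χ||u| ≤ C g m|u| the factor m is attached to u: f₁ is bounded in L² independently of m,
  -- and f₂ is small.
  set f₁ : ℝ × Space3 → ℝ := (Ioo 0 T ×ˢ Ω).indicator fun z => C * g z.2 with hf₁
  set f₂ : ℝ × Space3 → Space3 := (Ioo 0 T ×ˢ P).indicator fun z => m • u z with hf₂
  have hPI : MeasurableSet (Ioo 0 T ×ˢ P) := measurableSet_Ioo.prod hPm
  have hpt : ∀ z, ‖fderiv ℝ χ z.2 (u z)‖ₑ ≤ ‖f₁ z‖ₑ * ‖f₂ z‖ₑ := by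
    intro z
    by_cases hz : z ∈ cyl T Ω
    · by_cases hzP : z.2 ∈ P
      · rw [hf₁, hf₂, indicator_of_mem (show z ∈ Ioo 0 T ×ˢ Ω from hz),
          indicator_of_mem (show z ∈ Ioo 0 T ×ˢ P from ⟨hz.1, hzP⟩), ← enorm_smul,
          ← ofReal_norm, ← ofReal_norm]
        refine ENNReal.ofReal_le_ofReal (((fderiv ℝ χ z.2).le_of_opNorm_le (hχg z.2) _).trans_eq ?_)
        rw [norm_smul, norm_smul, Real.norm_of_nonneg hm.le,
          Real.norm_of_nonneg (mul_nonneg hC0 (Real.sqrt_nonneg _))]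
        ring
      · rw [hχ' z.2 (not_le.1 fun h' => hzP ⟨hz.2, h'⟩)]
        simp
    · rw [h.zero_u z hz]
      simp
  have hf₁m : Measurable f₁ := (measurable_const.mul (hgc.measurable.comp measurable_snd)).indicator
    (measurableSet_Ioo.prod hΩm)
  have b1 : eLpNorm f₁ 2 volume ^ 2 ≤ K₀ := by
    rw [eLpNorm_two_sq]
    have e1 : ∀ z, ‖f₁ z‖ₑ ^ 2 = (Ioo 0 T ×ˢ Ω).indicator
        (fun z => ENNReal.ofReal C ^ 2 * ENNReal.ofReal (g z.2) ^ 2) z := by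
      intro z
      by_cases hz : z ∈ Ioo 0 T ×ˢ Ω
      · rw [hf₁, indicator_of_mem hz, indicator_of_mem hz, ← ofReal_norm,
          Real.norm_of_nonneg (mul_nonneg hC0 (Real.sqrt_nonneg _)), ENNReal.ofReal_mul hC0, mul_pow]
      · rw [hf₁, indicator_of_notMem hz, indicator_of_notMem hz]
        simp
    have hgm : Measurable fun x => ENNReal.ofReal (g x) ^ 2 :=
      (hgc.measurable.ennreal_ofReal).pow_const 2
    have hGsq : Measurable fun z => ‖G z‖ₑ ^ 2 := hGm.enorm.pow_const 2
    rw [lintegral_congr e1, lintegral_indicator (measurableSet_Ioo.prod hΩm),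
      lintegral_time_restrict (f := fun z => ENNReal.ofReal C ^ 2 * ENNReal.ofReal (g z.2) ^ 2)
        (measurable_const.mul (hgm.comp measurable_snd))]
    simp only [setLIntegral_const, Real.volume_Ioo, sub_zero]
    have hgm' : Measurable fun x => ENNReal.ofReal C ^ 2 * ENNReal.ofReal (g x) ^ 2 :=
      measurable_const.mul hgm
    rw [lintegral_mul_const _ hgm', lintegral_const_mul _ hgm, mul_assoc,
      mul_comm (∫⁻ x in Ω, _), hK₀]
    gcongr
    simp_rw [hgG]
    rw [lintegral_add_left ((((hed 0).continuous_fderiv (by simp)).measurable.enorm).pow_const 2),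
      ← lintegral_time_restrict hGsq]
    gcongr
    refine (setLIntegral_le_lintegral _ _).trans ?_
    rw [← eLpNorm_two_sq]
    gcongr
    have e2 : G = A - fun z => A z - G z := by ext1 z; simp
    rw [e2]
    refine (eLpNorm_sub_le h.memLp_A.1 (h.memLp_A.1.sub hGm.aestronglyMeasurable) one_le_two).trans ?_
    gcongr
    exact hN2.le
  have b2 : eLpNorm f₂ 2 volume ≤ ENNReal.ofReal (1 / m) +
      volume {x | x ∈ Ω ∧ m ^ 2 * ρ x ^ 2 ≤ 1} ^ (1 / 2 : ℝ) := by
    have e1 : f₂ = ((Ioo 0 T ×ˢ P).indicator fun z => m • (u z - v z)) +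
        (Ioo 0 T ×ˢ P).indicator fun z => m • v z := by
      rw [hf₂, ← indicator_add']
      congr 1
      ext1 z
      rw [Pi.add_apply, smul_sub, sub_add_cancel]
    have hus : AEStronglyMeasurable (fun z => u z - v z) volume :=
      h.memLp_u.1.sub hvm.aestronglyMeasurable
    rw [e1]
    refine (eLpNorm_add_le ((hus.const_smul m).indicator hPI)
      ((hvm.aestronglyMeasurable.const_smul m).indicator hPI) one_le_two).trans (add_le_add ?_ ?_)
    · refine (eLpNorm_indicator_le _).trans ?_
      rw [eLpNorm_const_smul, ← ofReal_norm, Real.norm_of_nonneg hm.le]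
      refine (mul_le_mul_right hN1.le _).trans_eq ?_
      rw [← ENNReal.ofReal_mul hm.le]
      congr 1
      field_simp
    · have e4 : ∀ a : ℝ≥0∞, a = (a ^ 2) ^ (1 / 2 : ℝ) := fun a => by
        rw [← ENNReal.rpow_natCast, ← ENNReal.rpow_mul]
        norm_num
      rw [e4 (eLpNorm _ 2 volume), eLpNorm_two_sq]
      refine ENNReal.rpow_le_rpow ?_ (by norm_num)
      have e5 : ∀ z, ‖(Ioo 0 T ×ˢ P).indicator (m • v) z‖ₑ ^ 2 =
          (Ioo 0 T ×ˢ P).indicator (fun z => ENNReal.ofReal (m ^ 2) * ‖v z‖ₑ ^ 2) z := by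
        intro z
        by_cases hz : z ∈ Ioo 0 T ×ˢ P
        · rw [indicator_of_mem hz, indicator_of_mem hz, Pi.smul_apply, enorm_smul, mul_pow, ← ofReal_norm m,
            Real.norm_of_nonneg hm.le, ENNReal.ofReal_pow hm.le]
        · rw [indicator_of_notMem hz, indicator_of_notMem hz]
          simp
      have hvsq : Measurable fun z => ‖v z‖ₑ ^ 2 := hvm.enorm.pow_const 2
      rw [lintegral_congr e5, lintegral_indicator hPI,
        lintegral_time_restrict (f := fun z => ENNReal.ofReal (m ^ 2) * ‖v z‖ₑ ^ 2)
          (measurable_const.mul hvsq)]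
      -- On P the time integral of m²|v|² is at most m²S ≤ 1, so m v contributes only the measure of
      -- P.
      have e6 : ∀ x ∈ P, ∫⁻ t in Ioo 0 T, ENNReal.ofReal (m ^ 2) * ‖v (t, x)‖ₑ ^ 2 ≤ 1 := by
        intro x hx
        have hvx : Measurable fun t => ‖v (t, x)‖ₑ ^ 2 := hvsq.comp measurable_prodMk_right
        rw [lintegral_const_mul _ hvx]
        refine (mul_le_mul_right (hSv x) _).trans ?_
        rw [← ENNReal.ofReal_mul (by positivity), ENNReal.ofReal_le_one]
        exact hx.2
      refine (setLIntegral_mono measurable_const e6).trans ?_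
      rw [setLIntegral_const, one_mul]
      refine measure_mono fun x hx => ⟨hx.1, le_trans ?_ hx.2⟩
      exact mul_le_mul_of_nonneg_left (hρS x) (by positivity)
  have hf₂m : AEStronglyMeasurable f₂ volume := (h.memLp_u.1.const_smul m).indicator hPI
  refine (lintegral_mono hpt).trans ((lintegral_enorm_mul_enorm_le hf₁m.aestronglyMeasurable
    hf₂m).trans (mul_le_mul' ?_ b2))
  have e4 : eLpNorm f₁ 2 volume = (eLpNorm f₁ 2 volume ^ 2) ^ (1 / 2 : ℝ) := by
    rw [← ENNReal.rpow_natCast, ← ENNReal.rpow_mul]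
    norm_num
  rw [e4]
  exact ENNReal.rpow_le_rpow b1 (by norm_num)

/-- Cutoff functions adapted to a velocity in `L²(0,T;H¹₀)`. -/
theorem exists_cutoff (h : IsTransportSolution T Ω u A R) :
    ∃ χ : ℕ → Space3 → ℝ, (∀ n, IsTestOn Ω (χ n)) ∧ (∀ n x, 0 ≤ χ n x) ∧ (∀ n x, χ n x ≤ 1) ∧
      (∀ x ∈ Ω, Tendsto (fun n => χ n x) atTop (𝓝 1)) ∧
      Tendsto (fun n => ∫⁻ z, ‖fderiv ℝ (χ n) z.2 (u z)‖ₑ) atTop (𝓝 0) := by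
  -- A smooth function with nonvanishing set exactly Ω replaces the distance to the boundary.
  obtain ⟨ρ, hρs, hρ, hρr⟩ := h.isOpen.exists_contDiff_support_eq (n := ⊤)
  obtain ⟨K, hK, hstep⟩ := h.exists_cutoff_step hρ hρs
  choose χ hχ hχ0 hχ1 hχe hχu using fun n : ℕ => hstep ((n : ℝ) + 1) (by positivity)
  have hmono : ∀ {a b : ℕ}, a ≤ b → ∀ x, ((a : ℝ) + 1) ^ 2 * ρ x ^ 2 ≤ ((b : ℝ) + 1) ^ 2 * ρ x ^ 2 :=
    fun {a b} hab x => by gcongr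
  have hlarge : ∀ x ∈ Ω, ∃ n : ℕ, 1 < ((n : ℝ) + 1) ^ 2 * ρ x ^ 2 := by
    intro x hx
    have h0 : 0 < ρ x ^ 2 := by
      have : ρ x ≠ 0 := by
        rw [← hρs] at hx
        exact hx
      positivity
    obtain ⟨n, hn⟩ := exists_nat_gt (1 / ρ x ^ 2)
    refine ⟨n, ?_⟩
    rw [div_lt_iff₀ h0] at hn
    nlinarith [Nat.cast_nonneg (α := ℝ) n, mul_nonneg (Nat.cast_nonneg (α := ℝ) n) h0.le,
      mul_nonneg (sq_nonneg (n : ℝ)) h0.le]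
  refine ⟨χ, hχ, hχ0, hχ1, fun x hx => ?_, ?_⟩
  · obtain ⟨n, hn⟩ := hlarge x hx
    refine tendsto_const_nhds.congr' ?_
    filter_upwards [eventually_ge_atTop n] with k hk
    exact (hχe k x (hn.le.trans (hmono hk x))).symm
  · set F : ℕ → Set Space3 := fun n => {x | x ∈ Ω ∧ ((n : ℝ) + 1) ^ 2 * ρ x ^ 2 ≤ 1} with hF
    have hFv : Tendsto (fun n => volume (F n)) atTop (𝓝 0) := by
      have h1 := tendsto_measure_iInter_atTop (μ := volume) (s := F)
        (fun n => (h.isOpen.measurableSet.inter (isClosed_le (continuous_const.mul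
          (hρ.continuous.pow 2)) continuous_const).measurableSet).nullMeasurableSet)
        (fun a b hab x hx => ⟨hx.1, (hmono hab x).trans hx.2⟩)
        ⟨0, measure_ne_top_of_subset (fun x hx => hx.1) h.isBounded.measure_lt_top.ne⟩
      -- As ρ ≠ 0 on Ω, the sets where ρ is small decrease to the empty set, and their measures tend
      -- to 0.
      have h2 : ⋂ n, F n = ∅ := by
        refine eq_empty_of_forall_notMem fun x hx => ?_
        obtain ⟨n, hn⟩ := hlarge x (mem_iInter.1 hx 0).1
        exact absurd (mem_iInter.1 hx n).2 (not_le.2 hn)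
      rwa [h2, measure_empty] at h1
    have h3 : Tendsto (fun n : ℕ => ENNReal.ofReal (1 / ((n : ℝ) + 1))) atTop (𝓝 0) := by
      simpa using ENNReal.tendsto_ofReal (tendsto_one_div_add_atTop_nhds_zero_nat (𝕜 := ℝ))
    have h4 := hFv.ennrpow_const (1 / 2 : ℝ)
    rw [ENNReal.zero_rpow_of_pos (by norm_num)] at h4
    have h5 := ENNReal.Tendsto.const_mul (h3.add h4) (Or.inr hK)
    rw [add_zero, mul_zero] at h5
    exact tendsto_of_tendsto_of_tendsto_of_le_of_le tendsto_const_nhds h5 (fun _ => zero_le) hχu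

end IsTransportSolution

/-! ### Localized balance for the continuous representative -/

theorem eqOn_Icc_of_ae_eq_Ioo {Y : Type*} [TopologicalSpace Y] [T2Space Y] {T : ℝ} (hT : 0 < T)
    {f g : ℝ → Y} (hf : ContinuousOn f (Icc 0 T)) (hg : ContinuousOn g (Icc 0 T))
    (h : ∀ᵐ t ∂(volume.restrict (Ioo 0 T)), f t = g t) : EqOn f g (Icc 0 T) := by
  have h1 : EqOn f g (Ioo 0 T) :=
    Measure.eqOn_open_of_ae_eq h isOpen_Ioo (hf.mono Ioo_subset_Icc_self)
      (hg.mono Ioo_subset_Icc_self)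
  exact h1.of_subset_closure hf hg Ioo_subset_Icc_self (by rw [closure_Ioo hT.ne])

section NemytskiiL1

variable {E : Type*} [NormedAddCommGroup E] [NormedSpace ℝ E] {Ω : Set Space3} {β : E → ℝ} {C : ℝ}

theorem integrable_comp_Lp (hΩ : volume Ω ≠ ⊤) (hβ : ContDiff ℝ 1 β)
    (hC : ∀ X, ‖fderiv ℝ β X‖ ≤ C) (f : Lp E 1 (volume.restrict Ω)) :
    Integrable (fun x => β (f x)) (volume.restrict Ω) := by
  have : IsFiniteMeasure (volume.restrict Ω) := ⟨by simpa using hΩ.lt_top⟩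
  have hf := L1.integrable_coeFn f
  exact ((integrable_const ‖β 0‖).add (hf.norm.const_mul C)).mono'
    (hβ.continuous.comp_aestronglyMeasurable hf.1)
    (ae_of_all _ fun x => norm_comp_le_of_fderiv_bound hβ hC (f x))

/-- The functional is Lipschitz in L¹ with constant M C, so continuity of the representative passes
to the localized integrals of β. -/
theorem continuous_integral_mul_comp_Lp (hΩ : volume Ω ≠ ⊤) (hβ : ContDiff ℝ 1 β)
    (hC : ∀ X, ‖fderiv ℝ β X‖ ≤ C) {χ : Space3 → ℝ} (hχ : Continuous χ) {M : ℝ}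
    (hM : ∀ x, ‖χ x‖ ≤ M) :
    Continuous fun f : Lp E 1 (volume.restrict Ω) => ∫ x in Ω, χ x * β (f x) := by
  have hC0 : 0 ≤ C := (norm_nonneg _).trans (hC 0)
  have hM0 : 0 ≤ M := (norm_nonneg _).trans (hM 0)
  refine LipschitzWith.continuous (K := ⟨M * C, by positivity⟩)
    (LipschitzWith.of_dist_le_mul fun f g => ?_)
  have hi : ∀ f : Lp E 1 (volume.restrict Ω),
      Integrable (fun x => χ x * β (f x)) (volume.restrict Ω) := fun f =>
    integrable_bounded_smul (integrable_comp_Lp hΩ hβ hC f) hχ.aestronglyMeasurable hM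
  have hfg := L1.integrable_coeFn (f - g)
  rw [dist_eq_norm, ← integral_sub (hi f) (hi g), dist_eq_norm, L1.norm_eq_integral_norm,
    ← integral_const_mul]
  refine norm_integral_le_of_norm_le (hfg.norm.const_mul _) ?_
  filter_upwards [Lp.coeFn_sub f g] with x hx
  rw [hx, ← mul_sub, norm_mul]
  refine (mul_le_mul (hM x) (norm_image_sub_le_of_fderiv_bound hβ hC _ _) (norm_nonneg _)
    hM0).trans_eq ?_
  rw [← mul_assoc]
  rfl

end NemytskiiL1

namespace IsTransportSolution

variable {E : Type*} [NormedAddCommGroup E] [NormedSpace ℝ E] {T : ℝ}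
  {Ω : Set Space3} {u : ℝ × Space3 → Space3} {A : ℝ × Space3 → Space3 →L[ℝ] Space3}
  {R : ℝ × Space3 → E} {β : E → ℝ} {C : ℝ}

theorem integrable_divOf (h : IsTransportSolution T Ω u A R) : Integrable fun z => divOf (A z) :=
  h.integrable_of_memLp h.memLp_divOf fun z hz => by rw [h.zero_A z hz]; simp [divOf]

theorem integrable_source (h : IsTransportSolution T Ω u A R) (hβ : ContDiff ℝ 1 β)
    (hC : ∀ X, ‖fderiv ℝ β X‖ ≤ C) :
    Integrable fun z => (β (R z) - fderiv ℝ β (R z) (R z)) * divOf (A z) := by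
  have i1 := integrable_comp_mul hβ hC h.memLp_R h.memLp_divOf h.integrable_divOf
  have i2 : Integrable fun z => fderiv ℝ β (R z) (R z) * divOf (A z) := by
    have h1 : Integrable fun z => ‖R z‖ * ‖divOf (A z)‖ :=
      h.memLp_R.norm.integrable_mul h.memLp_divOf.norm
    refine (h1.const_mul C).mono' ((((hβ.continuous_fderiv one_ne_zero).comp_aestronglyMeasurable
      h.memLp_R.1).clm_apply' h.memLp_R.1).mul h.memLp_divOf.1) (ae_of_all _ fun z => ?_)
    rw [norm_mul, ← mul_assoc]
    gcongr
    exact (fderiv ℝ β (R z)).le_of_opNorm_le (hC _) _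
  simp_rw [sub_mul]
  exact i1.sub i2

theorem memLp_fderiv_space (h : IsTransportSolution T Ω u A R) {χ : Space3 → ℝ}
    (hχ : IsTestOn Ω χ) : MemLp (fun z => fderiv ℝ χ z.2 (u z)) 2 volume := by
  have hχ' := hχ.continuous_fderiv
  obtain ⟨M, hM⟩ := hχ'.bounded_above_of_compact_support (hχ.2.1.fderiv (𝕜 := ℝ))
  exact (h.memLp_u.norm.const_mul M).mono'
    ((hχ'.comp continuous_snd).aestronglyMeasurable.clm_apply' h.memLp_u.1)
    (ae_of_all _ fun z => (fderiv ℝ χ z.2).le_of_opNorm_le (hM _) _)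

/-- The weak time derivative of `∫ χ β(R)`. -/
noncomputable def pairingRate (u : ℝ × Space3 → Space3) (A : ℝ × Space3 → Space3 →L[ℝ] Space3)
    (R : ℝ × Space3 → E) (β : E → ℝ) (χ : Space3 → ℝ) (z : ℝ × Space3) : ℝ :=
  β (R z) * fderiv ℝ χ z.2 (u z) + χ z.2 * ((β (R z) - fderiv ℝ β (R z) (R z)) * divOf (A z))

theorem integrable_pairingRate (h : IsTransportSolution T Ω u A R) (hβ : ContDiff ℝ 1 β)
    (hC : ∀ X, ‖fderiv ℝ β X‖ ≤ C) {χ : Space3 → ℝ} (hχ : IsTestOn Ω χ) :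
    Integrable (pairingRate u A R β χ) := by
  obtain ⟨M, hM⟩ := hχ.1.continuous.bounded_above_of_compact_support hχ.2.1
  have hW := h.memLp_fderiv_space hχ
  exact (integrable_comp_mul hβ hC h.memLp_R hW (h.integrable_of_memLp hW fun z hz => by
    rw [h.zero_u z hz, map_zero])).add (integrable_bounded_smul (h.integrable_source hβ hC)
      (hχ.1.continuous.comp continuous_snd).aestronglyMeasurable fun z => hM z.2)

/-- The renormalized equation tested with θ(t)χ(x) identifies the weak time derivative of ∫ χβ(R).
Both sides being continuous in t, equality almost everywhere extends to every t, including the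
endpoints. -/
theorem setIntegral_mul_comp_representative [CompleteSpace E] (h : IsTransportSolution T Ω u A R)
    (hT : 0 < T)
    {Rc : ℝ → Lp E 1 (volume.restrict Ω)} (hRc : ContinuousOn Rc (Icc 0 T))
    (hae : ∀ᵐ t ∂(volume.restrict (Ioo 0 T)), Rc t =ᵐ[volume.restrict Ω] fun x => R (t, x))
    (hβ : ContDiff ℝ 1 β) (hC : ∀ X, ‖fderiv ℝ β X‖ ≤ C) {χ : Space3 → ℝ} (hχ : IsTestOn Ω χ)
    {t : ℝ} (ht : t ∈ Icc 0 T) :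
    ∫ x in Ω, χ x * β (Rc t x) =
      (∫ x in Ω, χ x * β (Rc 0 x)) + ∫ s in 0..t, ∫ x, pairingRate u A R β χ (s, x) := by
  obtain ⟨M, hM⟩ := hχ.1.continuous.bounded_above_of_compact_support hχ.2.1
  have hΩv : volume Ω ≠ ⊤ := h.isBounded.measure_lt_top.ne
  have : IsFiniteMeasure (volume.restrict (cyl T Ω)) := ⟨by simpa using h.volume_cyl_lt_top⟩
  have hf := h.integrable_pairingRate hβ hC hχ
  -- Since β(0) may be nonzero, β(R) need not vanish at times outside (0, T); the indicator restores
  -- integrability.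
  set b : ℝ × Space3 → ℝ := (cyl T Ω).indicator fun z => χ z.2 * β (R z) with hb
  have hbi : Integrable b := by
    refine (integrable_indicator_iff h.measurableSet_cyl).2 ?_
    refine integrable_bounded_smul ?_ (hχ.1.continuous.comp continuous_snd).aestronglyMeasurable
      fun z => hM z.2
    exact ((integrable_const ‖β 0‖).add (h.integrable_R.restrict.norm.const_mul C)).mono'
      (hβ.continuous.comp_aestronglyMeasurable h.memLp_R.1.restrict)
      (ae_of_all _ fun z => norm_comp_le_of_fderiv_bound hβ hC (R z))
  obtain ⟨c, hc⟩ := exists_ae_integral_eq_add_primitive hT hbi hf fun θ hθ => by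
    have htest : IsTestOn (cyl T Ω) fun z : ℝ × Space3 => θ z.1 * χ z.2 := hθ.time_mul_space hχ
    rw [← h.renormalized hβ hC htest]
    refine integral_congr_ae (ae_of_all _ fun z => ?_)
    have e1 : deriv θ z.1 * b z = deriv θ z.1 * (χ z.2 * β (R z)) := by
      by_cases hz : z ∈ cyl T Ω
      · rw [hb, indicator_of_mem hz]
      · rw [hb, indicator_of_notMem hz]
        by_cases hz1 : z.1 ∈ Ioo 0 T
        · rw [hχ.eq_zero_of_notMem fun h' => hz ⟨hz1, h'⟩, zero_mul]
        · rw [← fderiv_apply_one_eq_deriv, hθ.fderiv_eq_zero_of_notMem hz1]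
          simp
    simp only [e1, pairingRate, fderiv_time_mul_space hθ.differentiable hχ.differentiable]
    ring
  have hf' : Integrable (pairingRate u A R β χ) (volume.prod volume) := hf
  have hG := continuous_intervalIntegral_of_integrable hf'.integral_prod_left 0
  have key : EqOn (fun t => ∫ x in Ω, χ x * β (Rc t x))
      (fun t => c + ∫ s in 0..t, ∫ x, pairingRate u A R β χ (s, x)) (Icc 0 T) := by
    refine eqOn_Icc_of_ae_eq_Ioo hT ?_ (continuous_const.add hG).continuousOn ?_
    · exact (continuous_integral_mul_comp_Lp hΩv hβ hC hχ.1.continuous hM).comp_continuousOn hRc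
    · filter_upwards [hc, hae, ae_restrict_mem measurableSet_Ioo] with t hct hat hmem
      rw [← hct]
      have e2 : ∀ x, b (t, x) = Ω.indicator (fun x => χ x * β (R (t, x))) x := by
        intro x
        by_cases hx : x ∈ Ω
        · rw [hb, indicator_of_mem hx, indicator_of_mem (show (t, x) ∈ cyl T Ω from ⟨hmem, hx⟩)]
        · rw [hb, indicator_of_notMem hx, indicator_of_notMem fun h' => hx h'.2]
      simp_rw [e2]
      rw [integral_indicator h.isOpen.measurableSet]
      refine integral_congr_ae ?_
      filter_upwards [hat] with x hx
      rw [hx]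
  have k0 := key (left_mem_Icc.2 hT.le)
  have kt := key ht
  simp only [intervalIntegral.integral_same, add_zero] at k0 kt
  rw [kt, k0]

end IsTransportSolution

theorem intervalIntegral_slice {F : ℝ × Space3 → ℝ} (hF : Integrable F) {t : ℝ} (ht : 0 ≤ t) :
    ∫ s in 0..t, ∫ x, F (s, x) = ∫ z in Ioo 0 t ×ˢ univ, F z := by
  have hF' : IntegrableOn F (Ioo 0 t ×ˢ univ) (volume.prod volume) := hF.integrableOn
  rw [intervalIntegral.integral_of_le ht, integral_Ioc_eq_integral_Ioo, Measure.volume_eq_prod,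
    setIntegral_prod _ hF']
  simp

/-! ### Bounded truncations of β -/

section Truncation

variable {E : Type*} {β : E → ℝ} {C : ℝ}

/-- A bounded truncation of `β` at height of order `1 / ε`. -/
noncomputable def arctanTrunc (β : E → ℝ) (ε : ℝ) (X : E) : ℝ := ε⁻¹ * Real.arctan (ε * β X)

theorem abs_arctan_le_abs (x : ℝ) : |Real.arctan x| ≤ |x| := by
  have h := Convex.norm_image_sub_le_of_norm_hasDerivWithin_le (f := Real.arctan)
    (f' := fun x => 1 / (1 + x ^ 2)) (s := univ) (C := 1) (x := 0) (y := x)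
    (fun y _ => (Real.hasDerivAt_arctan y).hasDerivWithinAt)
    (fun y _ => by
      rw [Real.norm_of_nonneg (by positivity), div_le_one (by positivity)]
      nlinarith [sq_nonneg y]) convex_univ (mem_univ _) (mem_univ _)
  simpa using h

theorem abs_arctanTrunc_le {ε : ℝ} (hε : 0 < ε) (X : E) : |arctanTrunc β ε X| ≤ |β X| := by
  rw [arctanTrunc, abs_mul, abs_inv, abs_of_pos hε, inv_mul_le_iff₀ hε]
  refine (abs_arctan_le_abs _).trans_eq ?_
  rw [abs_mul, abs_of_pos hε]

theorem abs_arctanTrunc_le_const {ε : ℝ} (hε : 0 < ε) (X : E) :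
    |arctanTrunc β ε X| ≤ ε⁻¹ * (Real.pi / 2) := by
  rw [arctanTrunc, abs_mul, abs_inv, abs_of_pos hε]
  gcongr
  exact abs_le.2 ⟨(Real.neg_pi_div_two_lt_arctan _).le, (Real.arctan_lt_pi_div_two _).le⟩

/-- The truncation is the difference quotient at 0 of ε ↦ arctan(ε β(X)), whose derivative there is
β(X). -/
theorem tendsto_arctanTrunc (X : E) :
    Tendsto (fun n : ℕ => arctanTrunc β (1 / ((n : ℝ) + 1)) X) atTop (𝓝 (β X)) := by
  have h1 : HasDerivAt (fun ε : ℝ => Real.arctan (ε * β X)) (β X) 0 := by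
    simpa using ((hasDerivAt_id (0 : ℝ)).mul_const (β X)).arctan
  have h2 : Tendsto (fun n : ℕ => 1 / ((n : ℝ) + 1)) atTop (𝓝[≠] 0) :=
    tendsto_nhdsWithin_iff.2 ⟨tendsto_one_div_add_atTop_nhds_zero_nat,
      Eventually.of_forall fun n => (Nat.one_div_pos_of_nat (α := ℝ)).ne'⟩
  have h3 := h1.tendsto_slope_zero.comp h2
  simpa [Function.comp_def, arctanTrunc] using h3

variable [NormedAddCommGroup E] [NormedSpace ℝ E]

theorem contDiff_arctanTrunc (hβ : ContDiff ℝ 1 β) (ε : ℝ) : ContDiff ℝ 1 (arctanTrunc β ε) :=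
  contDiff_const.mul (Real.contDiff_arctan.comp (contDiff_const.mul hβ))

theorem fderiv_arctanTrunc (hβ : ContDiff ℝ 1 β) {ε : ℝ} (hε : 0 < ε) (X : E) :
    fderiv ℝ (arctanTrunc β ε) X = (1 / (1 + (ε * β X) ^ 2)) • fderiv ℝ β X := by
  have h1 := (hβ.differentiable one_ne_zero X).hasFDerivAt.const_mul ε
  have h2 := ((Real.hasDerivAt_arctan (ε * β X)).comp_hasFDerivAt X h1).const_mul ε⁻¹
  have h3 : fderiv ℝ (arctanTrunc β ε) X = _ := h2.fderiv
  rw [h3, smul_smul, smul_smul]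
  congr 1
  field_simp

theorem norm_fderiv_arctanTrunc_le (hβ : ContDiff ℝ 1 β) (hC : ∀ X, ‖fderiv ℝ β X‖ ≤ C) {ε : ℝ}
    (hε : 0 < ε) (X : E) : ‖fderiv ℝ (arctanTrunc β ε) X‖ ≤ C := by
  rw [fderiv_arctanTrunc hβ hε, norm_smul, Real.norm_of_nonneg (by positivity)]
  refine (mul_le_of_le_one_left (norm_nonneg _) ?_).trans (hC X)
  rw [div_le_one (by positivity)]
  nlinarith [sq_nonneg (ε * β X)]

theorem tendsto_fderiv_arctanTrunc (hβ : ContDiff ℝ 1 β) (X Y : E) :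
    Tendsto (fun n : ℕ => fderiv ℝ (arctanTrunc β (1 / ((n : ℝ) + 1))) X Y) atTop
      (𝓝 (fderiv ℝ β X Y)) := by
  have h1 : Tendsto (fun n : ℕ => 1 / (1 + (1 / ((n : ℝ) + 1) * β X) ^ 2) * fderiv ℝ β X Y) atTop
      (𝓝 (1 / (1 + (0 * β X) ^ 2) * fderiv ℝ β X Y)) :=
    ((tendsto_const_nhds.div (((tendsto_one_div_add_atTop_nhds_zero_nat.mul_const _).pow
      2).const_add 1) (by positivity)).mul_const _)
  simp only [zero_mul, ne_eq, OfNat.ofNat_ne_zero, not_false_eq_true, zero_pow, add_zero, div_one,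
    one_mul] at h1
  refine h1.congr fun n => ?_
  rw [fderiv_arctanTrunc hβ Nat.one_div_pos_of_nat]
  rfl

end Truncation

/-! ### The global balance and the initial value -/

namespace IsTransportSolution

variable {E : Type*} [NormedAddCommGroup E] [NormedSpace ℝ E] [CompleteSpace E] {T : ℝ}
  {Ω : Set Space3} {u : ℝ × Space3 → Space3} {A : ℝ × Space3 → Space3 →L[ℝ] Space3}
  {R : ℝ × Space3 → E} {β : E → ℝ} {C : ℝ}

/-- Let the adapted cutoffs tend to 1 in the localized balance. Boundedness of β is needed only for
the boundary term, which is at most B|u·∇χₙ| and tends to 0 in L¹. -/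
theorem setIntegral_comp_representative_of_bounded (h : IsTransportSolution T Ω u A R)
    (hT : 0 < T)
    {Rc : ℝ → Lp E 1 (volume.restrict Ω)} (hRc : ContinuousOn Rc (Icc 0 T))
    (hae : ∀ᵐ t ∂(volume.restrict (Ioo 0 T)), Rc t =ᵐ[volume.restrict Ω] fun x => R (t, x))
    (hβ : ContDiff ℝ 1 β) (hC : ∀ X, ‖fderiv ℝ β X‖ ≤ C) {B : ℝ} (hB : ∀ X, |β X| ≤ B)
    {t : ℝ} (ht : t ∈ Icc 0 T) :
    ∫ x in Ω, β (Rc t x) = (∫ x in Ω, β (Rc 0 x)) +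
      ∫ z in Ioo 0 t ×ˢ univ, (β (R z) - fderiv ℝ β (R z) (R z)) * divOf (A z) := by
  have hΩv : volume Ω ≠ ⊤ := h.isBounded.measure_lt_top.ne
  obtain ⟨χ, hχ, hχ0, hχ1, hlim, hu⟩ := h.exists_cutoff
  have hχn : ∀ n x, ‖χ n x‖ ≤ 1 := fun n x => by
    rw [Real.norm_of_nonneg (hχ0 n x)]
    exact hχ1 n x
  have hβi : ∀ s, Integrable (fun x => β (Rc s x)) (volume.restrict Ω) := fun s =>
    integrable_comp_Lp hΩv hβ hC (Rc s)
  have hl : ∀ s, Tendsto (fun n => ∫ x in Ω, χ n x * β (Rc s x)) atTop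
      (𝓝 (∫ x in Ω, β (Rc s x))) := by
    intro s
    refine tendsto_integral_of_dominated_convergence (fun x => ‖β (Rc s x)‖)
      (fun n => (hχ n).1.continuous.aestronglyMeasurable.mul (hβi s).1) (hβi s).norm
      (fun n => ae_of_all _ fun x => ?_) ?_
    · rw [norm_mul]
      exact mul_le_of_le_one_left (norm_nonneg _) (hχn n x)
    · filter_upwards [ae_restrict_mem h.isOpen.measurableSet] with x hx
      simpa using (hlim x hx).mul_const (β (Rc s x))
  set f : ℝ × Space3 → ℝ := fun z => (β (R z) - fderiv ℝ β (R z) (R z)) * divOf (A z) with hf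
  have hfi : Integrable f := h.integrable_source hβ hC
  have hf0 : ∀ z : ℝ × Space3, z.2 ∉ Ω → f z = 0 := fun z hz => by
    simp [hf, h.zero_A z fun h' => hz h'.2, divOf]
  have i1 : ∀ n, Integrable fun z => β (R z) * fderiv ℝ (χ n) z.2 (u z) := fun n =>
    have hW := h.memLp_fderiv_space (hχ n)
    integrable_comp_mul hβ hC h.memLp_R hW (h.integrable_of_memLp hW fun z hz => by
      rw [h.zero_u z hz, map_zero])
  have i2 : ∀ n, Integrable fun z => χ n z.2 * f z := fun n =>
    integrable_bounded_smul hfi ((hχ n).1.continuous.comp continuous_snd).aestronglyMeasurable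
      fun z => hχn n z.2
  have l1 : Tendsto (fun n => ∫ z in Ioo 0 t ×ˢ univ, β (R z) * fderiv ℝ (χ n) z.2 (u z)) atTop
      (𝓝 0) := by
    have h1 : Tendsto (fun n => ENNReal.ofReal B * ∫⁻ z, ‖fderiv ℝ (χ n) z.2 (u z)‖ₑ) atTop
        (𝓝 0) := by
      simpa using ENNReal.Tendsto.const_mul hu (Or.inr ENNReal.ofReal_ne_top)
    rw [tendsto_zero_iff_enorm_tendsto_zero]
    refine tendsto_of_tendsto_of_tendsto_of_le_of_le tendsto_const_nhds h1 (fun _ => zero_le)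
      fun n => ?_
    refine (enorm_integral_le_lintegral_enorm _).trans ((setLIntegral_le_lintegral _ _).trans ?_)
    rw [← lintegral_const_mul'' _ (h.memLp_fderiv_space (hχ n)).1.enorm]
    refine lintegral_mono fun z => ?_
    rw [enorm_mul]
    gcongr
    rw [← ofReal_norm]
    exact ENNReal.ofReal_le_ofReal (hB _)
  have l2 : Tendsto (fun n => ∫ z in Ioo 0 t ×ˢ univ, χ n z.2 * f z) atTop
      (𝓝 (∫ z in Ioo 0 t ×ˢ univ, f z)) := by
    refine tendsto_integral_of_dominated_convergence (fun z => ‖f z‖)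
      (fun n => (i2 n).1.restrict) hfi.norm.restrict
      (fun n => ae_of_all _ fun z => ?_) (ae_of_all _ fun z => ?_)
    · rw [norm_mul]
      exact mul_le_of_le_one_left (norm_nonneg _) (hχn n z.2)
    · by_cases hz : z.2 ∈ Ω
      · simpa using (hlim z.2 hz).mul_const (f z)
      · simp [hf0 z hz]
  have l3 := (hl 0).add (l1.add l2)
  rw [zero_add] at l3
  refine tendsto_nhds_unique (hl t) (l3.congr fun n => ?_)
  rw [h.setIntegral_mul_comp_representative hT hRc hae hβ hC (hχ n) ht,
    intervalIntegral_slice (h.integrable_pairingRate hβ hC (hχ n)) ht.1,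
    ← integral_add (i1 n).restrict (i2 n).restrict]
  rfl

/-- The renormalized balance of `∫ β(R)`. -/
theorem setIntegral_comp_representative (h : IsTransportSolution T Ω u A R)
    (hT : 0 < T)
    {Rc : ℝ → Lp E 1 (volume.restrict Ω)} (hRc : ContinuousOn Rc (Icc 0 T))
    (hae : ∀ᵐ t ∂(volume.restrict (Ioo 0 T)), Rc t =ᵐ[volume.restrict Ω] fun x => R (t, x))
    (hβ : ContDiff ℝ 1 β) (hC : ∀ X, ‖fderiv ℝ β X‖ ≤ C)
    {t : ℝ} (ht : t ∈ Icc 0 T) :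
    ∫ x in Ω, β (Rc t x) = (∫ x in Ω, β (Rc 0 x)) +
      ∫ z in Ioo 0 t ×ˢ univ, (β (R z) - fderiv ℝ β (R z) (R z)) * divOf (A z) := by
  have hΩv : volume Ω ≠ ⊤ := h.isBounded.measure_lt_top.ne
  -- The truncations are bounded, are dominated by |β| and keep the gradient bound C, so dominated
  -- convergence removes them from every term.
  set b : ℕ → E → ℝ := fun n => arctanTrunc β (1 / ((n : ℝ) + 1)) with hb
  have hpos : ∀ n : ℕ, 0 < 1 / ((n : ℝ) + 1) := fun n => Nat.one_div_pos_of_nat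
  have hbd : ∀ n, ContDiff ℝ 1 (b n) := fun n => contDiff_arctanTrunc hβ _
  have hbC : ∀ n X, ‖fderiv ℝ (b n) X‖ ≤ C := fun n => norm_fderiv_arctanTrunc_le hβ hC (hpos n)
  have hl : ∀ s, Tendsto (fun n => ∫ x in Ω, b n (Rc s x)) atTop (𝓝 (∫ x in Ω, β (Rc s x))) := by
    intro s
    have hβi := integrable_comp_Lp hΩv hβ hC (Rc s)
    exact tendsto_integral_of_dominated_convergence (fun x => ‖β (Rc s x)‖)
      (fun n => (integrable_comp_Lp hΩv (hbd n) (hbC n) (Rc s)).1) hβi.norm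
      (fun n => ae_of_all _ fun x => abs_arctanTrunc_le (hpos n) _)
      (ae_of_all _ fun x => tendsto_arctanTrunc _)
  have l2 : Tendsto (fun n => ∫ z in Ioo 0 t ×ˢ univ,
      (b n (R z) - fderiv ℝ (b n) (R z) (R z)) * divOf (A z)) atTop
      (𝓝 (∫ z in Ioo 0 t ×ˢ univ, (β (R z) - fderiv ℝ β (R z) (R z)) * divOf (A z))) := by
    have k1 := integrable_comp_mul hβ hC h.memLp_R h.memLp_divOf h.integrable_divOf
    have k2 : Integrable fun z => ‖R z‖ * ‖divOf (A z)‖ :=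
      h.memLp_R.norm.integrable_mul h.memLp_divOf.norm
    refine tendsto_integral_of_dominated_convergence
      (fun z => ‖β (R z) * divOf (A z)‖ + C * (‖R z‖ * ‖divOf (A z)‖))
      (fun n => (h.integrable_source (hbd n) (hbC n)).1.restrict)
      (k1.norm.add (k2.const_mul C)).restrict
      (fun n => ae_of_all _ fun z => ?_) (ae_of_all _ fun z => ?_)
    · rw [norm_mul, norm_mul, ← mul_assoc, ← add_mul]
      gcongr
      refine (norm_sub_le _ _).trans (add_le_add (abs_arctanTrunc_le (hpos n) _) ?_)
      exact (fderiv ℝ (b n) (R z)).le_of_opNorm_le (hbC n _) _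
    · exact ((tendsto_arctanTrunc _).sub (tendsto_fderiv_arctanTrunc hβ _ _)).mul_const _
  refine tendsto_nhds_unique (hl t) (((hl 0).add l2).congr fun n => ?_)
  rw [h.setIntegral_comp_representative_of_bounded hT hRc hae (hbd n) (hbC n)
    (abs_arctanTrunc_le_const (hpos n)) ht]

/-- The initial value of the continuous representative. -/
theorem representative_zero_eq (h : IsTransportSolution T Ω u A R) (hT : 0 < T)
    {Rc : ℝ → Lp E 1 (volume.restrict Ω)} (hRc : ContinuousOn Rc (Icc 0 T))
    (hae : ∀ᵐ t ∂(volume.restrict (Ioo 0 T)), Rc t =ᵐ[volume.restrict Ω] fun x => R (t, x))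
    (ℓ : E →L[ℝ] ℝ) {r₀ : Space3 → ℝ} (hr₀ : LocallyIntegrableOn r₀ Ω)
    (hinit : ∀ φ : ℝ × Space3 → ℝ, IsTestOn (Iio T ×ˢ Ω) φ →
      (∫ z, fderiv ℝ φ z (1, u z) * ℓ (R z)) + (∫ x in Ω, r₀ x * φ (0, x)) = 0) :
    ∀ᵐ x ∂(volume.restrict Ω), ℓ (Rc 0 x) = r₀ x := by
  have hΩv : volume Ω ≠ ⊤ := h.isBounded.measure_lt_top.ne
  have hℓ : ContDiff ℝ 1 ℓ := ℓ.contDiff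
  have hℓC : ∀ X, ‖fderiv ℝ ℓ X‖ ≤ ‖ℓ‖ := fun X => by rw [ℓ.fderiv]
  have hm0 : LocallyIntegrableOn (fun x => ℓ (Rc 0 x)) Ω :=
    IntegrableOn.locallyIntegrableOn (integrable_comp_Lp hΩv hℓ hℓC (Rc 0))
  -- A time cutoff equal to 1 at t = 0 and supported before T, so that its products with χ see the
  -- initial value.
  obtain ⟨θ, hθ, hθ1⟩ : ∃ θ : ℝ → ℝ, IsTestOn (Iio T) θ ∧ θ 0 = 1 := by
    let f : ContDiffBump (0 : ℝ) := ⟨T / 4, T / 2, by positivity, by linarith⟩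
    refine ⟨f, ⟨f.contDiff, f.hasCompactSupport, ?_⟩,
      f.one_of_mem_closedBall (Metric.mem_closedBall_self f.rIn_pos.le)⟩
    rw [f.tsupport_eq]
    intro x hx
    have h1 : |x - 0| ≤ T / 2 := hx
    have h2 := le_abs_self (x - 0)
    exact show x < T by linarith
  have hsub := hm0.sub hr₀
  have key := h.isOpen.ae_eq_zero_of_integral_contDiff_smul_eq_zero hsub fun χ hχ1 hχ2 hχ3 => by
    have hχ : IsTestOn Ω χ := ⟨hχ1, hχ2, hχ3⟩
    obtain ⟨M, hM⟩ := hχ.1.continuous.bounded_above_of_compact_support hχ.2.1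
    obtain ⟨K, hK⟩ := hθ.1.continuous.bounded_above_of_compact_support hθ.2.1
    have hθ' : Continuous (deriv θ) := hθ.1.continuous_deriv (by simp)
    obtain ⟨K', hK'⟩ := hθ'.bounded_above_of_compact_support hθ.2.1.deriv
    have hθ'0 : ∀ t, T ≤ t → deriv θ t = 0 := fun t ht => by
      rw [← fderiv_apply_one_eq_deriv, hθ.fderiv_eq_zero_of_notMem (not_lt.2 ht)]
      simp
    set F : ℝ × Space3 → ℝ := fun z => ℓ (R z) * fderiv ℝ χ z.2 (u z) with hF
    have hFp : pairingRate u A R ℓ χ = F := by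
      funext z
      simp [pairingRate, hF]
    have hFi : Integrable F (volume.prod volume) := hFp ▸ h.integrable_pairingRate hℓ hℓC hχ
    have hF0 : ∀ s, s ∉ Ioo 0 T → ∫ x, F (s, x) = 0 := fun s hs => by
      have : ∀ x, F (s, x) = 0 := fun x => by
        rw [hF]
        simp only
        rw [h.zero_R (s, x) fun h' => hs h'.1, map_zero, zero_mul]
      simp [this]
    set b : ℝ × Space3 → ℝ := fun z => χ z.2 * ℓ (R z) with hb
    have hbi : Integrable b (volume.prod volume) :=
      integrable_bounded_smul (ℓ.integrable_comp h.integrable_R)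
        (hχ.1.continuous.comp continuous_snd).aestronglyMeasurable fun z => hM z.2
    set c : ℝ := ∫ x in Ω, χ x * ℓ (Rc 0 x) with hc
    have hmass : ∀ t ∈ Icc 0 T, ∫ x in Ω, χ x * ℓ (Rc t x) = c + ∫ s in 0..t, ∫ x, F (s, x) :=
      fun t ht => by
        rw [h.setIntegral_mul_comp_representative hT hRc hae hℓ hℓC hχ ht, hFp]
    have h1 := integral_deriv_smul_comp_primitive (β := fun x : ℝ => x) hFi.integral_prod_left 0 c
      contDiff_id (C := 1) (fun X => by rw [fderiv_fun_id]; exact ContinuousLinearMap.norm_id_le)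
      (hθ.1.of_le (by simp)) hθ.2.1
    -- For t ≤ 0 the extended solution vanishes and only c is left; on (0, T) the localized balance
    -- applies; from T on θ' is zero.
    have h2 : ∀ᵐ t, deriv θ t * (c + ∫ s in 0..t, ∫ x, F (s, x)) =
        (Iic 0).indicator (fun t => deriv θ t * c) t + deriv θ t * ∫ x, b (t, x) := by
      rw [ae_restrict_iff' measurableSet_Ioo] at hae
      filter_upwards [hae] with t ht
      by_cases ht0 : t ≤ 0
      · rw [indicator_of_mem (show t ∈ Iic 0 from ht0)]
        have e1 : ∫ s in 0..t, ∫ x, F (s, x) = 0 := by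
          rw [intervalIntegral.integral_symm, neg_eq_zero]
          refine intervalIntegral.integral_zero_ae (ae_of_all _ fun s hs => ?_)
          rw [uIoc_of_le ht0] at hs
          exact hF0 s fun h' => absurd hs.2 (not_le.2 h'.1)
        have e2 : ∀ x, b (t, x) = 0 := fun x => by
          rw [hb]
          simp only
          rw [h.zero_R (t, x) fun h' => absurd h'.1.1 (not_lt.2 ht0), map_zero, mul_zero]
        simp [e1, e2]
      · rw [indicator_of_notMem (show t ∉ Iic 0 from ht0), zero_add]
        by_cases htT : T ≤ t
        · simp [hθ'0 t htT]
        · have hmem : t ∈ Ioo 0 T := ⟨not_le.1 ht0, not_le.1 htT⟩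
          rw [← hmass t (Ioo_subset_Icc_self hmem),
            ← setIntegral_eq_integral_of_forall_compl_eq_zero (s := Ω) (f := fun x => b (t, x))]
          · congr 1
            refine integral_congr_ae ?_
            filter_upwards [ht hmem] with x hx
            rw [hx]
          · intro x hx
            simp [hb, hχ.eq_zero_of_notMem hx]
    have i1 : Integrable fun t => deriv θ t * ∫ x, b (t, x) :=
      integrable_bounded_smul hbi.integral_prod_left hθ'.aestronglyMeasurable hK'
    have i2 : Integrable fun t => θ t * ∫ x, F (t, x) :=
      integrable_bounded_smul hFi.integral_prod_left hθ.1.continuous.aestronglyMeasurable hK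
    have i3 : Integrable ((Iic 0).indicator fun t => deriv θ t * c) :=
      ((hθ'.integrable_of_hasCompactSupport hθ.2.1.deriv).mul_const c).indicator measurableSet_Iic
    have i12 : Integrable fun t => (deriv θ t * ∫ x, b (t, x)) + θ t * ∫ x, F (t, x) := i1.add i2
    -- The integral of θ' over t ≤ 0 is θ(0) = 1, so c takes the place held by ∫ r₀χ in the
    -- formulation with initial data. Comparing the two identities gives equality for every χ.
    have h3 : c + ((∫ t, deriv θ t * ∫ x, b (t, x)) + ∫ t, θ t * ∫ x, F (t, x)) = 0 := by
      rw [← h1, ← integral_add i1 i2]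
      have e3 : c = ∫ t, (Iic 0).indicator (fun t => deriv θ t * c) t := by
        rw [integral_indicator measurableSet_Iic, integral_mul_const,
          hθ.2.1.integral_Iic_deriv_eq (hθ.1.of_le (by simp)), hθ1, one_mul]
      nth_rewrite 1 [e3]
      rw [← integral_add i3 i12]
      refine integral_congr_ae ?_
      filter_upwards [h2] with t ht
      simp only [smul_eq_mul, fderiv_fun_id, ContinuousLinearMap.coe_id', id_eq, ht]
      ring
    have j1 : Integrable (fun z : ℝ × Space3 => deriv θ z.1 * b z) (volume.prod volume) :=
      integrable_bounded_smul hbi (hθ'.comp continuous_fst).aestronglyMeasurable fun z => hK' z.1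
    have j2 : Integrable (fun z : ℝ × Space3 => θ z.1 * F z) (volume.prod volume) :=
      integrable_bounded_smul hFi (hθ.1.continuous.comp continuous_fst).aestronglyMeasurable
        fun z => hK z.1
    have h4 : ∫ z, fderiv ℝ (fun z : ℝ × Space3 => θ z.1 * χ z.2) z (1, u z) * ℓ (R z) =
        (∫ t, deriv θ t * ∫ x, b (t, x)) + ∫ t, θ t * ∫ x, F (t, x) := by
      simp_rw [← integral_const_mul]
      rw [← integral_prod _ j1, ← integral_prod _ j2, ← integral_add j1 j2,
        ← Measure.volume_eq_prod]
      refine integral_congr_ae (ae_of_all _ fun z => ?_)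
      simp only [fderiv_time_mul_space hθ.differentiable hχ.differentiable, hb, hF]
      ring
    have h5 := hinit _ (hθ.time_mul_space hχ)
    rw [h4] at h5
    simp only [hθ1, one_mul] at h5
    have k1 : IntegrableOn (fun x => χ x * ℓ (Rc 0 x)) Ω :=
      integrable_bounded_smul (integrable_comp_Lp hΩv hℓ hℓC (Rc 0))
        hχ.1.continuous.aestronglyMeasurable hM
    have k2 : IntegrableOn (fun x => χ x * r₀ x) Ω := by
      have k3 : IntegrableOn r₀ (tsupport χ) :=
        hr₀.integrableOn_compact_subset hχ.2.2 hχ.2.1.isCompact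
      have k4 : IntegrableOn (fun x => χ x * r₀ x) (tsupport χ) :=
        integrable_bounded_smul k3 hχ.1.continuous.aestronglyMeasurable hM
      refine ((integrableOn_iff_integrable_of_support_subset fun x hx => ?_).1 k4).integrableOn
      exact subset_tsupport _ fun h0 => hx (by simp [h0])
    rw [← setIntegral_eq_integral_of_forall_compl_eq_zero (s := Ω)]
    · simp only [smul_eq_mul, Pi.sub_apply, mul_sub]
      rw [integral_sub k1 k2]
      simp_rw [mul_comm (χ _) (r₀ _)]
      linarith
    · intro x hx
      simp [hχ.eq_zero_of_notMem hx]
  rw [ae_restrict_iff' h.isOpen.measurableSet]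
  filter_upwards [key] with x hx hxΩ
  exact sub_eq_zero.1 (hx hxΩ)

end IsTransportSolution

/-! ### Extension by zero -/

section ZeroExtension

variable {F : Type*} [NormedAddCommGroup F] {T : ℝ} {Ω : Set Space3}

/-- Extension by zero of a strongly measurable representative. -/
theorem MemL2L2.exists_extension (hΩ : IsOpen Ω) {f : ℝ → Space3 → F} (hf : MemL2L2 T Ω f) :
    ∃ g : ℝ × Space3 → F, StronglyMeasurable g ∧ MemLp g 2 volume ∧
      (∀ z, z ∉ cyl T Ω → g z = 0) ∧ ∀ᵐ z ∂(volume.restrict (cyl T Ω)), g z = f z.1 z.2 := by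
  have hm : MeasurableSet (cyl T Ω) := (isOpen_Ioo.prod hΩ).measurableSet
  have hae : ∀ᵐ z ∂(volume.restrict (cyl T Ω)),
      (cyl T Ω).indicator (hf.1.mk _) z = f z.1 z.2 := by
    filter_upwards [hf.1.ae_eq_mk, ae_restrict_mem hm] with z hz hmem
    rw [indicator_of_mem hmem, hz]
  refine ⟨(cyl T Ω).indicator (hf.1.mk _), hf.1.stronglyMeasurable_mk.indicator hm,
    (memLp_indicator_iff_restrict hm).2 ((memLp_congr_ae hf.1.ae_eq_mk).1 hf),
    fun z hz => indicator_of_notMem hz _, hae⟩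

theorem ae_ae_of_ae_cyl {p : ℝ × Space3 → Prop} (h : ∀ᵐ z ∂(volume.restrict (cyl T Ω)), p z) :
    ∀ᵐ t ∂(volume.restrict (Ioo 0 T)), ∀ᵐ x ∂(volume.restrict Ω), p (t, x) := by
  rw [cyl, Measure.volume_eq_prod, ← Measure.prod_restrict] at h
  exact Measure.ae_ae_of_ae_prod h

theorem eLpNorm_eq_restrict (hΩ : IsOpen Ω) {f : Space3 → F} (hf : ∀ x, x ∉ Ω → f x = 0)
    (p : ℝ≥0∞) : eLpNorm f p volume = eLpNorm f p (volume.restrict Ω) := by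
  rw [← eLpNorm_indicator_eq_eLpNorm_restrict hΩ.measurableSet, indicator_eq_self.2]
  intro x hx
  by_contra h
  exact hx (hf x h)

/-- The approximating fields and the extended functions all vanish outside Ω, so distances over Ω
and over the whole space coincide. -/
theorem MemH10.isH10Limit (hΩ : IsOpen Ω) {v v' : Space3 → Space3}
    {G G' : Space3 → Space3 →L[ℝ] Space3} (h : MemH10 Ω v G)
    (hv : v' =ᵐ[volume.restrict Ω] v) (hG : G' =ᵐ[volume.restrict Ω] G)
    (hv0 : ∀ x, x ∉ Ω → v' x = 0) (hG0 : ∀ x, x ∉ Ω → G' x = 0) : IsH10Limit Ω v' G' := by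
  obtain ⟨-, φ, hφ, h1, h2⟩ := h
  refine ⟨φ, hφ, h1.congr fun n => ?_, h2.congr fun n => ?_⟩
  · rw [eLpNorm_eq_restrict hΩ fun x hx => by
      rw [hv0 x hx, (hφ n).eq_zero_of_notMem hx, sub_zero]]
    refine eLpNorm_congr_ae ?_
    filter_upwards [hv] with x hx
    rw [hx]
  · rw [eLpNorm_eq_restrict hΩ fun x hx => by
      rw [hG0 x hx, (hφ n).fderiv_eq_zero_of_notMem hx, sub_zero]]
    refine eLpNorm_congr_ae ?_
    filter_upwards [hG] with x hx
    rw [hx]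

theorem isH10Limit_zero (Ω : Set Space3) : IsH10Limit Ω (fun _ => 0) (fun _ => 0) :=
  by
  have h0 : ∀ F : Type, ∀ _ : NormedAddCommGroup F, eLpNorm (fun _ : Space3 => (0 : F)) 2 volume = 0 :=
    fun F _ => eLpNorm_zero'
  exact ⟨fun _ _ => 0, fun _ => IsTestOn.zero Ω, by simp [h0], by simp [h0]⟩

end ZeroExtension

/-- The weak formulation after extension by zero. -/
theorem integral_fderiv_one_mul_eq {T : ℝ} {Ω : Set Space3}
    {u : ℝ → Space3 → Space3} {r : ℝ → Space3 → ℝ} {u' : ℝ × Space3 → Space3}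
    {r' : ℝ × Space3 → ℝ} (hu : ∀ᵐ z ∂(volume.restrict (cyl T Ω)), u' z = u z.1 z.2)
    (hr : ∀ᵐ z ∂(volume.restrict (cyl T Ω)), r' z = r z.1 z.2)
    (hr0 : ∀ z, z ∉ cyl T Ω → r' z = 0) (φ : ℝ × Space3 → ℝ) :
    ∫ z, fderiv ℝ φ z (1, u' z) * r' z = ∫ z in cyl T Ω,
      (r z.1 z.2 * fderiv ℝ φ z (1, 0) + r z.1 z.2 * fderiv ℝ φ z (0, u z.1 z.2)) := by
  rw [← setIntegral_eq_integral_of_forall_compl_eq_zero (s := cyl T Ω) fun z hz => by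
    rw [hr0 z hz, mul_zero]]
  refine integral_congr_ae ?_
  filter_upwards [hu, hr] with z hz1 hz2
  have e : ((1 : ℝ), u z.1 z.2) = (1, 0) + (0, u z.1 z.2) := by simp
  rw [hz1, hz2, e, map_add]
  ring

/-- Extension by zero turns a weak solution on the cylinder into an `IsTransportSolution`. -/
theorem exists_isTransportSolution {N : ℕ} {T : ℝ} {Ω : Set Space3} (hΩ : IsOpen Ω)
    (hΩb : Bornology.IsBounded Ω) {R : ℝ → Space3 → EuclideanSpace ℝ (Fin N)}
    {u : ℝ → Space3 → Space3} {Du : ℝ → Space3 → Space3 →L[ℝ] Space3}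
    (hR : MemL2L2 T Ω R) (hu : MemL2H10 T Ω u Du)
    (hEq : ∀ i : Fin N, SolvesTransport T Ω u (fun t x => R t x i) (fun _ _ => 0)) :
    ∃ (u' : ℝ × Space3 → Space3) (A' : ℝ × Space3 → Space3 →L[ℝ] Space3)
      (R' : ℝ × Space3 → EuclideanSpace ℝ (Fin N)), IsTransportSolution T Ω u' A' R' ∧
      ∀ᵐ z ∂(volume.restrict (cyl T Ω)),
        u' z = u z.1 z.2 ∧ A' z = Du z.1 z.2 ∧ R' z = R z.1 z.2 := by
  obtain ⟨hu1, hu2, hu3⟩ := hu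
  obtain ⟨R', mR, lR, zR, eR⟩ := hR.exists_extension hΩ
  obtain ⟨u', mu, lu, zu, eu⟩ := hu1.exists_extension hΩ
  obtain ⟨A', mA, lA, zA, eA⟩ := hu2.exists_extension hΩ
  refine ⟨u', A', R', ⟨hΩ, hΩb, mu, mA, mR, lu, lA, lR, zu, zA, zR, ?_, fun φ hφ => ?_⟩, ?_⟩
  · have h3 := ae_ae_of_ae_cyl eu
    have h4 := ae_ae_of_ae_cyl eA
    rw [ae_restrict_iff' measurableSet_Ioo] at hu3 h3 h4
    filter_upwards [hu3, h3, h4] with t t1 t2 t3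
    by_cases ht : t ∈ Ioo 0 T
    -- Inside (0, T) the hypothesis on u(t) is used; at other times the slices are zero and are
    -- trivially H¹₀ limits.
    · exact (t1 ht).isH10Limit hΩ (t2 ht) (t3 ht) (fun x hx => zu _ fun h => hx h.2)
        fun x hx => zA _ fun h => hx h.2
    · have e1 : (fun x => u' (t, x)) = fun _ => 0 := funext fun x => zu _ fun h => ht h.1
      have e2 : (fun x => A' (t, x)) = fun _ => 0 := funext fun x => zA _ fun h => ht h.1
      rw [e1, e2]
      exact isH10Limit_zero Ω
  · have hi : Integrable fun z => fderiv ℝ φ z (1, u' z) • R' z :=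
      (lu.fderiv_one_apply (hφ.1.of_le (by simp)) hφ.2.1).integrable_smul' lR
    ext i
    have h1 := (EuclideanSpace.proj (𝕜 := ℝ) i).integral_comp_comm hi
    have h2 := (hEq i).2.2.2 φ hφ
    simp only [zero_mul, sub_zero] at h2
    have h3 := integral_fderiv_one_mul_eq eu (r := fun t x => R t x i) (r' := fun z => R' z i)
      (eR.mono fun z hz => by rw [hz]) (fun z hz => by rw [zR z hz]; rfl) φ
    rw [h2] at h3
    simpa [h3] using h1.symm
  · filter_upwards [eu, eA, eR] with z h1 h2 h3
    exact ⟨h1, h2, h3⟩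

/-! ### Return to the original functions -/

section Transfer

variable {N : ℕ} {T : ℝ} {Ω : Set Space3} {R : ℝ → Space3 → EuclideanSpace ℝ (Fin N)}
  {u : ℝ → Space3 → Space3} {Du : ℝ → Space3 → Space3 →L[ℝ] Space3}
  {u' : ℝ × Space3 → Space3} {A' : ℝ × Space3 → Space3 →L[ℝ] Space3}
  {R' : ℝ × Space3 → EuclideanSpace ℝ (Fin N)} {β : EuclideanSpace ℝ (Fin N) → ℝ} {C : ℝ}

theorem renormSource_ae_eq
    (hae : ∀ᵐ z ∂(volume.restrict (cyl T Ω)),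
      u' z = u z.1 z.2 ∧ A' z = Du z.1 z.2 ∧ R' z = R z.1 z.2) :
    (fun z => -((β (R' z) - fderiv ℝ β (R' z) (R' z)) * divOf (A' z)))
      =ᵐ[volume.restrict (cyl T Ω)] fun z => renormSource β R Du z.1 z.2 := by
  filter_upwards [hae] with z hz
  rw [renormSource, hz.2.1, hz.2.2]
  ring

namespace IsTransportSolution

theorem integrableOn_renormSource (h : IsTransportSolution T Ω u' A' R')
    (hae : ∀ᵐ z ∂(volume.restrict (cyl T Ω)),
      u' z = u z.1 z.2 ∧ A' z = Du z.1 z.2 ∧ R' z = R z.1 z.2)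
    (hβ : ContDiff ℝ 1 β) (hC : ∀ X, ‖fderiv ℝ β X‖ ≤ C) :
    IntegrableOn (fun z : ℝ × Space3 => renormSource β R Du z.1 z.2) (cyl T Ω) :=
  (h.integrable_source hβ hC).neg.restrict.congr (renormSource_ae_eq hae)

/-- Linear growth of β together with R, u and div u in L² on a set of finite measure gives the
integrability; the identity is the renormalized equation of the extensions, whose integrand vanishes
off the cylinder because φ does. -/
theorem solvesTransport_comp (h : IsTransportSolution T Ω u' A' R')
    (hae : ∀ᵐ z ∂(volume.restrict (cyl T Ω)),
      u' z = u z.1 z.2 ∧ A' z = Du z.1 z.2 ∧ R' z = R z.1 z.2)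
    (hβ : ContDiff ℝ 1 β) (hC : ∀ X, ‖fderiv ℝ β X‖ ≤ C) :
    SolvesTransport T Ω u (fun t x => β (R t x)) (renormSource β R Du) := by
  have : IsFiniteMeasure (volume.restrict (cyl T Ω)) := ⟨by simpa using h.volume_cyl_lt_top⟩
  have hβR := hβ.continuous.comp_aestronglyMeasurable h.memLp_R.1
  refine ⟨?_, ?_, (h.integrableOn_renormSource hae hβ hC).locallyIntegrableOn, fun φ hφ => ?_⟩
  · have h1 : IntegrableOn (fun z => β (R' z)) (cyl T Ω) :=
      ((integrable_const ‖β 0‖).add (h.integrable_R.restrict.norm.const_mul C)).mono' hβR.restrict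
        (ae_of_all _ fun z => norm_comp_le_of_fderiv_bound hβ hC (R' z))
    refine IntegrableOn.locallyIntegrableOn (h1.congr ?_)
    filter_upwards [hae] with z hz
    rw [hz.2.2]
  · have h1 : Integrable fun z => β (R' z) * ‖u' z‖ :=
      integrable_comp_mul hβ hC h.memLp_R h.memLp_u.norm
        (h.integrable_of_memLp h.memLp_u h.zero_u).norm
    have h2 : Integrable fun z => β (R' z) • u' z :=
      h1.mono (hβR.smul h.memLp_u.1) (ae_of_all _ fun z => by simp [norm_smul])
    refine IntegrableOn.locallyIntegrableOn (h2.integrableOn.congr ?_)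
    filter_upwards [hae] with z hz
    rw [hz.1, hz.2.2]
  · refine Eq.trans ?_ (h.renormalized hβ hC hφ)
    have h1 := setIntegral_eq_integral_of_forall_compl_eq_zero (μ := volume) (s := cyl T Ω)
      (f := fun z => fderiv ℝ φ z (1, u' z) * β (R' z)
        + (β (R' z) - fderiv ℝ β (R' z) (R' z)) * divOf (A' z) * φ z) fun z hz => by
          simp [hφ.eq_zero_of_notMem hz, hφ.fderiv_eq_zero_of_notMem hz]
    rw [← h1]
    refine integral_congr_ae ?_
    filter_upwards [hae] with z hz
    have e : ((1 : ℝ), u z.1 z.2) = (1, 0) + (0, u z.1 z.2) := by simp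
    rw [renormSource, hz.1, hz.2.1, hz.2.2, e, map_add]
    ring

theorem setIntegral_source_eq (h : IsTransportSolution T Ω u' A' R')
    (hae : ∀ᵐ z ∂(volume.restrict (cyl T Ω)),
      u' z = u z.1 z.2 ∧ A' z = Du z.1 z.2 ∧ R' z = R z.1 z.2) {t : ℝ} (ht : t ≤ T) :
    ∫ z in Ioo 0 t ×ˢ univ, (β (R' z) - fderiv ℝ β (R' z) (R' z)) * divOf (A' z) =
      -∫ z in cyl t Ω, renormSource β R Du z.1 z.2 := by
  have hsub : cyl t Ω ⊆ cyl T Ω := prod_mono (Ioo_subset_Ioo_right ht) Subset.rfl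
  rw [setIntegral_eq_of_subset_of_forall_sdiff_eq_zero (s := cyl t Ω)
    (measurableSet_Ioo.prod MeasurableSet.univ) (prod_mono Subset.rfl (subset_univ _)),
    ← integral_neg]
  · refine integral_congr_ae ?_
    filter_upwards [ae_restrict_of_ae_restrict_of_subset hsub
      (renormSource_ae_eq (β := β) hae)] with z hz
    rw [← hz, neg_neg]
  · intro z hz
    rw [h.zero_A z fun hz' => hz.2 ⟨hz.1.1, hz'.2⟩]
    simp [divOf]

end IsTransportSolution

end Transfer

theorem mainTheorem3 {N : ℕ} (T : ℝ) (hT : 0 < T)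
    (Ω : Set Space3) (hΩ : IsOpen Ω) (hΩb : Bornology.IsBounded Ω)
    (R : ℝ → Space3 → EuclideanSpace ℝ (Fin N))
    (u : ℝ → Space3 → Space3) (Du : ℝ → Space3 → Space3 →L[ℝ] Space3)
    (hR : MemL2L2 T Ω R) (hu : MemL2H10 T Ω u Du)
    (hEq : ∀ i : Fin N, SolvesTransport T Ω u (fun t x => R t x i) (fun _ _ => 0)) :
    (∀ β : EuclideanSpace ℝ (Fin N) → ℝ, IsC1BoundedGradient β →
      SolvesTransport T Ω u (fun t x => β (R t x)) (renormSource β R Du)) ∧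
    (∀ γ : ℝ, 1 < γ → MemLinftyLp T Ω γ R →
      ∃ Rc : ℝ → Lp (EuclideanSpace ℝ (Fin N)) 1 (volume.restrict Ω),
        ContinuousOn Rc (Icc 0 T) ∧
        (∀ᵐ t ∂(volume.restrict (Ioo 0 T)), Rc t =ᵐ[volume.restrict Ω] R t) ∧
        ∀ R₀ : Space3 → EuclideanSpace ℝ (Fin N),
          (∀ i : Fin N, SolvesTransportWithInitial T Ω u (fun t x => R t x i)
            (fun x => R₀ x i)) →
          Rc 0 =ᵐ[volume.restrict Ω] R₀ ∧
          ∀ β : EuclideanSpace ℝ (Fin N) → ℝ, IsC1BoundedGradient β →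
            IntegrableOn (fun x => β (R₀ x)) Ω ∧
            IntegrableOn (fun z : ℝ × Space3 => renormSource β R Du z.1 z.2) (cyl T Ω) ∧
            ∀ t ∈ Icc 0 T,
              IntegrableOn (fun x => β (Rc t x)) Ω ∧
              ∫ x in Ω, β (Rc t x) =
                (∫ x in Ω, β (R₀ x)) - ∫ z in cyl t Ω, renormSource β R Du z.1 z.2) := by
  obtain ⟨u', A', R', h, hae⟩ := exists_isTransportSolution hΩ hΩb hR hu hEq
  refine ⟨fun β ⟨hβ, C, hC⟩ => h.solvesTransport_comp hae hβ hC, fun γ hγ ⟨_, C, hC⟩ => ?_⟩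
  have hslice : ∀ᵐ t ∂(volume.restrict (Ioo 0 T)),
      (fun x => R' (t, x)) =ᵐ[volume.restrict Ω] R t :=
    ae_ae_of_ae_cyl (hae.mono fun z hz => hz.2.2)
  have hC' : ∀ᵐ t ∂(volume.restrict (Ioo 0 T)),
      eLpNorm (fun x => R' (t, x)) (ENNReal.ofReal γ) volume ≤ C := by
    filter_upwards [hC, hslice] with t h1 h2
    rw [eLpNorm_eq_restrict hΩ fun x hx => h.zero_R _ fun h' => hx h'.2]
    rwa [eLpNorm_congr_ae h2]
  obtain ⟨Rc, hRc, hRc'⟩ := h.exists_continuousOn_representative hT hγ hC'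
  refine ⟨Rc, hRc, ?_, fun R₀ hR₀ => ?_⟩
  · filter_upwards [hRc', hslice] with t h1 h2
    exact h1.trans h2
  have h0 : Rc 0 =ᵐ[volume.restrict Ω] R₀ := by
    -- The initial value is identified coordinate by coordinate, with the coordinate projections as
    -- linear functionals.
    have h1 : ∀ i : Fin N, ∀ᵐ x ∂(volume.restrict Ω), Rc 0 x i = R₀ x i := fun i => by
      refine h.representative_zero_eq hT hRc hRc' (EuclideanSpace.proj (𝕜 := ℝ) i) (hR₀ i).1
        fun φ hφ => ?_
      have h2 := integral_fderiv_one_mul_eq (r := fun t x => R t x i) (r' := fun z => R' z i)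
        (hae.mono fun z hz => hz.1) (hae.mono fun z hz => by rw [hz.2.2])
        (fun z hz => by rw [h.zero_R z hz]; rfl) φ
      refine Eq.trans ?_ ((hR₀ i).2 φ hφ)
      rw [← h2]
      rfl
    filter_upwards [ae_all_iff.2 h1] with x hx
    ext i
    exact hx i
  refine ⟨h0, fun β ⟨hβ, C', hC'⟩ => ?_⟩
  have hβi : ∀ t, IntegrableOn (fun x => β (Rc t x)) Ω := fun t =>
    integrable_comp_Lp hΩb.measure_lt_top.ne hβ hC' (Rc t)
  have e0 : (fun x => β (Rc 0 x)) =ᵐ[volume.restrict Ω] fun x => β (R₀ x) :=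
    h0.fun_comp β
  refine ⟨(hβi 0).congr e0, h.integrableOn_renormSource hae hβ hC', fun t ht => ⟨hβi t, ?_⟩⟩
  rw [h.setIntegral_comp_representative hT hRc hRc' hβ hC' ht, h.setIntegral_source_eq hae ht.2,
    integral_congr_ae e0, sub_eq_add_neg]
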